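/- Let $V:\mathbb R^2\to\mathbb R$ be measurable, put $v=|V|^{1/2}$, $U=1$ where $V\ge 0$ and $U=-1$ where $V<0$, and assume that for some $C$ and some $\delta>0$ one has $v(x)\le C\langle x\rangle^{-3-\delta}$ for all $x$, where $\langle x\rangle=(1+|x|^2)^{1/2}$. Let $G_0f(x)=-\frac1{2\pi}\int_{\mathbb R^2}\log|x-y|\,f(y)\,dy$ and $T=U+vG_0v$ on $L^2(\mathbb R^2)$, let $P$ be the orthogonal projection onto the span of $v$, $Q=1-P$, and let $S_1$ be the (orthogonal) Riesz projection onto the kernel of $QTQ$ as an operator on $QL^2(\mathbb R^2)$. Assume that there is a resonance of the first kind (an s-wave resonance only) at zero, that is, $QTQ$ is not invertible on $QL^2(\mathbb R^2)$ and $T_1=S_1TPTS_1$ is invertible on $S_1L^2(\mathbb R^2)$, and let $D_1=T_1^{-1}$ on $S_1L^2(\mathbb R^2)$. Let $R_0^\pm(\lambda^2)$ be the limiting free resolvents of $-\Delta$, with kernels $R_0^\pm(\lambda^2)(x,y)=\pm\frac i4H_0^\pm(\lambda|x-y|)$, $H_0^\pm=J_0\pm iY_0$. Let $h^-(\lambda)=a\log\lambda+z+b$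 with $a,b\in\mathbb R$ and $z\in\mathbb C$, let $\lambda_1>0$, and let $\chi\in C^\infty(\mathbb R)$ be real-valued with $\chi(\lambda)=1$ for $0<\lambda<\lambda_1$ and $\chi(\lambda)=0$ for $\lambda>2\lambda_1$. Consider $$Au=\frac1{\pi i}\int_0^\infty h^-(\lambda)\,R_0^-(\lambda^2)\,v\,S_1D_1S_1\,v\,\big[R_0^+(\lambda^2)-R_0^-(\lambda^2)\big]\lambda\,\chi(\lambda)\,u\,d\lambda .$$ For every $u\in L^1(\mathbb R^2)$ all integrals in the definition of $Au(x)$ converge absolutely, for every $x\in\mathbb R^2$, and $S_1D_1S_1$ is there applied to elements of $L^2(\mathbb R^2)$. For every $1\le p\le\infty$ the operator $A$, defined on $L^1(\mathbb R^2)\cap L^p(\mathbb R^2)$, extends to a bounded operator on $L^p(\mathbb R^2)$; the extension can be chosen such that for every $u\in L^p(\mathbb R^2)$ it is given by $\lim_{R\to\infty}A(\mathbf 1_{\{|y|<R\}}u)(x)$ for almost every $x$. -/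

import Mathlib

open MeasureTheory Filter Topology
open scoped ENNReal ContDiff

noncomputable section

namespace PlanarSchrodinger

/-- The Euclidean plane `ℝ²`. -/
abbrev Plane : Type := EuclideanSpace ℝ (Fin 2)

/-- The complex Hilbert space `L²(ℝ²)`. -/
abbrev L2 : Type := Lp ℂ 2 (volume : Measure Plane)

/-- The bracket `⟨x⟩ = (1 + |x|²)^{1/2}`. -/
def bracket (x : Plane) : ℝ := Real.sqrt (1 + ‖x‖ ^ 2)

/-! ### Bessel and Hankel functions of order zero on the positive half-line -/

/-- The Bessel function of the first kind
`J₀(r) = (1/π) ∫_0^π cos (r sin θ) dθ`. -/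
def besselJ0 (r : ℝ) : ℝ :=
  1 / Real.pi * ∫ θ in (0 : ℝ)..Real.pi, Real.cos (r * Real.sin θ)

/-- The Bessel function of the second kind, for `r > 0`:
`Y₀(r) = (1/π) ∫_0^π sin (r sin θ) dθ - (2/π) ∫_0^∞ exp (-r sinh t) dt`. -/
def besselY0 (r : ℝ) : ℝ :=
  1 / Real.pi * (∫ θ in (0 : ℝ)..Real.pi, Real.sin (r * Real.sin θ)) -
    2 / Real.pi * ∫ t in Set.Ioi (0 : ℝ), Real.exp (-(r * Real.sinh t))

/-- The Hankel function `H₀⁺ = J₀ + i Y₀`. -/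
def hankelPlus (r : ℝ) : ℂ := (besselJ0 r : ℂ) + Complex.I * (besselY0 r : ℂ)

/-- The Hankel function `H₀⁻ = J₀ - i Y₀`. -/
def hankelMinus (r : ℝ) : ℂ := (besselJ0 r : ℂ) - Complex.I * (besselY0 r : ℂ)

/-- The integral kernel `(i/4) H₀⁺(lam |x - y|)` of the free resolvent `R₀⁺(lam²)` of `-Δ`. -/
def freeResolventPlus (lam : ℝ) (x y : Plane) : ℂ :=
  Complex.I / 4 * hankelPlus (lam * ‖x - y‖)

/-- The integral kernel `-(i/4) H₀⁻(lam |x - y|)` of the free resolvent `R₀⁻(lam²)` of `-Δ`. -/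
def freeResolventMinus (lam : ℝ) (x y : Plane) : ℂ :=
  -(Complex.I / 4) * hankelMinus (lam * ‖x - y‖)

/-! ### The threshold operators -/

/-- `v = |V|^{1/2}`. -/
def sqrtAbs (V : Plane → ℝ) (x : Plane) : ℝ := Real.sqrt |V x|

/-- `U = 1` where `V ≥ 0` and `U = -1` where `V < 0`, so that `V = U v²`. -/
def signOf (V : Plane → ℝ) (x : Plane) : ℝ := if 0 ≤ V x then 1 else -1

/-- `G₀ f(x) = -(1/2π) ∫ log |x - y| f(y) dy`. -/
def logPotential (f : Plane → ℂ) (x : Plane) : ℂ :=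
  -(1 / (2 * (Real.pi : ℂ))) * ∫ y : Plane, (Real.log ‖x - y‖ : ℂ) * f y

/-- `A` is the operator `U + v G₀ v` on `L²(ℝ²)`. -/
def IsThresholdOp (V : Plane → ℝ) (A : L2 →L[ℂ] L2) : Prop :=
  ∀ f : L2, ∀ᵐ x : Plane, A f x =
    (signOf V x : ℂ) * f x +
      (sqrtAbs V x : ℂ) * logPotential (fun y => (sqrtAbs V y : ℂ) * f y) x

theorem log_sq_le (t : ℝ) (ht : 0 ≤ t) : Real.log t ^ 2 ≤ 4 * (t + t⁻¹) := by
  rcases ht.eq_or_lt with rfl | ht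
  · simp
  have key : ∀ s : ℝ, 1 ≤ s → Real.log s ^ 2 ≤ 4 * s := by
    intro s hs
    have h := Real.log_le_rpow_div (show 0 ≤ s by linarith) (show (0 : ℝ) < 1 / 2 by norm_num)
    rw [← Real.sqrt_eq_rpow] at h
    have h0 := Real.log_nonneg hs
    have h1 := Real.sq_sqrt (show 0 ≤ s by linarith)
    have h2 : Real.log s ≤ 2 * Real.sqrt s := by linarith
    nlinarith [Real.sqrt_nonneg s]
  rcases le_total 1 t with h | h
  · have := key t h
    have : 0 < t⁻¹ := inv_pos.2 ht
    nlinarith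
  · have := key t⁻¹ ((one_le_inv₀ ht).2 h)
    rw [Real.log_inv] at this
    nlinarith

theorem measurable_sqrtAbs {V : Plane → ℝ} (hV : Measurable V) : Measurable (sqrtAbs V) := by
  unfold sqrtAbs
  fun_prop

theorem measurable_signOf {V : Plane → ℝ} (hV : Measurable V) : Measurable (signOf V) :=
  Measurable.ite (measurableSet_le measurable_const hV) measurable_const measurable_const

/-- The logarithmic kernel is square integrable against a rapidly decaying weight. -/
theorem log_kernel_bound {V : Plane → ℝ} (hV : Measurable V)
    (hdecay : ∃ C δ : ℝ, 0 < δ ∧ ∀ x : Plane, sqrtAbs V x ≤ C * bracket x ^ (-3 - δ)) :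
    ∃ E : ℝ, (∀ x : Plane,
        Integrable (fun y : Plane => (Real.log ‖x - y‖ * sqrtAbs V y) ^ 2) ∧
        ∫ y : Plane, (Real.log ‖x - y‖ * sqrtAbs V y) ^ 2 ≤ E * (1 + ‖x‖)) ∧
      Integrable (fun x : Plane => sqrtAbs V x ^ 2 * (1 + ‖x‖)) := by
  obtain ⟨C, δ, hδ, hC⟩ := hdecay
  have hw := measurable_sqrtAbs hV
  have hfin : Module.finrank ℝ Plane = 2 := by simp
  set j : Plane → ℝ := fun y => ((1 : ℝ) + ‖y‖ ^ 2) ^ (-(4 : ℝ) / 2) with hj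
  have hji : Integrable j := integrable_rpow_neg_one_add_norm_sq (by rw [hfin]; norm_num)
  have hj0 : ∀ y, 0 ≤ j y := fun y => by positivity
  set s : Plane → ℝ := (Metric.ball (0 : Plane) 1).indicator (fun u => ‖u‖⁻¹) with hs
  have hsi : Integrable s := by
    rw [hs, integrable_indicator_iff measurableSet_ball]
    refine integrableOn_ball_of_norm_le_rpow (C := 1) (α := 1) (by rw [hfin]; norm_num)
      (by rw [hfin]; norm_num) ?_ (by fun_prop)
    refine Eventually.of_forall fun x => ?_
    simp [Real.rpow_neg_one]
  have hs0 : ∀ u, 0 ≤ s u := fun u => Set.indicator_nonneg (fun u _ => by positivity) u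
  set D : ℝ := C ^ 2 with hD
  have hD0 : 0 ≤ D := by positivity
  have hw1 : ∀ y, sqrtAbs V y ^ 2 * (1 + ‖y‖ ^ 2) ≤ D * j y := by
    intro y
    have hb : (1 : ℝ) ≤ 1 + ‖y‖ ^ 2 := by nlinarith [sq_nonneg ‖y‖]
    have h1 : sqrtAbs V y ^ 2 ≤ (C * bracket y ^ (-3 - δ)) ^ 2 :=
      pow_le_pow_left₀ (Real.sqrt_nonneg _) (hC y) 2
    have h2 : (bracket y ^ (-3 - δ)) ^ 2 ≤ (1 + ‖y‖ ^ 2) ^ (-3 : ℝ) := by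
      rw [bracket, Real.sqrt_eq_rpow, ← Real.rpow_mul (by positivity), ← Real.rpow_natCast,
        ← Real.rpow_mul (by positivity)]
      apply Real.rpow_le_rpow_of_exponent_le hb
      push_cast
      linarith
    have h3 : (1 + ‖y‖ ^ 2) ^ (-3 : ℝ) * (1 + ‖y‖ ^ 2) = j y := by
      rw [hj]
      nth_rewrite 2 [← Real.rpow_one (1 + ‖y‖ ^ 2)]
      rw [← Real.rpow_add (by positivity)]
      norm_num
    calc sqrtAbs V y ^ 2 * (1 + ‖y‖ ^ 2)
        ≤ (C * bracket y ^ (-3 - δ)) ^ 2 * (1 + ‖y‖ ^ 2) := by gcongr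
      _ = D * ((bracket y ^ (-3 - δ)) ^ 2 * (1 + ‖y‖ ^ 2)) := by rw [hD]; ring
      _ ≤ D * ((1 + ‖y‖ ^ 2) ^ (-3 : ℝ) * (1 + ‖y‖ ^ 2)) := by gcongr
      _ = D * j y := by rw [h3]
  have hw2 : ∀ y, sqrtAbs V y ^ 2 * (1 + ‖y‖) ≤ 2 * (D * j y) := by
    intro y
    have := hw1 y
    have h0 := sq_nonneg (sqrtAbs V y)
    nlinarith [mul_nonneg h0 (sq_nonneg (‖y‖ - 1)), mul_nonneg h0 (sq_nonneg ‖y‖)]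
  have hw3 : ∀ y, sqrtAbs V y ^ 2 ≤ D * j y := by
    intro y
    have := hw1 y
    nlinarith [mul_nonneg (sq_nonneg (sqrtAbs V y)) (sq_nonneg ‖y‖)]
  have hw4 : ∀ y, sqrtAbs V y ^ 2 ≤ D := by
    intro y
    refine (hw3 y).trans (mul_le_of_le_one_right hD0 ?_)
    exact Real.rpow_le_one_of_one_le_of_nonpos (by nlinarith [sq_nonneg ‖y‖]) (by norm_num)
  have hpt : ∀ x y : Plane, (Real.log ‖x - y‖ * sqrtAbs V y) ^ 2 ≤
      4 * ((1 + ‖x‖) * (2 * (D * j y)) + D * j y + D * s (x - y)) := by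
    intro x y
    have h1 := log_sq_le ‖x - y‖ (norm_nonneg _)
    have h2 : ‖x - y‖ ≤ (1 + ‖x‖) * (1 + ‖y‖) := by
      have := norm_sub_le x y
      nlinarith [mul_nonneg (norm_nonneg x) (norm_nonneg y)]
    have h3 : ‖x - y‖⁻¹ ≤ 1 + s (x - y) := by
      by_cases h : x - y ∈ Metric.ball (0 : Plane) 1
      · rw [hs, Set.indicator_of_mem h]; linarith
      · have h' : 1 ≤ ‖x - y‖ := by simpa using h
        have := inv_le_one_of_one_le₀ h'
        have := hs0 (x - y)
        linarith
    have hq := sq_nonneg (sqrtAbs V y)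
    calc (Real.log ‖x - y‖ * sqrtAbs V y) ^ 2
        = Real.log ‖x - y‖ ^ 2 * sqrtAbs V y ^ 2 := by ring
      _ ≤ (4 * ((1 + ‖x‖) * (1 + ‖y‖) + (1 + s (x - y)))) * sqrtAbs V y ^ 2 := by
          gcongr
          linarith
      _ = 4 * ((1 + ‖x‖) * (sqrtAbs V y ^ 2 * (1 + ‖y‖)) + sqrtAbs V y ^ 2 +
            sqrtAbs V y ^ 2 * s (x - y)) := by ring
      _ ≤ 4 * ((1 + ‖x‖) * (2 * (D * j y)) + D * j y + D * s (x - y)) := by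
          have := hw2 y
          have := hw3 y
          have := hw4 y
          have := hs0 (x - y)
          gcongr
  have hdom : ∀ x : Plane, Integrable (fun y : Plane =>
      4 * ((1 + ‖x‖) * (2 * (D * j y)) + D * j y + D * s (x - y))) := by
    intro x
    exact ((((hji.const_mul D).const_mul 2).const_mul (1 + ‖x‖)).add (hji.const_mul D)
      |>.add ((hsi.comp_sub_left x).const_mul D)).const_mul 4
  have hint : ∀ x : Plane,
      Integrable (fun y : Plane => (Real.log ‖x - y‖ * sqrtAbs V y) ^ 2) := by
    intro x
    refine (hdom x).mono' ?_ (Eventually.of_forall fun y => ?_)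
    · exact (Measurable.aestronglyMeasurable (by fun_prop))
    · rw [Real.norm_of_nonneg (sq_nonneg _)]
      exact hpt x y
  refine ⟨4 * (2 * (D * ∫ y, j y) + D * (∫ y, j y) + D * ∫ y, s y), fun x => ⟨hint x, ?_⟩, ?_⟩
  · refine (integral_mono (hint x) (hdom x) (hpt x)).trans ?_
    rw [integral_const_mul, integral_add, integral_add, integral_const_mul, integral_const_mul,
      integral_const_mul, integral_const_mul, integral_sub_left_eq_self s volume x]
    · have e1 : 0 ≤ ∫ y, j y := integral_nonneg hj0
      have e2 : 0 ≤ ∫ y, s y := integral_nonneg hs0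
      have e3 := mul_nonneg hD0 e1
      have e4 := mul_nonneg hD0 e2
      nlinarith [mul_nonneg e3 (norm_nonneg x), mul_nonneg e4 (norm_nonneg x)]
    · exact ((hji.const_mul D).const_mul 2).const_mul (1 + ‖x‖)
    · exact hji.const_mul D
    · exact (((hji.const_mul D).const_mul 2).const_mul (1 + ‖x‖)).add (hji.const_mul D)
    · exact (hsi.comp_sub_left x).const_mul D
  · refine ((hji.const_mul D).const_mul 2).mono' ?_ (Eventually.of_forall fun y => ?_)
    · exact (Measurable.aestronglyMeasurable (by fun_prop))
    · rw [Real.norm_of_nonneg (by positivity)]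
      exact hw2 y

/-- The operator `T = U + v G₀ v` exists as a bounded operator on `L²(ℝ²)`. -/
theorem exists_thresholdOp {V : Plane → ℝ} (hV : Measurable V)
    (hdecay : ∃ C δ : ℝ, 0 < δ ∧ ∀ x : Plane, sqrtAbs V x ≤ C * bracket x ^ (-3 - δ)) :
    ∃ A : L2 →L[ℂ] L2, IsThresholdOp V A := by
  obtain ⟨E, hE, hwi⟩ := log_kernel_bound hV hdecay
  have hw := measurable_sqrtAbs hV
  have hU := measurable_signOf hV
  have hE0 : 0 ≤ E := by
    have := (integral_nonneg (fun y : Plane => sq_nonneg _)).trans (hE 0).2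
    simpa using this
  have hk : ∀ x : Plane, MemLp (fun y : Plane => ((Real.log ‖x - y‖ * sqrtAbs V y : ℝ) : ℂ)) 2
      (volume : Measure Plane) := by
    intro x
    have : MemLp (fun y : Plane => Real.log ‖x - y‖ * sqrtAbs V y) 2 (volume : Measure Plane) :=
      (memLp_two_iff_integrable_sq (Measurable.aestronglyMeasurable (by fun_prop))).2 (hE x).1
    exact this.ofReal
  set κ : Plane → L2 := fun x => (hk x).toLp _ with hκ
  have hκn : ∀ x, ‖κ x‖ ≤ Real.sqrt (E * (1 + ‖x‖)) := by
    intro x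
    apply Real.le_sqrt_of_sq_le
    have h1 : ((‖κ x‖ ^ 2 : ℝ) : ℂ) = ∫ y : Plane, inner ℂ (κ x y) (κ x y) := by
      rw [← L2.inner_def, inner_self_eq_norm_sq_to_K]
      norm_num
    have h2 : ∫ y : Plane, inner ℂ (κ x y) (κ x y) =
        ∫ y : Plane, (((Real.log ‖x - y‖ * sqrtAbs V y) ^ 2 : ℝ) : ℂ) := by
      apply integral_congr_ae
      filter_upwards [(hk x).coeFn_toLp] with y hy
      rw [hκ]
      simp only [hy]
      rw [inner_self_eq_norm_sq_to_K, Complex.norm_real, Real.norm_eq_abs]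
      norm_cast
      rw [sq_abs]
      rfl
    rw [h2, integral_complex_ofReal] at h1
    rw [Complex.ofReal_inj.1 h1]
    exact (hE x).2
  have hlog : ∀ (f : L2) (x : Plane),
      logPotential (fun y => (sqrtAbs V y : ℂ) * f y) x =
        -(1 / (2 * (Real.pi : ℂ))) * inner ℂ (κ x) f := by
    intro f x
    rw [logPotential, L2.inner_def]
    congr 1
    apply integral_congr_ae
    filter_upwards [(hk x).coeFn_toLp] with y hy
    rw [hκ]
    simp only [hy]
    simp
    ring
  set W : Plane → ℝ := fun x => sqrtAbs V x * Real.sqrt (E * (1 + ‖x‖)) with hWdef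
  have hW : MemLp W 2 (volume : Measure Plane) := by
    refine (memLp_two_iff_integrable_sq (Measurable.aestronglyMeasurable (by fun_prop))).2 ?_
    refine (hwi.const_mul E).congr (Eventually.of_forall fun x => ?_)
    simp only [hWdef, mul_pow]
    rw [Real.sq_sqrt (by positivity)]
    ring
  have hF : ∀ f : L2, MemLp (fun x : Plane => (sqrtAbs V x : ℂ) *
      logPotential (fun y => (sqrtAbs V y : ℂ) * f y) x) 2 (volume : Measure Plane) := by
    intro f
    refine (hW.const_mul (‖(1 / (2 * (Real.pi : ℂ)))‖ * ‖f‖)).mono ?_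
      (Eventually.of_forall fun x => ?_)
    · refine AEStronglyMeasurable.mul (Measurable.aestronglyMeasurable (by fun_prop)) ?_
      refine AEStronglyMeasurable.const_mul ?_ _
      refine AEStronglyMeasurable.integral_prod_right'
        (f := fun q : Plane × Plane => (Real.log ‖q.1 - q.2‖ : ℂ) * ((sqrtAbs V q.2 : ℂ) * f q.2)) ?_
      refine AEStronglyMeasurable.mul (Measurable.aestronglyMeasurable (by fun_prop)) ?_
      refine AEStronglyMeasurable.mul (Measurable.aestronglyMeasurable (by fun_prop)) ?_
      exact (Lp.aestronglyMeasurable f).comp_snd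
    · rw [hlog, norm_mul, norm_mul, norm_neg, Complex.norm_real]
      have h0 : 0 ≤ sqrtAbs V x := Real.sqrt_nonneg _
      rw [Real.norm_of_nonneg h0, Real.norm_of_nonneg (by positivity)]
      have h1 := (norm_inner_le_norm (𝕜 := ℂ) (κ x) f).trans
        (mul_le_mul_of_nonneg_right (hκn x) (norm_nonneg f))
      calc sqrtAbs V x * (‖(1 / (2 * (Real.pi : ℂ)))‖ * ‖inner ℂ (κ x) f‖)
          ≤ sqrtAbs V x * (‖(1 / (2 * (Real.pi : ℂ)))‖ * (Real.sqrt (E * (1 + ‖x‖)) * ‖f‖)) := by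
            gcongr
        _ = _ := by rw [hWdef]; ring
  have hG : ∀ f : L2, MemLp (fun x : Plane => (signOf V x : ℂ) * f x) 2
      (volume : Measure Plane) := by
    intro f
    refine (Lp.memLp f).mono ?_ (Eventually.of_forall fun x => ?_)
    · exact AEStronglyMeasurable.mul (Measurable.aestronglyMeasurable (by fun_prop))
        (Lp.aestronglyMeasurable f)
    · rw [norm_mul, Complex.norm_real]
      have : ‖signOf V x‖ = 1 := by unfold signOf; split_ifs <;> simp
      rw [this, one_mul]
  let A1 : L2 →ₗ[ℂ] L2 :=
    { toFun := fun f => (hG f).toLp _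
      map_add' := fun f g => by
        apply Lp.ext
        filter_upwards [(hG (f + g)).coeFn_toLp, (hG f).coeFn_toLp, (hG g).coeFn_toLp,
          Lp.coeFn_add f g, Lp.coeFn_add ((hG f).toLp _) ((hG g).toLp _)] with x h1 h2 h3 h4 h5
        rw [h1, h5, Pi.add_apply, h2, h3, h4, Pi.add_apply, mul_add]
      map_smul' := fun c f => by
        apply Lp.ext
        filter_upwards [(hG (c • f)).coeFn_toLp, (hG f).coeFn_toLp, Lp.coeFn_smul c f,
          Lp.coeFn_smul c ((hG f).toLp _)] with x h1 h2 h4 h5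
        rw [h1, RingHom.id_apply, h5, Pi.smul_apply, h2, h4, Pi.smul_apply, smul_eq_mul,
          smul_eq_mul]
        ring }
  let A2 : L2 →ₗ[ℂ] L2 :=
    { toFun := fun f => (hF f).toLp _
      map_add' := fun f g => by
        apply Lp.ext
        filter_upwards [(hF (f + g)).coeFn_toLp, (hF f).coeFn_toLp, (hF g).coeFn_toLp,
          Lp.coeFn_add ((hF f).toLp _) ((hF g).toLp _)] with x h1 h2 h3 h5
        rw [h1, h5, Pi.add_apply, h2, h3, hlog, hlog, hlog, inner_add_right]
        ring
      map_smul' := fun c f => by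
        apply Lp.ext
        filter_upwards [(hF (c • f)).coeFn_toLp, (hF f).coeFn_toLp,
          Lp.coeFn_smul c ((hF f).toLp _)] with x h1 h2 h5
        rw [h1, RingHom.id_apply, h5, Pi.smul_apply, h2, hlog, hlog, inner_smul_right, smul_eq_mul]
        ring }
  let B1 : L2 →L[ℂ] L2 := A1.mkContinuous 1 fun f => by
    refine Lp.norm_le_mul_norm_of_ae_le_mul ?_
    filter_upwards [(hG f).coeFn_toLp] with x h1
    have h2 : A1 f x = (signOf V x : ℂ) * f x := h1
    have : ‖signOf V x‖ = 1 := by unfold signOf; split_ifs <;> simp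
    rw [h2, norm_mul, Complex.norm_real, this]
  let B2 : L2 →L[ℂ] L2 :=
    A2.mkContinuous (‖(1 / (2 * (Real.pi : ℂ)))‖ * ‖hW.toLp W‖) fun f => by
    have : ‖A2 f‖ ≤ (‖(1 / (2 * (Real.pi : ℂ)))‖ * ‖f‖) * ‖hW.toLp W‖ := by
      refine Lp.norm_le_mul_norm_of_ae_le_mul ?_
      filter_upwards [(hF f).coeFn_toLp, hW.coeFn_toLp] with x h1 h3
      have h2 : A2 f x = (sqrtAbs V x : ℂ) *
        logPotential (fun y => (sqrtAbs V y : ℂ) * f y) x := h1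
      rw [h2, h3, hlog, norm_mul, norm_mul, norm_neg, Complex.norm_real]
      have h0 : 0 ≤ sqrtAbs V x := Real.sqrt_nonneg _
      have hW0 : 0 ≤ W x := mul_nonneg h0 (Real.sqrt_nonneg _)
      rw [Real.norm_of_nonneg h0, Real.norm_of_nonneg hW0]
      have h1 := (norm_inner_le_norm (𝕜 := ℂ) (κ x) f).trans
        (mul_le_mul_of_nonneg_right (hκn x) (norm_nonneg f))
      calc sqrtAbs V x * (‖(1 / (2 * (Real.pi : ℂ)))‖ * ‖inner ℂ (κ x) f‖)
          ≤ sqrtAbs V x * (‖(1 / (2 * (Real.pi : ℂ)))‖ * (Real.sqrt (E * (1 + ‖x‖)) * ‖f‖)) := by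
            gcongr
        _ = _ := by rw [hWdef]; ring
    linarith
  refine ⟨B1 + B2, fun f => ?_⟩
  filter_upwards [Lp.coeFn_add (B1 f) (B2 f), (hG f).coeFn_toLp, (hF f).coeFn_toLp] with x h1 h2 h3
  have e1 : B1 f x = (signOf V x : ℂ) * f x := h2
  have e2 : B2 f x = (sqrtAbs V x : ℂ) *
    logPotential (fun y => (sqrtAbs V y : ℂ) * f y) x := h3
  rw [_root_.add_apply, h1, Pi.add_apply, e1, e2]

open Classical in
/-- The operator `T = U + v G₀ v` on `L²(ℝ²)`. There is at most one bounded operator given by this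
formula, and there is one when `v` decays fast enough (see `thresholdOp_spec`);
otherwise the value is `0`. -/
def thresholdOp (V : Plane → ℝ) : L2 →L[ℂ] L2 :=
  if h : ∃ A : L2 →L[ℂ] L2, IsThresholdOp V A then h.choose else 0

theorem thresholdOp_spec {V : Plane → ℝ} (hV : Measurable V)
    (hdecay : ∃ C δ : ℝ, 0 < δ ∧ ∀ x : Plane, sqrtAbs V x ≤ C * bracket x ^ (-3 - δ)) :
    IsThresholdOp V (thresholdOp V) := by
  have h := exists_thresholdOp hV hdecay
  rw [thresholdOp, dif_pos h]
  exact h.choose_spec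

/-- The span of `v` in `L²(ℝ²)`, that is `P L²(ℝ²)`. -/
def spanV (V : Plane → ℝ) : Submodule ℂ L2 :=
  Submodule.span ℂ {f : L2 | ∀ᵐ x : Plane, f x = (sqrtAbs V x : ℂ)}

instance (V : Plane → ℝ) : FiniteDimensional ℂ (spanV V) := by
  have h : {f : L2 | ∀ᵐ x : Plane, f x = (sqrtAbs V x : ℂ)}.Subsingleton := by
    intro f hf g hg
    apply Lp.ext
    filter_upwards [hf, hg] with x h1 h2
    rw [h1, h2]
  exact FiniteDimensional.span_of_finite ℂ h.finite

/-- The orthogonal projection `P` onto the span of `v`. -/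
def projP (V : Plane → ℝ) : L2 →L[ℂ] L2 := (spanV V).starProjection

/-- The subspace `Q L²(ℝ²)`, where `Q = 1 - P`: the orthogonal complement of `v`. -/
def spaceQ (V : Plane → ℝ) : Submodule ℂ L2 := (spanV V)ᗮ

instance (V : Plane → ℝ) : CompleteSpace (spaceQ V) :=
  inferInstanceAs (CompleteSpace ((spanV V)ᗮ : Submodule ℂ L2))

/-- For the orthogonal projection `Π` onto `K`, the operator `Π A Π` as an operator on `K`. -/
def compress (K : Submodule ℂ L2) [K.HasOrthogonalProjection] (A : L2 →L[ℂ] L2) : K →L[ℂ] K :=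
  K.orthogonalProjectionOnto ∘L A ∘L K.subtypeL

/-- `Q T Q` as an operator on `Q L²(ℝ²)`. -/
def opQTQ (V : Plane → ℝ) : spaceQ V →L[ℂ] spaceQ V := compress (spaceQ V) (thresholdOp V)

/-- Zero is a regular point of the spectrum of `-Δ + V`: `Q T Q` is invertible on `Q L²(ℝ²)`. -/
def ZeroIsRegular (V : Plane → ℝ) : Prop := IsUnit (opQTQ V)

/-- The subspace `S₁ L²(ℝ²)`: the kernel of `Q T Q` as an operator on `Q L²(ℝ²)`. -/
def spaceS1 (V : Plane → ℝ) : Submodule ℂ L2 :=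
  (LinearMap.ker (opQTQ V).toLinearMap).map (spaceQ V).subtype

instance (V : Plane → ℝ) : CompleteSpace (spaceS1 V) := by
  have h1 : IsComplete ((LinearMap.ker (opQTQ V).toLinearMap : Submodule ℂ (spaceQ V)) :
      Set (spaceQ V)) := (opQTQ V).isClosed_ker.isComplete
  have h2 := ((spaceQ V).subtypeₗᵢ.isometry.isUniformInducing.isComplete_iff).2 h1
  exact completeSpace_coe_iff_isComplete.2 h2

/-- `T₁ = S₁ T P T S₁` as an operator on `S₁ L²(ℝ²)`, where `S₁` is the (orthogonal) Riesz
projection onto the kernel of the self-adjoint operator `Q T Q`. -/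
def opT1 (V : Plane → ℝ) : spaceS1 V →L[ℂ] spaceS1 V :=
  compress (spaceS1 V) (thresholdOp V ∘L projP V ∘L thresholdOp V)

/-- There is a resonance of the first kind at zero (an s-wave resonance, but no p-wave resonance
and no eigenvalue): zero is not a regular point, and `T₁` is invertible on `S₁ L²(ℝ²)`. -/
def FirstKindResonance (V : Plane → ℝ) : Prop := ¬ ZeroIsRegular V ∧ IsUnit (opT1 V)

/-- `S₁ D₁ S₁` on `L²(ℝ²)`, where `D₁ = T₁⁻¹` on `S₁ L²(ℝ²)`. -/
def opS1D1S1 (V : Plane → ℝ) : L2 →L[ℂ] L2 :=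
  (spaceS1 V).subtypeL ∘L Ring.inverse (opT1 V) ∘L (spaceS1 V).orthogonalProjectionOnto

/-! ### The leading low-energy term of the wave operator -/

open Classical in
/-- A bounded operator on `L²(ℝ²)` applied to a square-integrable function
(and `0` for other functions). -/
def applyFun (B : L2 →L[ℂ] L2) (g : Plane → ℂ) : Plane → ℂ :=
  if h : MemLp g 2 (volume : Measure Plane) then ⇑(B (h.toLp g)) else 0

/-- `v [R₀⁺ - R₀⁻](lam²) u`. -/
def rightFactor (V : Plane → ℝ) (lam : ℝ) (u : Plane → ℂ) (w : Plane) : ℂ :=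
  (sqrtAbs V w : ℂ) *
    ∫ y : Plane, (freeResolventPlus lam w y - freeResolventMinus lam w y) * u y

/-- `v S₁ D₁ S₁ v [R₀⁺ - R₀⁻](lam²) u`. -/
def middleFactor (V : Plane → ℝ) (lam : ℝ) (u : Plane → ℂ) (z : Plane) : ℂ :=
  (sqrtAbs V z : ℂ) * applyFun (opS1D1S1 V) (rightFactor V lam u) z

/-- `h(lam) R₀⁻(lam²) v S₁ D₁ S₁ v [R₀⁺ - R₀⁻](lam²) lam χ(lam) u`, evaluated at `x`. -/
def lowEnergyIntegrand (V : Plane → ℝ) (h : ℝ → ℂ) (χ : ℝ → ℝ) (u : Plane → ℂ)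
    (x : Plane) (lam : ℝ) : ℂ :=
  h lam * (∫ z : Plane, freeResolventMinus lam x z * middleFactor V lam u z) *
    (lam : ℂ) * (χ lam : ℂ)

/-- `A u = (1 / (π i)) ∫_0^∞ h(lam) R₀⁻(lam²) v S₁ D₁ S₁ v [R₀⁺ - R₀⁻](lam²) lam χ(lam) u dlam`. -/
def lowEnergyOp (V : Plane → ℝ) (h : ℝ → ℂ) (χ : ℝ → ℝ) (u : Plane → ℂ) (x : Plane) : ℂ :=
  1 / ((Real.pi : ℂ) * Complex.I) *
    ∫ lam in Set.Ioi (0 : ℝ), lowEnergyIntegrand V h χ u x lam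

/-- All integrals in the definition of `A u` converge absolutely, and `S₁ D₁ S₁` is applied to
elements of `L²(ℝ²)`. -/
structure LowEnergyOpConverges (V : Plane → ℝ) (h : ℝ → ℂ) (χ : ℝ → ℝ) (u : Plane → ℂ) :
    Prop where
  right_integrable : ∀ lam : ℝ, 0 < lam → ∀ w : Plane,
    Integrable fun y : Plane => (freeResolventPlus lam w y - freeResolventMinus lam w y) * u y
  right_memLp : ∀ lam : ℝ, 0 < lam → MemLp (rightFactor V lam u) 2 (volume : Measure Plane)
  left_integrable : ∀ lam : ℝ, 0 < lam → ∀ x : Plane,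
    Integrable fun z : Plane => freeResolventMinus lam x z * middleFactor V lam u z
  energy_integrable : ∀ x : Plane,
    IntegrableOn (fun lam : ℝ => lowEnergyIntegrand V h χ u x lam) (Set.Ioi 0)

/-- The function `h⁻(lam) = g⁻(lam) + b`, where `g⁻(lam) = a log lam + z`. The expansion of
`M⁻(lam)⁻¹` involves it with `a = -‖V‖₁ / (2π)`, `z = ‖V‖₁ (-i/4 + (log 2 - γ) / (2π))`
(`γ` Euler's constant) and a real `b` determined by `V`; here `a`, `b`, `z` are free parameters. -/
def hMinus (a b : ℝ) (z : ℂ) (lam : ℝ) : ℂ := (a : ℂ) * (Real.log lam : ℂ) + z + (b : ℂ)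

end PlanarSchrodinger

end

open PlanarSchrodinger

noncomputable section

namespace PlanarSchrodinger

/-! ### An oscillatory representation of the Hankel function -/

/-! Since P has rank at most one and T₁ factors through P, invertibility of T₁ forces S₁L² to be at
most one-dimensional (`exists_generator_spaceS1`), so S₁D₁S₁f = c⟨φ,f⟩φ (`exists_opS1D1S1_eq`). As φ
lies in QL², it is orthogonal to v, so ψ = vφ has mean zero besides weighted decay
(`neutralDensity_sqrtAbs_mul`). Hence A is an integral operator with kernel a constant times ∫ m(λ)
F(λ,x) J(λ,y) dλ, where m = h⁻·λ·χ, F is R₀⁻ψ up to a constant, and J is the jump of the resolvent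
tested against the conjugate of ψ.

The kernel is estimated on the wave side. The Hankel function is a conditionally convergent Fourier
integral, H₀⁻(λr) = (2i/π) ∫ exp(-iλs) (s²-r²)₊^{-1/2} ds. Because ψ has mean zero, the profile at
the reference radius 1+|x| may be subtracted, and F(λ,x) becomes the one-sided Fourier transform of
a field w(x,s) that is absolutely integrable in time (`NeutralDensity.integral_hankelMinus_mul`).
The field has a majorant W with three bounds: ∫W ds and ∫√s·W ds are bounded uniformly in x, and ∫W
dx = O(√s).

J is a difference of two such transforms, with phases exp(-iλt) and exp(iλt). Integrating in λ first
turns the kernel into a superposition of w(x,s) times the conjugate of w(y,t) times m̂(s±t). Near 0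
the profile m behaves like λ log λ, whence m̂(σ) = O(|σ|^{-7/4})
(`MildProfile.exists_norm_halfFourier_le`). Integrating in y costs √t ≤ √|s±t| + √s: the first term
is absorbed by m̂, as 7/4 - 1/2 > 1, the second by the √s moment of W
(`NeutralDensity.exists_lintegral_pairMajorant_le`). The majorant of the kernel is symmetric, so
both marginals are bounded, and Schur's test covers every p, the endpoints 1 and ∞ included.
Absolute convergence of the kernel integral at almost every x gives the limit over balls. -/

theorem integrableOn_exp_neg_mul_sinh {r : ℝ} (hr : 0 < r) :
    IntegrableOn (fun t : ℝ => Real.exp (-(r * Real.sinh t))) (Set.Ioi 0) := by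
  refine (integrableOn_exp_mul_Ioi (a := -r) (by linarith) 0).mono'
    (Continuous.aestronglyMeasurable (by fun_prop)) ?_
  refine (ae_restrict_mem measurableSet_Ioi).mono fun t ht => ?_
  rw [Real.norm_of_nonneg (Real.exp_pos _).le]
  apply Real.exp_le_exp.2
  have := Real.self_le_sinh_iff.2 (le_of_lt (show (0 : ℝ) < t from ht))
  nlinarith

/-- A shift by π/2 turns the cosine into a sine, and the sine is symmetric about π/2. This rewrites
the left side of the contour below in terms of the integrals that define J₀ and Y₀. -/
theorem integral_exp_cos_eq (r : ℝ) :
    ∫ y in (-(Real.pi / 2))..0, Complex.exp (-Complex.I * r * Real.cos y) =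
      1 / 2 * ∫ θ in (0 : ℝ)..Real.pi, Complex.exp (-Complex.I * r * Real.sin θ) := by
  set F : ℝ → ℂ := fun θ => Complex.exp (-Complex.I * r * Real.sin θ) with hF
  have hc : Continuous F := by fun_prop
  have h1 : ∫ y in (-(Real.pi / 2))..0, Complex.exp (-Complex.I * r * Real.cos y) =
      ∫ θ in (0 : ℝ)..(Real.pi / 2), F θ := by
    have := intervalIntegral.integral_comp_add_right (a := -(Real.pi / 2)) (b := 0) F (Real.pi / 2)
    simp only [hF, Real.sin_add_pi_div_two] at this
    rw [this]
    simp [hF]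
  have h2 : ∫ θ in (0 : ℝ)..(Real.pi / 2), F θ = ∫ θ in (Real.pi / 2)..Real.pi, F θ := by
    have := intervalIntegral.integral_comp_sub_left (a := 0) (b := Real.pi / 2) F Real.pi
    simp only [hF, Real.sin_pi_sub] at this
    simp only [hF]
    rw [this]
    congr 1 <;> ring
  have h3 := intervalIntegral.integral_add_adjacent_intervals
    (hc.intervalIntegrable (μ := volume) 0 (Real.pi / 2))
    (hc.intervalIntegrable (μ := volume) (Real.pi / 2) Real.pi)
  rw [h1, ← h3, ← h2]
  ring

theorem hankelMinus_eq (r : ℝ) :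
    hankelMinus r =
      1 / (Real.pi : ℂ) * (∫ θ in (0 : ℝ)..Real.pi, Complex.exp (-Complex.I * r * Real.sin θ)) +
        2 * Complex.I / (Real.pi : ℂ) *
          ((∫ t in Set.Ioi (0 : ℝ), Real.exp (-(r * Real.sinh t)) : ℝ) : ℂ) := by
  have h : ∀ θ : ℝ, Complex.exp (-Complex.I * r * Real.sin θ) =
      ((Real.cos (r * Real.sin θ) : ℝ) : ℂ) - Complex.I * ((Real.sin (r * Real.sin θ) : ℝ) : ℂ) := by
    intro θ
    rw [show -Complex.I * r * Real.sin θ = ((-(r * Real.sin θ) : ℝ) : ℂ) * Complex.I by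
      push_cast; ring, Complex.exp_mul_I, ← Complex.ofReal_cos, ← Complex.ofReal_sin, Real.cos_neg,
      Real.sin_neg]
    push_cast
    ring
  simp_rw [h]
  rw [intervalIntegral.integral_sub
    (Continuous.intervalIntegrable (by fun_prop) _ _)
    (Continuous.intervalIntegrable (by fun_prop) _ _), intervalIntegral.integral_const_mul,
    intervalIntegral.integral_ofReal, intervalIntegral.integral_ofReal, hankelMinus, besselJ0,
    besselY0]
  push_cast
  ring

/-- The contour shift behind `H₀⁻(r) = (2i/π) ∫_0^∞ exp (-i r cosh u) du`. -/
theorem tendsto_integral_exp_cosh {r : ℝ} (hr : 0 < r) :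
    Tendsto (fun R : ℝ => ∫ u in (0 : ℝ)..R, Complex.exp (-Complex.I * r * Real.cosh u)) atTop
      (𝓝 (Real.pi / (2 * Complex.I) * hankelMinus r)) := by
  set f : ℂ → ℂ := fun u => Complex.exp (-Complex.I * r * Complex.cosh u) with hf
  have hfd : Differentiable ℂ f := by
    have := Complex.differentiable_cosh
    fun_prop
  have hrect : ∀ R : ℝ, ∫ u in (0 : ℝ)..R, Complex.exp (-Complex.I * r * Real.cosh u) =
      (∫ x in (0 : ℝ)..R, ((Real.exp (-(r * Real.sinh x)) : ℝ) : ℂ)) +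
        Complex.I * (∫ y in (-(Real.pi / 2))..0, f (R + y * Complex.I)) -
        Complex.I * ∫ y in (-(Real.pi / 2))..0, Complex.exp (-Complex.I * r * Real.cos y) := by
    intro R
    -- Rectangle with vertices -iπ/2 and R. On its lower side cosh(x - iπ/2) = -i sinh x, so the
    -- oscillating exponential becomes the decaying exp(-r sinh x).
    have h := Complex.integral_boundary_rect_eq_zero_of_differentiableOn f
      (⟨0, -(Real.pi / 2)⟩ : ℂ) (⟨R, 0⟩ : ℂ) hfd.differentiableOn
    simp only [smul_eq_mul] at h
    have e1 : ∀ x : ℝ, f (x + ((-(Real.pi / 2) : ℝ) : ℂ) * Complex.I) =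
        ((Real.exp (-(r * Real.sinh x)) : ℝ) : ℂ) := by
      intro x
      simp only [hf]
      rw [Complex.cosh_add, Complex.cosh_mul_I, Complex.sinh_mul_I, ← Complex.ofReal_cos,
        ← Complex.ofReal_sin, Real.cos_neg, Real.sin_neg, Real.cos_pi_div_two, Real.sin_pi_div_two]
      push_cast
      congr 1
      linear_combination (r * Complex.sinh x) * Complex.I_sq
    have e2 : ∀ x : ℝ, f (x + ((0 : ℝ) : ℂ) * Complex.I) =
        Complex.exp (-Complex.I * r * Real.cosh x) := by
      intro x
      simp [hf]
    have e3 : ∀ y : ℝ, f (((0 : ℝ) : ℂ) + y * Complex.I) =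
        Complex.exp (-Complex.I * r * Real.cos y) := by
      intro y
      simp [hf, Complex.cosh_mul_I]
    simp only [e1, e2, e3] at h
    linear_combination -h
  have hlim1 : Tendsto (fun R : ℝ => ∫ x in (0 : ℝ)..R, ((Real.exp (-(r * Real.sinh x)) : ℝ) : ℂ))
      atTop (𝓝 (∫ t in Set.Ioi (0 : ℝ), ((Real.exp (-(r * Real.sinh t)) : ℝ) : ℂ))) :=
    intervalIntegral_tendsto_integral_Ioi 0 (integrableOn_exp_neg_mul_sinh hr).ofReal tendsto_id
  have hnorm : ∀ R y : ℝ, ‖f (R + y * Complex.I)‖ = Real.exp (r * (Real.sinh R * Real.sin y)) := by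
    intro R y
    simp only [hf]
    rw [Complex.norm_exp, Complex.cosh_add, Complex.cosh_mul_I, Complex.sinh_mul_I,
      ← Complex.ofReal_cos, ← Complex.ofReal_sin, ← Complex.ofReal_sinh, ← Complex.ofReal_cosh]
    congr 1
    simp only [Complex.mul_re, Complex.neg_re, Complex.neg_im, Complex.mul_im, Complex.add_re,
      Complex.add_im, Complex.ofReal_re, Complex.ofReal_im, Complex.I_re, Complex.I_im]
    ring
  -- The right side disappears by dominated convergence: the modulus exp(r sinh R sin y) is at most
  -- 1 for y in [-π/2, 0] and tends to 0 except at the corner y = 0.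
  have hlim2 : Tendsto (fun R : ℝ => ∫ y in (-(Real.pi / 2))..0, f (R + y * Complex.I)) atTop
      (𝓝 (∫ _y in (-(Real.pi / 2))..0, (0 : ℂ))) := by
    refine intervalIntegral.tendsto_integral_filter_of_dominated_convergence (fun _ => (1 : ℝ))
      ?_ ?_ ?_ ?_
    · exact Eventually.of_forall fun R =>
        (hfd.continuous.comp (by fun_prop)).aestronglyMeasurable
    · filter_upwards [eventually_ge_atTop 0] with R hR
      refine Eventually.of_forall fun y hy => ?_
      rw [Set.uIoc_of_le (by linarith [Real.pi_pos])] at hy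
      rw [hnorm]
      apply Real.exp_le_one_iff.2
      have h1 := Real.sinh_nonneg_iff.2 hR
      have h2 : Real.sin y ≤ 0 := Real.sin_nonpos_of_nonpos_of_neg_pi_le hy.2
        (by linarith [hy.1, Real.pi_pos])
      exact mul_nonpos_of_nonneg_of_nonpos hr.le (mul_nonpos_of_nonneg_of_nonpos h1 h2)
    · exact intervalIntegrable_const
    · have h0 : ∀ᵐ y : ℝ, y ≠ 0 := by simp [ae_iff]
      filter_upwards [h0] with y hy0 hy
      rw [Set.uIoc_of_le (by linarith [Real.pi_pos])] at hy
      rw [tendsto_zero_iff_norm_tendsto_zero]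
      simp_rw [hnorm]
      refine Real.tendsto_exp_atBot.comp ?_
      have h2 : Real.sin y < 0 := Real.sin_neg_of_neg_of_neg_pi_lt (lt_of_le_of_ne hy.2 hy0)
        (by linarith [hy.1, Real.pi_pos])
      have hs : Tendsto Real.sinh atTop atTop := by
        refine tendsto_atTop_mono' _ ?_ tendsto_id
        filter_upwards [eventually_ge_atTop 0] with t ht
        exact Real.self_le_sinh_iff.2 ht
      exact (hs.atTop_mul_const_of_neg h2).const_mul_atBot hr
  have hfin := ((hlim1.add (hlim2.const_mul Complex.I)).sub
    (tendsto_const_nhds (x := Complex.I *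
      ∫ y in (-(Real.pi / 2))..0, Complex.exp (-Complex.I * r * Real.cos y))))
  simp_rw [hrect]
  convert hfin using 2
  rw [hankelMinus_eq, integral_exp_cos_eq, integral_complex_ofReal]
  have hpi : (Real.pi : ℂ) ≠ 0 := by exact_mod_cast Real.pi_ne_zero
  have hI := Complex.I_ne_zero
  simp only [intervalIntegral.integral_zero]
  generalize (∫ θ in (0 : ℝ)..Real.pi, Complex.exp (-Complex.I * r * Real.sin θ)) = J
  field_simp
  linear_combination J * Complex.I_sq

/-- The profile `(s² - r²)_+^{-1/2}` of the fundamental solution of the wave equation in the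
plane. -/
def waveKernel (s r : ℝ) : ℝ := (Real.sqrt (s ^ 2 - r ^ 2))⁻¹

/-- The conventions √t = 0 for t ≤ 0 and 0⁻¹ = 0 supply the positive part, so no indicator function
is needed. -/
theorem waveKernel_of_le {s r : ℝ} (hs : 0 ≤ s) (h : s ≤ r) : waveKernel s r = 0 := by
  rw [waveKernel, Real.sqrt_eq_zero_of_nonpos (by nlinarith), inv_zero]

theorem waveKernel_nonneg (s r : ℝ) : 0 ≤ waveKernel s r := inv_nonneg.2 (Real.sqrt_nonneg _)

@[fun_prop]
theorem measurable_waveKernel {α : Type*} [MeasurableSpace α] {f g : α → ℝ} (hf : Measurable f)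
    (hg : Measurable g) : Measurable fun a => waveKernel (f a) (g a) := by
  unfold waveKernel
  fun_prop

/-- Substitute s = r cosh u: then √(s²-r²) = r sinh u cancels the Jacobian. The range 0 < s ≤ r
contributes nothing. -/
theorem integral_waveKernel_Ioc {lam r S : ℝ} (hr : 0 < r) (hS : r ≤ S) :
    ∫ s in Set.Ioc 0 S, Complex.exp (-Complex.I * lam * s) * (waveKernel s r : ℂ) =
      ∫ u in (0 : ℝ)..Real.arcosh (S / r), Complex.exp (-Complex.I * (lam * r : ℝ) * Real.cosh u) := by
  set T := Real.arcosh (S / r) with hT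
  have hSr : 1 ≤ S / r := (one_le_div hr).2 hS
  have hT0 : 0 ≤ T := Real.arcosh_nonneg hSr
  have hcT : r * Real.cosh T = S := by rw [hT, Real.cosh_arcosh hSr]; field_simp
  have hinj : Set.InjOn (fun u => r * Real.cosh u) (Set.Ioc 0 T) := by
    intro x hx y hy hxy
    have : Real.cosh x = Real.cosh y := by simpa [hr.ne'] using hxy
    rw [← Real.arcosh_cosh hx.1.le, ← Real.arcosh_cosh hy.1.le, this]
  have himg : (fun u => r * Real.cosh u) '' Set.Ioc 0 T = Set.Ioc r S := by
    ext s
    constructor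
    · rintro ⟨u, hu, rfl⟩
      refine ⟨?_, ?_⟩
      · have := Real.one_lt_cosh.2 hu.1.ne'
        simp only
        nlinarith
      · rw [← hcT]
        have : Real.cosh u ≤ Real.cosh T := Real.cosh_le_cosh.2 (by
          rw [abs_of_nonneg hu.1.le, abs_of_nonneg hT0]; exact hu.2)
        simp only
        gcongr
    · intro hs
      have h1 : 1 < s / r := (one_lt_div hr).2 hs.1
      refine ⟨Real.arcosh (s / r), ⟨Real.arcosh_pos h1, ?_⟩, ?_⟩
      · rw [hT]
        refine (Real.arcosh_le_arcosh (by linarith) (by linarith)).2 ?_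
        have := hs.2
        gcongr
      · simp only
        rw [Real.cosh_arcosh h1.le]
        field_simp
  have hsplit : ∫ s in Set.Ioc 0 S, Complex.exp (-Complex.I * lam * s) * (waveKernel s r : ℂ) =
      ∫ s in Set.Ioc r S, Complex.exp (-Complex.I * lam * s) * (waveKernel s r : ℂ) := by
    refine setIntegral_eq_of_subset_of_forall_sdiff_eq_zero measurableSet_Ioc
      (Set.Ioc_subset_Ioc_left hr.le) fun s hs => ?_
    have h2 : s ≤ r := by
      by_contra h
      exact hs.2 ⟨not_le.1 h, hs.1.2⟩
    rw [waveKernel_of_le hs.1.1.le h2]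
    simp
  rw [hsplit, ← himg, integral_image_eq_integral_abs_deriv_smul (f' := fun u => r * Real.sinh u)
    measurableSet_Ioc (fun u _ => ((Real.hasDerivAt_cosh u).const_mul r).hasDerivWithinAt) hinj,
    intervalIntegral.integral_of_le hT0]
  refine setIntegral_congr_fun measurableSet_Ioc fun u hu => ?_
  have hsh : 0 < Real.sinh u := Real.sinh_pos_iff.2 hu.1
  have hw : waveKernel (r * Real.cosh u) r = (r * Real.sinh u)⁻¹ := by
    rw [waveKernel, show (r * Real.cosh u) ^ 2 - r ^ 2 = (r * Real.sinh u) ^ 2 by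
      rw [mul_pow, Real.cosh_sq]; ring, Real.sqrt_sq (by positivity)]
  rw [hw, abs_of_pos (by positivity), Complex.real_smul]
  have : (r : ℂ) * (Real.sinh u : ℂ) ≠ 0 := by exact_mod_cast (mul_pos hr hsh).ne'
  push_cast at this ⊢
  field_simp
  exact div_self this

theorem tendsto_arcosh_atTop : Tendsto Real.arcosh atTop atTop := by
  refine tendsto_atTop_mono' _ ?_ Real.tendsto_log_atTop
  filter_upwards [eventually_ge_atTop 1] with x hx
  rw [Real.arcosh]
  exact Real.log_le_log (by linarith) (by linarith [Real.sqrt_nonneg (x ^ 2 - 1)])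

/-- The profile decays only like 1/s, so the integral over the half-line is not absolutely
convergent and has to be kept as a limit of truncations. -/
theorem tendsto_integral_waveKernel {lam r : ℝ} (hlam : 0 < lam) (hr : 0 < r) :
    Tendsto (fun S : ℝ =>
      ∫ s in Set.Ioc 0 S, Complex.exp (-Complex.I * lam * s) * (waveKernel s r : ℂ)) atTop
      (𝓝 (Real.pi / (2 * Complex.I) * hankelMinus (lam * r))) := by
  have h := (tendsto_integral_exp_cosh (mul_pos hlam hr)).comp
    (tendsto_arcosh_atTop.comp (tendsto_id.atTop_div_const hr))
  refine h.congr' ?_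
  filter_upwards [eventually_ge_atTop r] with S hS
  exact (integral_waveKernel_Ioc hr hS).symm

/-- For s > r one has s² - r² ≥ r(s - r), which leaves an integrable inverse square root at the
front. -/
theorem integrableOn_waveKernel {r : ℝ} (hr : 0 < r) (S : ℝ) :
    IntegrableOn (fun s => waveKernel s r) (Set.Ioc 0 S) := by
  have h1 : IntegrableOn (fun s : ℝ => (Real.sqrt r)⁻¹ * (s - r) ^ (-(1 / 2 : ℝ))) (Set.Ioc r S) := by
    refine Integrable.const_mul ?_ _
    rcases le_total r S with h | h
    · have := (intervalIntegral.intervalIntegrable_rpow' (a := 0) (b := S - r)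
        (show (-1 : ℝ) < -(1 / 2) by norm_num)).comp_sub_right r
      simp only [zero_add, sub_add_cancel] at this
      exact (intervalIntegrable_iff_integrableOn_Ioc_of_le h).1 this
    · simp [Set.Ioc_eq_empty (not_lt.2 h)]
  have h2 : IntegrableOn (fun s => waveKernel s r) (Set.Ioc r S) := by
    refine h1.mono' (Measurable.aestronglyMeasurable (by fun_prop)) ?_
    refine (ae_restrict_mem measurableSet_Ioc).mono fun s hs => ?_
    have hs1 : 0 < s - r := sub_pos.2 hs.1
    rw [Real.norm_of_nonneg (waveKernel_nonneg _ _), Real.rpow_neg hs1.le, ← Real.sqrt_eq_rpow,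
      ← mul_inv, ← Real.sqrt_mul hr.le, waveKernel]
    apply inv_anti₀ (Real.sqrt_pos.2 (by positivity))
    apply Real.sqrt_le_sqrt
    nlinarith
  have h3 : IntegrableOn (fun s => waveKernel s r) (Set.Ioc 0 r) := by
    refine (integrableOn_zero (μ := volume)).congr_fun (fun s hs => ?_) measurableSet_Ioc
    exact (waveKernel_of_le hs.1.le hs.2).symm
  refine (h3.union h2).mono_set fun s hs => ?_
  rcases le_or_gt s r with h | h
  · exact Or.inl ⟨hs.1, h⟩
  · exact Or.inr ⟨h, hs.2⟩

/-- Differences of the Hankel function as absolutely convergent Fourier integrals. -/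
theorem hankelMinus_sub {lam r r' : ℝ} (hlam : 0 < lam) (hr : 0 < r) (hr' : 0 < r')
    (hint : IntegrableOn (fun s => waveKernel s r - waveKernel s r') (Set.Ioi 0)) :
    hankelMinus (lam * r) - hankelMinus (lam * r') =
      2 * Complex.I / Real.pi * ∫ s in Set.Ioi (0 : ℝ),
        Complex.exp (-Complex.I * lam * s) * ((waveKernel s r - waveKernel s r' : ℝ) : ℂ) := by
  have hn : ∀ s : ℝ, ‖Complex.exp (-Complex.I * lam * s)‖ = 1 := by
    intro s
    rw [Complex.norm_exp]
    simp
  have hi : ∀ (f : ℝ → ℝ) (A : Set ℝ), IntegrableOn f A →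
      IntegrableOn (fun s : ℝ => Complex.exp (-Complex.I * lam * s) * (f s : ℂ)) A := by
    intro f A hf
    refine hf.ofReal.bdd_mul (c := 1) (Continuous.aestronglyMeasurable (by fun_prop)) ?_
    exact Eventually.of_forall fun s => (hn s).le
  -- The truncated integrals of the two profiles converge separately; their difference converges to
  -- the absolutely convergent integral as well, and limits are unique.
  have h1 := (tendsto_integral_waveKernel hlam hr).sub (tendsto_integral_waveKernel hlam hr')
  have h2 := intervalIntegral_tendsto_integral_Ioi 0 (hi _ _ hint) tendsto_id
  have h3 := tendsto_nhds_unique_of_eventuallyEq h1 h2 (by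
    filter_upwards [eventually_ge_atTop 0] with S hS
    simp only [id]
    rw [intervalIntegral.integral_of_le hS, ← integral_sub
      (hi _ _ (integrableOn_waveKernel hr S)) (hi _ _ (integrableOn_waveKernel hr' S))]
    refine integral_congr_ae (Eventually.of_forall fun s => ?_)
    push_cast
    ring)
  rw [← h3]
  have hpi : (Real.pi : ℂ) ≠ 0 := by exact_mod_cast Real.pi_ne_zero
  have hI := Complex.I_ne_zero
  field_simp

/-! ### Bounds for differences of the wave profile -/

/-- An integrable profile with an inverse square root singularity at `0`, vanishing on the negative
half-line. -/
def edgeProfile (ρ : ℝ) : ℝ := (Real.sqrt ρ)⁻¹ / (1 + ρ)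

theorem edgeProfile_of_nonpos {ρ : ℝ} (h : ρ ≤ 0) : edgeProfile ρ = 0 := by
  rw [edgeProfile, Real.sqrt_eq_zero_of_nonpos h, inv_zero, zero_div]

theorem edgeProfile_nonneg (ρ : ℝ) : 0 ≤ edgeProfile ρ := by
  rcases le_total ρ 0 with h | h
  · rw [edgeProfile_of_nonpos h]
  · unfold edgeProfile
    positivity

@[fun_prop]
theorem measurable_edgeProfile {α : Type*} [MeasurableSpace α] {f : α → ℝ} (hf : Measurable f) :
    Measurable fun a => edgeProfile (f a) := by
  unfold edgeProfile
  fun_prop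

theorem waveKernel_eq_of_lt {s r : ℝ} (h : r < s) :
    waveKernel s r = (Real.sqrt (s - r))⁻¹ * (Real.sqrt (s + r))⁻¹ := by
  rw [waveKernel, ← mul_inv, ← Real.sqrt_mul (by linarith)]
  congr 2
  ring

/-- Three regions. Ahead of both fronts everything vanishes. Between the fronts s - r ≤ d, so the
extra decay 1/(1+ρ) in `edgeProfile` is paid for by the factor 2d. Behind both, the difference of
the inverse square roots gains a factor (r' - r)/(s - r), one more power of decay than either
profile has alone. -/
theorem abs_waveKernel_sub_le_of_le {s r r' d : ℝ} (hs : 0 < s) (hr : 0 ≤ r) (hrr : r ≤ r')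
    (hd : r' - r ≤ d) (h1 : 1 ≤ d) :
    |waveKernel s r - waveKernel s r'| ≤
      2 * d * ((Real.sqrt s)⁻¹ * (edgeProfile (s - r) + edgeProfile (s - r'))) := by
  have hsq : 0 < Real.sqrt s := Real.sqrt_pos.2 hs
  rcases le_or_gt s r with h | h
  · rw [waveKernel_of_le hs.le h, waveKernel_of_le hs.le (h.trans hrr), sub_zero, abs_zero]
    have := edgeProfile_nonneg (s - r)
    have := edgeProfile_nonneg (s - r')
    positivity
  have hA : 0 < Real.sqrt (s - r) := Real.sqrt_pos.2 (by linarith)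
  rcases le_or_gt s r' with h' | h'
  · rw [waveKernel_of_le hs.le h', sub_zero, abs_of_nonneg (waveKernel_nonneg _ _),
      edgeProfile_of_nonpos (show s - r' ≤ 0 by linarith), add_zero, waveKernel_eq_of_lt h,
      edgeProfile]
    have h2 : (Real.sqrt (s + r))⁻¹ ≤ (Real.sqrt s)⁻¹ :=
      inv_anti₀ hsq (Real.sqrt_le_sqrt (by linarith))
    have h3 : 1 ≤ 2 * d / (1 + (s - r)) := by
      rw [le_div_iff₀ (by linarith)]
      linarith
    calc (Real.sqrt (s - r))⁻¹ * (Real.sqrt (s + r))⁻¹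
        ≤ (Real.sqrt (s - r))⁻¹ * (Real.sqrt s)⁻¹ * 1 := by rw [mul_one]; gcongr
      _ ≤ (Real.sqrt (s - r))⁻¹ * (Real.sqrt s)⁻¹ * (2 * d / (1 + (s - r))) := by gcongr
      _ = _ := by ring
  · set A := Real.sqrt (s ^ 2 - r' ^ 2) with hAdef
    set B := Real.sqrt (s ^ 2 - r ^ 2) with hBdef
    have hA2 : A ^ 2 = s ^ 2 - r' ^ 2 := Real.sq_sqrt (by nlinarith)
    have hB2 : B ^ 2 = s ^ 2 - r ^ 2 := Real.sq_sqrt (by nlinarith)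
    have hA0 : 0 < A := Real.sqrt_pos.2 (by nlinarith)
    have hB0 : 0 < B := Real.sqrt_pos.2 (by nlinarith)
    have hAB : A ≤ B := Real.sqrt_le_sqrt (by nlinarith)
    have hAge : Real.sqrt s * Real.sqrt (s - r') ≤ A := by
      rw [← Real.sqrt_mul hs.le]
      exact Real.sqrt_le_sqrt (by nlinarith)
    have hC : 0 < Real.sqrt (s - r') := Real.sqrt_pos.2 (by linarith)
    have hdiff : |waveKernel s r - waveKernel s r'| = (B - A) / (A * B) := by
      rw [abs_sub_comm, waveKernel, waveKernel, ← hAdef, ← hBdef, abs_of_nonneg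
        (sub_nonneg.2 (inv_anti₀ hA0 hAB))]
      field_simp
    -- Rationalisation, with B ≤ A + B in the denominator.
    have h2 : (B - A) / (A * B) ≤ (B ^ 2 - A ^ 2) / (A * B ^ 2) := by
      rw [div_le_div_iff₀ (by positivity) (by positivity)]
      have : 0 ≤ (B - A) * (A * B) * A :=
        mul_nonneg (mul_nonneg (by linarith) (by positivity)) hA0.le
      nlinarith
    have h3 : B ^ 2 - A ^ 2 ≤ 2 * s * (r' - r) := by
      rw [hB2, hA2]
      nlinarith
    have h4 : s * (s - r) ≤ B ^ 2 := by
      rw [hB2]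
      nlinarith
    have h5 : (B ^ 2 - A ^ 2) / (A * B ^ 2) ≤
        2 * s * (r' - r) / (Real.sqrt s * Real.sqrt (s - r') * (s * (s - r))) := by
      have : 0 < s * (s - r) := mul_pos hs (by linarith)
      have : 0 ≤ 2 * s * (r' - r) := mul_nonneg (by linarith) (by linarith)
      gcongr
    -- Here `1 ≤ d` enters: s - r = (s - r') + (r' - r), and d dominates r' - r in the first summand
    -- and 1 in the second.
    have h6 : (r' - r) / (s - r) ≤ d / (1 + (s - r')) := by
      rw [div_le_div_iff₀ (by linarith) (by linarith)]
      nlinarith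
    have h7 : 2 * s * (r' - r) / (Real.sqrt s * Real.sqrt (s - r') * (s * (s - r))) =
        2 * ((Real.sqrt s)⁻¹ * (Real.sqrt (s - r'))⁻¹) * ((r' - r) / (s - r)) := by
      have : s - r ≠ 0 := by linarith
      field_simp
    calc |waveKernel s r - waveKernel s r'|
        ≤ 2 * ((Real.sqrt s)⁻¹ * (Real.sqrt (s - r'))⁻¹) * ((r' - r) / (s - r)) := by
          rw [← h7, hdiff]
          exact h2.trans h5
      _ ≤ 2 * ((Real.sqrt s)⁻¹ * (Real.sqrt (s - r'))⁻¹) * (d / (1 + (s - r'))) := by gcongr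
      _ = 2 * d * ((Real.sqrt s)⁻¹ * edgeProfile (s - r')) := by rw [edgeProfile]; ring
      _ ≤ _ := by
          have := edgeProfile_nonneg (s - r)
          gcongr
          linarith

theorem abs_waveKernel_sub_le {s r r' d : ℝ} (hs : 0 < s) (hr : 0 ≤ r) (hr' : 0 ≤ r')
    (hd : |r - r'| ≤ d) (h1 : 1 ≤ d) :
    |waveKernel s r - waveKernel s r'| ≤
      2 * d * ((Real.sqrt s)⁻¹ * (edgeProfile (s - r) + edgeProfile (s - r'))) := by
  have hd' := abs_le.1 hd
  rcases le_total r r' with h | h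
  · exact abs_waveKernel_sub_le_of_le hs hr h (by linarith) h1
  · rw [abs_sub_comm, add_comm]
    exact abs_waveKernel_sub_le_of_le hs hr' h (by linarith) h1

/-! ### Integrals of the edge profile in time and in space -/

theorem integrableOn_rpow_neg_div_one_add {a : ℝ} (h0 : 0 < a) (h1 : a < 1) :
    IntegrableOn (fun ρ : ℝ => ρ ^ (-a) / (1 + ρ)) (Set.Ioi 0) := by
  have hm : Measurable fun ρ : ℝ => ρ ^ (-a) / (1 + ρ) := by fun_prop
  have e1 : IntegrableOn (fun ρ : ℝ => ρ ^ (-a) / (1 + ρ)) (Set.Ioc 0 1) := by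
    have h := (intervalIntegral.intervalIntegrable_rpow' (a := 0) (b := 1)
      (show (-1 : ℝ) < -a by linarith))
    refine ((intervalIntegrable_iff_integrableOn_Ioc_of_le zero_le_one).1 h).mono'
      hm.aestronglyMeasurable ?_
    refine (ae_restrict_mem measurableSet_Ioc).mono fun ρ hρ => ?_
    have hρ0 : 0 < ρ := hρ.1
    rw [Real.norm_of_nonneg (by positivity)]
    exact div_le_self (by positivity) (by linarith)
  have e2 : IntegrableOn (fun ρ : ℝ => ρ ^ (-a) / (1 + ρ)) (Set.Ioi 1) := by
    refine (integrableOn_Ioi_rpow_of_lt (show -a - 1 < -1 by linarith) one_pos).mono'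
      hm.aestronglyMeasurable ?_
    refine (ae_restrict_mem measurableSet_Ioi).mono fun ρ hρ => ?_
    have hρ0 : 0 < ρ := one_pos.trans hρ
    rw [Real.norm_of_nonneg (by positivity), Real.rpow_sub hρ0, Real.rpow_one]
    gcongr
    linarith
  rw [← Set.Ioc_union_Ioi_eq_Ioi (zero_le_one' ℝ)]
  exact e1.union e2

theorem integrable_edgeProfile : Integrable edgeProfile := by
  have h : IntegrableOn edgeProfile (Set.Ioi 0) := by
    refine (integrableOn_rpow_neg_div_one_add (a := 1 / 2) (by norm_num) (by norm_num)).congr_fun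
      (fun ρ hρ => ?_) measurableSet_Ioi
    simp only [edgeProfile]
    rw [Real.rpow_neg (le_of_lt hρ), Real.sqrt_eq_rpow]
  rw [← integrableOn_univ, ← Set.Iic_union_Ioi (a := (0 : ℝ))]
  refine IntegrableOn.union ?_ h
  refine (integrableOn_zero (μ := volume)).congr_fun (fun ρ hρ => ?_) measurableSet_Iic
  exact (edgeProfile_of_nonpos hρ).symm

/-- The mass of the edge profile. -/
def edgeMass : ℝ≥0∞ := ∫⁻ ρ, ENNReal.ofReal (edgeProfile ρ)

theorem edgeMass_ne_top : edgeMass ≠ ⊤ := integrable_edgeProfile.lintegral_lt_top.ne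

theorem lintegral_edgeProfile_sub (c : ℝ) :
    ∫⁻ s, ENNReal.ofReal (edgeProfile (s - c)) = edgeMass :=
  lintegral_sub_right_eq_self (fun ρ => ENNReal.ofReal (edgeProfile ρ)) c

/-- The mass of the edge profile against an additional weight `ρ ^ (-1/4)`. -/
def edgeMassSing : ℝ≥0∞ := ∫⁻ ρ in Set.Ioi 0, ENNReal.ofReal (ρ ^ (-(3 / 4 : ℝ)) / (1 + ρ))

theorem edgeMassSing_ne_top : edgeMassSing ≠ ⊤ :=
  (integrableOn_rpow_neg_div_one_add (a := 3 / 4) (by norm_num) (by norm_num)).lintegral_lt_top.ne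

/-- On s > r, split s^{-1/2} into two factors s^{-1/4}. One is at most r^{-1/4}, a weak singularity
in the plane; the other is at most (s-r)^{-1/4}, which worsens the singularity at the front to the
still integrable exponent -3/4. -/
theorem lintegral_inv_sqrt_mul_edgeProfile_le {r : ℝ} (hr : 0 < r) :
    ∫⁻ s in Set.Ioi 0, ENNReal.ofReal ((Real.sqrt s)⁻¹ * edgeProfile (s - r)) ≤
      ENNReal.ofReal (r ^ (-(1 / 4 : ℝ))) * edgeMassSing := by
  set G : ℝ → ℝ≥0∞ := (Set.Ioi (0 : ℝ)).indicator
    fun ρ => ENNReal.ofReal (ρ ^ (-(3 / 4 : ℝ)) / (1 + ρ)) with hG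
  have hGm : Measurable G := Measurable.indicator (by fun_prop) measurableSet_Ioi
  have hpt : ∀ s ∈ Set.Ioi (0 : ℝ), ENNReal.ofReal ((Real.sqrt s)⁻¹ * edgeProfile (s - r)) ≤
      ENNReal.ofReal (r ^ (-(1 / 4 : ℝ))) * G (s - r) := by
    intro s hs
    rcases le_or_gt s r with h | h
    · rw [edgeProfile_of_nonpos (by linarith)]
      simp
    have hsr : 0 < s - r := by linarith
    have hs0 : 0 < s := hs
    rw [hG, Set.indicator_of_mem (show s - r ∈ Set.Ioi (0 : ℝ) from hsr),
      ← ENNReal.ofReal_mul (by positivity)]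
    apply ENNReal.ofReal_le_ofReal
    have e1 : (Real.sqrt s)⁻¹ = s ^ (-(1 / 4 : ℝ)) * s ^ (-(1 / 4 : ℝ)) := by
      rw [Real.sqrt_eq_rpow, ← Real.rpow_neg hs0.le, ← Real.rpow_add hs0]
      norm_num
    have e2 : s ^ (-(1 / 4 : ℝ)) ≤ r ^ (-(1 / 4 : ℝ)) :=
      Real.rpow_le_rpow_of_nonpos hr h.le (by norm_num)
    have e3 : s ^ (-(1 / 4 : ℝ)) ≤ (s - r) ^ (-(1 / 4 : ℝ)) :=
      Real.rpow_le_rpow_of_nonpos hsr (by linarith) (by norm_num)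
    have e4 : (s - r) ^ (-(3 / 4 : ℝ)) = (s - r) ^ (-(1 / 4 : ℝ)) * (Real.sqrt (s - r))⁻¹ := by
      rw [Real.sqrt_eq_rpow, ← Real.rpow_neg hsr.le, ← Real.rpow_add hsr]
      norm_num
    rw [edgeProfile, e1, e4]
    calc s ^ (-(1 / 4 : ℝ)) * s ^ (-(1 / 4 : ℝ)) * ((Real.sqrt (s - r))⁻¹ / (1 + (s - r)))
        ≤ r ^ (-(1 / 4 : ℝ)) * (s - r) ^ (-(1 / 4 : ℝ)) *
            ((Real.sqrt (s - r))⁻¹ / (1 + (s - r))) := by gcongr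
      _ = _ := by ring
  calc ∫⁻ s in Set.Ioi 0, ENNReal.ofReal ((Real.sqrt s)⁻¹ * edgeProfile (s - r))
      ≤ ∫⁻ s in Set.Ioi 0, ENNReal.ofReal (r ^ (-(1 / 4 : ℝ))) * G (s - r) :=
        setLIntegral_mono' measurableSet_Ioi hpt
    _ ≤ ∫⁻ s, ENNReal.ofReal (r ^ (-(1 / 4 : ℝ))) * G (s - r) := setLIntegral_le_lintegral _ _
    _ = ENNReal.ofReal (r ^ (-(1 / 4 : ℝ))) * ∫⁻ s, G (s - r) :=
        lintegral_const_mul _ (by fun_prop)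
    _ = _ := by
        rw [lintegral_sub_right_eq_self G r, hG, lintegral_indicator measurableSet_Ioi]
        rfl

theorem integrableOn_inv_sqrt_mul_edgeProfile {r : ℝ} (hr : 0 < r) :
    IntegrableOn (fun s => (Real.sqrt s)⁻¹ * edgeProfile (s - r)) (Set.Ioi 0) := by
  refine ⟨Measurable.aestronglyMeasurable (by fun_prop), ?_⟩
  rw [hasFiniteIntegral_iff_ofReal (Eventually.of_forall fun s =>
    mul_nonneg (inv_nonneg.2 (Real.sqrt_nonneg _)) (edgeProfile_nonneg _))]
  exact (lintegral_inv_sqrt_mul_edgeProfile_le hr).trans_lt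
    (ENNReal.mul_lt_top ENNReal.ofReal_lt_top edgeMassSing_ne_top.lt_top)

theorem integrableOn_waveKernel_sub {r r' : ℝ} (hr : 0 < r) (hr' : 0 < r') :
    IntegrableOn (fun s => waveKernel s r - waveKernel s r') (Set.Ioi 0) := by
  refine (((integrableOn_inv_sqrt_mul_edgeProfile hr).add
    (integrableOn_inv_sqrt_mul_edgeProfile hr')).const_mul (2 * (|r - r'| + 1))).mono'
    (Measurable.aestronglyMeasurable (by fun_prop)) ?_
  refine (ae_restrict_mem measurableSet_Ioi).mono fun s hs => ?_
  refine (abs_waveKernel_sub_le hs hr.le hr'.le (d := |r - r'| + 1) (by linarith)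
    (by linarith [abs_nonneg (r - r')])).trans_eq ?_
  simp only [Pi.add_apply]
  ring

/-- A profile concentrated near a circle of radius `s - c` has mass `O(√s)` in the plane. -/
theorem lintegral_edgeProfile_norm_le {s c : ℝ} (hs : 0 < s) (hc : 0 ≤ c) :
    ∫⁻ x : Plane, ENNReal.ofReal ((Real.sqrt s)⁻¹ * edgeProfile (s - (c + ‖x‖))) ≤
      ENNReal.ofReal (2 * (volume : Measure Plane).real (Metric.ball 0 1)) *
        (ENNReal.ofReal (Real.sqrt s) * edgeMass) := by
  set f : ℝ → ℝ := fun r => (Real.sqrt s)⁻¹ * edgeProfile (s - (c + r)) with hf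
  have hf0 : ∀ r, 0 ≤ f r := fun r =>
    mul_nonneg (inv_nonneg.2 (Real.sqrt_nonneg _)) (edgeProfile_nonneg _)
  have hsq : 0 < Real.sqrt s := Real.sqrt_pos.2 hs
  have hdim : Module.finrank ℝ Plane = 2 := by simp
  -- In polar coordinates the Jacobian contributes r. Since c ≥ 0, the profile is supported where r
  -- < s, so r·s^{-1/2} ≤ √s.
  have hdom : ∀ r ∈ Set.Ioi (0 : ℝ), r * f r ≤ Real.sqrt s * edgeProfile (s - c - r) := by
    intro r hr
    have hr0 : 0 < r := hr
    simp only [hf]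
    rw [← sub_sub]
    rcases le_or_gt s r with h | h
    · rw [edgeProfile_of_nonpos (by linarith)]
      simp
    · have h0 := edgeProfile_nonneg (s - c - r)
      have : r * (Real.sqrt s)⁻¹ ≤ Real.sqrt s := by
        rw [← div_eq_mul_inv, div_le_iff₀ hsq, Real.mul_self_sqrt hs.le]
        exact h.le
      calc r * ((Real.sqrt s)⁻¹ * edgeProfile (s - c - r))
          = r * (Real.sqrt s)⁻¹ * edgeProfile (s - c - r) := by ring
        _ ≤ _ := by gcongr
  have hgi : Integrable fun r : ℝ => Real.sqrt s * edgeProfile (s - c - r) :=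
    (integrable_edgeProfile.comp_sub_left (s - c)).const_mul _
  have hi : IntegrableOn (fun r : ℝ => r * f r) (Set.Ioi 0) := by
    refine hgi.integrableOn.mono' (Measurable.aestronglyMeasurable (by fun_prop)) ?_
    refine (ae_restrict_mem measurableSet_Ioi).mono fun r hr => ?_
    have hr0 : (0 : ℝ) < r := hr
    rw [Real.norm_of_nonneg (mul_nonneg hr0.le (hf0 r))]
    exact hdom r hr
  have hI : Integrable fun x : Plane => f ‖x‖ := by
    rw [integrable_fun_norm_addHaar volume (f := f), hdim]
    simpa using hi
  have hle : ∫ r in Set.Ioi (0 : ℝ), r * f r ≤ Real.sqrt s * ∫ ρ, edgeProfile ρ := by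
    calc ∫ r in Set.Ioi (0 : ℝ), r * f r
        ≤ ∫ r in Set.Ioi (0 : ℝ), Real.sqrt s * edgeProfile (s - c - r) :=
          setIntegral_mono_on hi hgi.integrableOn measurableSet_Ioi hdom
      _ ≤ ∫ r, Real.sqrt s * edgeProfile (s - c - r) :=
          setIntegral_le_integral hgi (Eventually.of_forall fun r =>
            mul_nonneg hsq.le (edgeProfile_nonneg _))
      _ = _ := by rw [integral_const_mul, integral_sub_left_eq_self edgeProfile volume (s - c)]
  have hmass : edgeMass = ENNReal.ofReal (∫ ρ, edgeProfile ρ) :=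
    (ofReal_integral_eq_lintegral_ofReal integrable_edgeProfile
      (Eventually.of_forall edgeProfile_nonneg)).symm
  rw [← ofReal_integral_eq_lintegral_ofReal hI (Eventually.of_forall fun x => hf0 _),
    integral_fun_norm_addHaar volume f, hdim, hmass, ← ENNReal.ofReal_mul hsq.le,
    ← ENNReal.ofReal_mul (by positivity)]
  apply ENNReal.ofReal_le_ofReal
  simp only [Nat.add_one_sub_one, pow_one, smul_eq_mul, nsmul_eq_mul, Nat.cast_ofNat]
  calc (2 : ℝ) * ((volume : Measure Plane).real (Metric.ball 0 1) *
        ∫ r in Set.Ioi (0 : ℝ), r * f r)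
      ≤ 2 * ((volume : Measure Plane).real (Metric.ball 0 1) *
        (Real.sqrt s * ∫ ρ, edgeProfile ρ)) := by gcongr
    _ = _ := by ring

/-! ### Waves generated by a neutral density -/

/-- A density on the plane with weighted decay and vanishing mean. -/
structure NeutralDensity (ψ : Plane → ℂ) : Prop where
  stronglyMeasurable : StronglyMeasurable ψ
  integrable_weight : Integrable fun z => ‖ψ z‖ * (1 + ‖z‖)
  integrable_weight_sq : Integrable fun z => (‖ψ z‖ * (1 + ‖z‖)) ^ 2
  integral_eq_zero : ∫ z, ψ z = 0

/-- The solution at time `s` of the wave equation in the plane with initial velocity `ψ` (up to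
a constant), when `ψ` has mean zero. -/
def waveField (ψ : Plane → ℂ) (x : Plane) (s : ℝ) : ℂ :=
  ∫ z, ((waveKernel s ‖x - z‖ - waveKernel s (1 + ‖x‖) : ℝ) : ℂ) * ψ z

/-- The contribution of the point `z` to `waveMajorant`. -/
def majorantKernel (ψ : Plane → ℂ) (x : Plane) (s : ℝ) (z : Plane) : ℝ≥0∞ :=
  ENNReal.ofReal (‖ψ z‖ * (1 + ‖z‖)) *
    (ENNReal.ofReal ((Real.sqrt s)⁻¹ * edgeProfile (s - ‖x - z‖)) +
      ENNReal.ofReal ((Real.sqrt s)⁻¹ * edgeProfile (s - (1 + ‖x‖))))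

/-- A majorant of `waveField`. -/
def waveMajorant (ψ : Plane → ℂ) (x : Plane) (s : ℝ) : ℝ≥0∞ := ∫⁻ z, majorantKernel ψ x s z

variable {ψ : Plane → ℂ}

theorem NeutralDensity.integrable (hψ : NeutralDensity ψ) : Integrable ψ := by
  refine hψ.integrable_weight.mono' hψ.stronglyMeasurable.aestronglyMeasurable ?_
  exact Eventually.of_forall fun z =>
    le_mul_of_one_le_right (norm_nonneg _) (by linarith [norm_nonneg z])

theorem NeutralDensity.conj (hψ : NeutralDensity ψ) :
    NeutralDensity fun z => (starRingEnd ℂ) (ψ z) where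
  stronglyMeasurable := Complex.continuous_conj.comp_stronglyMeasurable hψ.stronglyMeasurable
  integrable_weight := by simpa using hψ.integrable_weight
  integrable_weight_sq := by simpa using hψ.integrable_weight_sq
  integral_eq_zero := by rw [integral_conj, hψ.integral_eq_zero, map_zero]

theorem waveField_conj (ψ : Plane → ℂ) (x : Plane) (s : ℝ) :
    waveField (fun z => (starRingEnd ℂ) (ψ z)) x s = (starRingEnd ℂ) (waveField ψ x s) := by
  rw [waveField, waveField, ← integral_conj]
  simp

theorem waveMajorant_conj (ψ : Plane → ℂ) (x : Plane) (s : ℝ) :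
    waveMajorant (fun z => (starRingEnd ℂ) (ψ z)) x s = waveMajorant ψ x s := by
  simp [waveMajorant, majorantKernel]

/-- The radii |x-z| and 1+|x| differ by at most 1+|z|, which is also at least 1 and therefore
admissible as d; the loss of one factor 1+|z| is the weight on ψ. -/
theorem enorm_waveKernel_sub_mul_le (ψ : Plane → ℂ) (x z : Plane) {s : ℝ} (hs : 0 < s) :
    ‖((waveKernel s ‖x - z‖ - waveKernel s (1 + ‖x‖) : ℝ) : ℂ) * ψ z‖ₑ ≤
      2 * majorantKernel ψ x s z := by
  have h := abs_waveKernel_sub_le hs (norm_nonneg (x - z)) (r' := 1 + ‖x‖) (by positivity)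
    (d := 1 + ‖z‖) (by
      have := abs_norm_sub_norm_le (x - z) x
      rw [show x - z - x = -z by abel, norm_neg] at this
      rw [abs_le] at this ⊢
      constructor <;> linarith [norm_nonneg z]) (by linarith [norm_nonneg z])
  have hsq : 0 ≤ (Real.sqrt s)⁻¹ := inv_nonneg.2 (Real.sqrt_nonneg _)
  have e1 := edgeProfile_nonneg (s - ‖x - z‖)
  have e2 := edgeProfile_nonneg (s - (1 + ‖x‖))
  have two_mul_ofReal : ∀ t : ℝ, 2 * ENNReal.ofReal t = ENNReal.ofReal (2 * t) := fun t => by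
    rw [ENNReal.ofReal_mul (by norm_num), ENNReal.ofReal_ofNat]
  rw [majorantKernel, ← ENNReal.ofReal_add (by positivity) (by positivity),
    ← ENNReal.ofReal_mul (by positivity), two_mul_ofReal, ← ofReal_norm]
  apply ENNReal.ofReal_le_ofReal
  rw [norm_mul, Complex.norm_real, Real.norm_eq_abs]
  calc |waveKernel s ‖x - z‖ - waveKernel s (1 + ‖x‖)| * ‖ψ z‖
      ≤ 2 * (1 + ‖z‖) * ((Real.sqrt s)⁻¹ *
          (edgeProfile (s - ‖x - z‖) + edgeProfile (s - (1 + ‖x‖)))) * ‖ψ z‖ := by gcongr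
    _ = _ := by ring

theorem enorm_waveField_le (ψ : Plane → ℂ) (x : Plane) {s : ℝ} (hs : 0 < s) :
    ‖waveField ψ x s‖ₑ ≤ 2 * waveMajorant ψ x s := by
  refine (enorm_integral_le_lintegral_enorm _).trans ?_
  rw [waveMajorant, ← lintegral_const_mul' _ _ (by norm_num)]
  exact lintegral_mono fun z => enorm_waveKernel_sub_mul_le ψ x z hs

theorem NeutralDensity.measurable_majorantKernel (hψ : NeutralDensity ψ) {α : Type*}
    [MeasurableSpace α] {f h : α → Plane} {g : α → ℝ} (hf : Measurable f) (hg : Measurable g)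
    (hh : Measurable h) : Measurable fun a => majorantKernel ψ (f a) (g a) (h a) := by
  have := hψ.stronglyMeasurable.measurable
  unfold majorantKernel
  fun_prop

theorem NeutralDensity.measurable_waveMajorant (hψ : NeutralDensity ψ) {α : Type*}
    [MeasurableSpace α] {f : α → Plane} {g : α → ℝ} (hf : Measurable f) (hg : Measurable g) :
    Measurable fun a => waveMajorant ψ (f a) (g a) :=
  (hψ.measurable_majorantKernel (hf.comp measurable_fst) (hg.comp measurable_fst)
    measurable_snd).lintegral_prod_right'

theorem NeutralDensity.stronglyMeasurable_waveField (hψ : NeutralDensity ψ) {α : Type*}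
    [MeasurableSpace α] {f : α → Plane} {g : α → ℝ} (hf : Measurable f) (hg : Measurable g) :
    StronglyMeasurable fun a => waveField ψ (f a) (g a) := by
  have := hψ.stronglyMeasurable.measurable
  refine StronglyMeasurable.integral_prod_right' (f := fun q : α × Plane =>
    ((waveKernel (g q.1) ‖f q.1 - q.2‖ - waveKernel (g q.1) (1 + ‖f q.1‖) : ℝ) : ℂ) * ψ q.2) ?_
  exact Measurable.stronglyMeasurable (by fun_prop)

/-! ### Three integral bounds for the wave majorant -/

theorem integrable_norm_rpow_ball :
    Integrable ((Metric.ball (0 : Plane) 1).indicator fun u : Plane => ‖u‖ ^ (-(1 / 2 : ℝ))) := by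
  have hfin : Module.finrank ℝ Plane = 2 := by simp
  rw [integrable_indicator_iff measurableSet_ball]
  refine integrableOn_ball_of_norm_le_rpow (C := 1) (α := 1 / 2) (by rw [hfin]; norm_num)
    (by rw [hfin]; norm_num) ?_ (Measurable.aestronglyMeasurable (by fun_prop))
  refine Eventually.of_forall fun x => ?_
  rw [Real.norm_of_nonneg (by positivity), one_mul]

/-- Away from the unit ball about x the singular factor is at most 1. Inside it, the product is at
most the sum of the squares; the square of the weighted density is integrable by assumption, and
|x-z|^{-1/2} is locally integrable in the plane. -/
theorem NeutralDensity.exists_lintegral_rpow_le (hψ : NeutralDensity ψ) :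
    ∃ N : ℝ≥0∞, N ≠ ⊤ ∧ ∀ x : Plane,
      ∫⁻ z, ENNReal.ofReal (‖ψ z‖ * (1 + ‖z‖)) * ENNReal.ofReal (‖x - z‖ ^ (-(1 / 4 : ℝ))) ≤ N := by
  set W : Plane → ℝ := fun z => ‖ψ z‖ * (1 + ‖z‖) with hW
  set S : Plane → ℝ := (Metric.ball (0 : Plane) 1).indicator fun u : Plane => ‖u‖ ^ (-(1 / 2 : ℝ))
    with hS
  have hW0 : ∀ z, 0 ≤ W z := fun z => by positivity
  have hS0 : ∀ u, 0 ≤ S u := fun u => Set.indicator_nonneg (fun u _ => by positivity) u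
  have hSm : Measurable S := Measurable.indicator (by fun_prop) measurableSet_ball
  refine ⟨(∫⁻ z, ENNReal.ofReal (W z)) + (∫⁻ z, ENNReal.ofReal (W z ^ 2)) +
    ∫⁻ z, ENNReal.ofReal (S z), ?_, fun x => ?_⟩
  · refine ENNReal.add_ne_top.2 ⟨ENNReal.add_ne_top.2 ⟨?_, ?_⟩, ?_⟩
    · exact hψ.integrable_weight.lintegral_lt_top.ne
    · exact hψ.integrable_weight_sq.lintegral_lt_top.ne
    · exact integrable_norm_rpow_ball.lintegral_lt_top.ne
  · have hpsi := hψ.stronglyMeasurable.measurable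
    rw [← lintegral_sub_left_eq_self (fun z => ENNReal.ofReal (S z)) x,
      ← lintegral_add_left (by fun_prop), ← lintegral_add_left (by fun_prop)]
    refine lintegral_mono fun z => ?_
    rw [← ENNReal.ofReal_mul (hW0 z), ← ENNReal.ofReal_add (hW0 z) (sq_nonneg _),
      ← ENNReal.ofReal_add (add_nonneg (hW0 z) (sq_nonneg _)) (hS0 _)]
    apply ENNReal.ofReal_le_ofReal
    have h0 := hW0 z
    have h1 := hS0 (x - z)
    by_cases h : x - z ∈ Metric.ball (0 : Plane) 1
    · have e : S (x - z) = (‖x - z‖ ^ (-(1 / 4 : ℝ))) ^ 2 := by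
        rw [hS, Set.indicator_of_mem h, ← Real.rpow_natCast, ← Real.rpow_mul (norm_nonneg _)]
        norm_num
      rw [e]
      nlinarith [sq_nonneg (W z - ‖x - z‖ ^ (-(1 / 4 : ℝ))), sq_nonneg (W z),
        sq_nonneg (‖x - z‖ ^ (-(1 / 4 : ℝ)))]
    · have h' : 1 ≤ ‖x - z‖ := by simpa using h
      have := Real.rpow_le_one_of_one_le_of_nonpos h' (show (-(1 / 4 : ℝ)) ≤ 0 by norm_num)
      nlinarith [sq_nonneg (W z)]

theorem NeutralDensity.exists_lintegral_waveMajorant_le (hψ : NeutralDensity ψ) :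
    ∃ N : ℝ≥0∞, N ≠ ⊤ ∧ ∀ x : Plane, ∫⁻ s in Set.Ioi 0, waveMajorant ψ x s ≤ N := by
  obtain ⟨N, hN, hle⟩ := hψ.exists_lintegral_rpow_le
  have hpsi := hψ.stronglyMeasurable.measurable
  set M : ℝ≥0∞ := ∫⁻ z, ENNReal.ofReal (‖ψ z‖ * (1 + ‖z‖)) with hM
  have hMt : M ≠ ⊤ := hψ.integrable_weight.lintegral_lt_top.ne
  refine ⟨(N + M) * edgeMassSing,
    ENNReal.mul_ne_top (ENNReal.add_ne_top.2 ⟨hN, hMt⟩) edgeMassSing_ne_top, fun x => ?_⟩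
  have hm : Measurable fun q : ℝ × Plane => majorantKernel ψ x q.1 q.2 :=
    hψ.measurable_majorantKernel measurable_const measurable_fst measurable_snd
  unfold waveMajorant
  rw [lintegral_lintegral_swap hm.aemeasurable]
  have hne : ∀ᵐ z : Plane, z ≠ x := by simp [ae_iff]
  calc ∫⁻ z, ∫⁻ s in Set.Ioi 0, majorantKernel ψ x s z
      ≤ ∫⁻ z, (ENNReal.ofReal (‖ψ z‖ * (1 + ‖z‖)) * ENNReal.ofReal (‖x - z‖ ^ (-(1 / 4 : ℝ))) +
          ENNReal.ofReal (‖ψ z‖ * (1 + ‖z‖))) * edgeMassSing := by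
        refine lintegral_mono_ae ?_
        filter_upwards [hne] with z hz
        simp only [majorantKernel]
        rw [lintegral_const_mul _ (by fun_prop), lintegral_add_left (by fun_prop)]
        have h1 := lintegral_inv_sqrt_mul_edgeProfile_le
          (norm_pos_iff.2 (sub_ne_zero.2 hz.symm))
        have h2 := lintegral_inv_sqrt_mul_edgeProfile_le (show 0 < 1 + ‖x‖ by positivity)
        -- The reference radius is 1+|x| and not |x| so that this factor stays bounded at x = 0.
        have h3 : ENNReal.ofReal ((1 + ‖x‖) ^ (-(1 / 4 : ℝ))) ≤ 1 := by
          rw [ENNReal.ofReal_le_one]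
          exact Real.rpow_le_one_of_one_le_of_nonpos (by linarith [norm_nonneg x]) (by norm_num)
        calc _ ≤ ENNReal.ofReal (‖ψ z‖ * (1 + ‖z‖)) *
              (ENNReal.ofReal (‖x - z‖ ^ (-(1 / 4 : ℝ))) * edgeMassSing + 1 * edgeMassSing) := by
              gcongr
              exact h2.trans (by gcongr)
          _ = _ := by ring
    _ = (∫⁻ z, (ENNReal.ofReal (‖ψ z‖ * (1 + ‖z‖)) * ENNReal.ofReal (‖x - z‖ ^ (-(1 / 4 : ℝ))) +
          ENNReal.ofReal (‖ψ z‖ * (1 + ‖z‖)))) * edgeMassSing :=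
        lintegral_mul_const _ (by fun_prop)
    _ ≤ (N + M) * edgeMassSing := by
        rw [lintegral_add_right _ (by fun_prop)]
        gcongr
        exact hle x

/-- The weight √s cancels the factor s^{-1/2} exactly, leaving translates of the edge profile, whose
mass does not depend on the position of the front. -/
theorem NeutralDensity.exists_lintegral_sqrt_mul_waveMajorant_le (hψ : NeutralDensity ψ) :
    ∃ N : ℝ≥0∞, N ≠ ⊤ ∧ ∀ x : Plane,
      ∫⁻ s in Set.Ioi 0, ENNReal.ofReal (Real.sqrt s) * waveMajorant ψ x s ≤ N := by
  have hpsi := hψ.stronglyMeasurable.measurable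
  set M : ℝ≥0∞ := ∫⁻ z, ENNReal.ofReal (‖ψ z‖ * (1 + ‖z‖)) with hM
  have hMt : M ≠ ⊤ := hψ.integrable_weight.lintegral_lt_top.ne
  refine ⟨M * (edgeMass + edgeMass),
    ENNReal.mul_ne_top hMt (ENNReal.add_ne_top.2 ⟨edgeMass_ne_top, edgeMass_ne_top⟩), fun x => ?_⟩
  have hm : Measurable fun q : ℝ × Plane =>
      ENNReal.ofReal (Real.sqrt q.1) * majorantKernel ψ x q.1 q.2 := by
    exact Measurable.mul (by fun_prop)
      (hψ.measurable_majorantKernel measurable_const measurable_fst measurable_snd)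
  unfold waveMajorant
  simp_rw [← lintegral_const_mul' (ENNReal.ofReal (Real.sqrt _)) _ ENNReal.ofReal_ne_top]
  rw [lintegral_lintegral_swap hm.aemeasurable]
  have hcancel : ∀ s ∈ Set.Ioi (0 : ℝ), ∀ r : ℝ, ENNReal.ofReal (Real.sqrt s) *
      ENNReal.ofReal ((Real.sqrt s)⁻¹ * edgeProfile (s - r)) =
        ENNReal.ofReal (edgeProfile (s - r)) := by
    intro s hs r
    have : 0 < Real.sqrt s := Real.sqrt_pos.2 hs
    rw [← ENNReal.ofReal_mul this.le, mul_inv_cancel_left₀ this.ne']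
  calc ∫⁻ z, ∫⁻ s in Set.Ioi 0, ENNReal.ofReal (Real.sqrt s) * majorantKernel ψ x s z
      ≤ ∫⁻ z, ENNReal.ofReal (‖ψ z‖ * (1 + ‖z‖)) * (edgeMass + edgeMass) := by
        refine lintegral_mono fun z => ?_
        calc ∫⁻ s in Set.Ioi 0, ENNReal.ofReal (Real.sqrt s) * majorantKernel ψ x s z
            = ∫⁻ s in Set.Ioi 0, ENNReal.ofReal (‖ψ z‖ * (1 + ‖z‖)) *
                (ENNReal.ofReal (edgeProfile (s - ‖x - z‖)) +
                  ENNReal.ofReal (edgeProfile (s - (1 + ‖x‖)))) := by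
              refine setLIntegral_congr_fun measurableSet_Ioi fun s hs => ?_
              simp only [majorantKernel]
              rw [← hcancel s hs ‖x - z‖, ← hcancel s hs (1 + ‖x‖)]
              ring
          _ ≤ ∫⁻ s, ENNReal.ofReal (‖ψ z‖ * (1 + ‖z‖)) *
                (ENNReal.ofReal (edgeProfile (s - ‖x - z‖)) +
                  ENNReal.ofReal (edgeProfile (s - (1 + ‖x‖)))) := setLIntegral_le_lintegral _ _
          _ = _ := by
              rw [lintegral_const_mul _ (by fun_prop), lintegral_add_left (by fun_prop),
                lintegral_edgeProfile_sub, lintegral_edgeProfile_sub]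
    _ = M * (edgeMass + edgeMass) := lintegral_mul_const _ (by fun_prop)

/-- At time s each term is concentrated near a circle of circumference O(s), about z or about the
origin, with amplitude s^{-1/2}. The √s growth is what the decay of m̂ has to beat later. -/
theorem NeutralDensity.exists_lintegral_waveMajorant_space_le (hψ : NeutralDensity ψ) :
    ∃ N : ℝ≥0∞, N ≠ ⊤ ∧ ∀ s : ℝ, 0 < s →
      ∫⁻ x : Plane, waveMajorant ψ x s ≤ N * ENNReal.ofReal (Real.sqrt s) := by
  have hpsi := hψ.stronglyMeasurable.measurable
  set M : ℝ≥0∞ := ∫⁻ z, ENNReal.ofReal (‖ψ z‖ * (1 + ‖z‖)) with hM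
  have hMt : M ≠ ⊤ := hψ.integrable_weight.lintegral_lt_top.ne
  set c : ℝ≥0∞ := ENNReal.ofReal (2 * (volume : Measure Plane).real (Metric.ball 0 1)) with hc
  refine ⟨M * (c * edgeMass + c * edgeMass), ?_, fun s hs => ?_⟩
  · have : c * edgeMass ≠ ⊤ := ENNReal.mul_ne_top ENNReal.ofReal_ne_top edgeMass_ne_top
    exact ENNReal.mul_ne_top hMt (ENNReal.add_ne_top.2 ⟨this, this⟩)
  have hm : Measurable fun q : Plane × Plane => majorantKernel ψ q.1 s q.2 :=
    hψ.measurable_majorantKernel measurable_fst measurable_const measurable_snd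
  unfold waveMajorant
  rw [lintegral_lintegral_swap hm.aemeasurable]
  calc ∫⁻ z, ∫⁻ x, majorantKernel ψ x s z
      ≤ ∫⁻ z, ENNReal.ofReal (‖ψ z‖ * (1 + ‖z‖)) *
          (c * (ENNReal.ofReal (Real.sqrt s) * edgeMass) +
            c * (ENNReal.ofReal (Real.sqrt s) * edgeMass)) := by
        refine lintegral_mono fun z => ?_
        simp only [majorantKernel]
        rw [lintegral_const_mul _ (by fun_prop), lintegral_add_left (by fun_prop)]
        gcongr
        · have h := lintegral_edgeProfile_norm_le hs le_rfl
          simp only [zero_add] at h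
          rw [lintegral_sub_right_eq_self (fun x : Plane =>
            ENNReal.ofReal ((Real.sqrt s)⁻¹ * edgeProfile (s - ‖x‖))) z]
          exact h
        · exact lintegral_edgeProfile_norm_le hs zero_le_one
    _ = M * (c * (ENNReal.ofReal (Real.sqrt s) * edgeMass) +
            c * (ENNReal.ofReal (Real.sqrt s) * edgeMass)) := lintegral_mul_const _ (by fun_prop)
    _ = _ := by ring

/-- The one-sided Fourier transform of the wave field in time. -/
def fieldTransform (ψ : Plane → ℂ) (lam : ℝ) (x : Plane) : ℂ :=
  ∫ s in Set.Ioi (0 : ℝ), Complex.exp (-Complex.I * lam * s) * waveField ψ x s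

theorem norm_exp_neg_I_mul (lam s : ℝ) : ‖Complex.exp (-Complex.I * lam * s)‖ = 1 := by
  rw [Complex.norm_exp]
  simp

theorem NeutralDensity.stronglyMeasurable_fieldTransform (hψ : NeutralDensity ψ) {α : Type*}
    [MeasurableSpace α] {f : α → ℝ} {g : α → Plane} (hf : Measurable f) (hg : Measurable g) :
    StronglyMeasurable fun a => fieldTransform ψ (f a) (g a) := by
  refine StronglyMeasurable.integral_prod_right' (f := fun q : α × ℝ =>
    Complex.exp (-Complex.I * f q.1 * q.2) * waveField ψ (g q.1) q.2) ?_
  refine StronglyMeasurable.mul (Measurable.stronglyMeasurable (by fun_prop)) ?_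
  exact hψ.stronglyMeasurable_waveField (by fun_prop) (by fun_prop)

theorem NeutralDensity.integrableOn_waveField (hψ : NeutralDensity ψ) (x : Plane) :
    IntegrableOn (waveField ψ x) (Set.Ioi 0) := by
  obtain ⟨N, hN, hle⟩ := hψ.exists_lintegral_waveMajorant_le
  have hm : StronglyMeasurable (waveField ψ x) :=
    hψ.stronglyMeasurable_waveField measurable_const measurable_id
  refine ⟨hm.aestronglyMeasurable, ?_⟩
  calc ∫⁻ s in Set.Ioi 0, ‖waveField ψ x s‖ₑ
      ≤ ∫⁻ s in Set.Ioi 0, 2 * waveMajorant ψ x s :=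
        setLIntegral_mono' measurableSet_Ioi fun s hs => enorm_waveField_le ψ x hs
    _ = 2 * ∫⁻ s in Set.Ioi 0, waveMajorant ψ x s := lintegral_const_mul' _ _ (by norm_num)
    _ < ⊤ := ENNReal.mul_lt_top (by norm_num) ((hle x).trans_lt hN.lt_top)

theorem NeutralDensity.exists_norm_fieldTransform_le (hψ : NeutralDensity ψ) :
    ∃ N : ℝ, ∀ (lam : ℝ) (x : Plane), ‖fieldTransform ψ lam x‖ ≤ N := by
  obtain ⟨N, hN, hle⟩ := hψ.exists_lintegral_waveMajorant_le
  refine ⟨(2 * N).toReal, fun lam x => ?_⟩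
  rw [← toReal_enorm]
  refine ENNReal.toReal_mono (ENNReal.mul_ne_top (by norm_num) hN) ?_
  calc ‖fieldTransform ψ lam x‖ₑ
      ≤ ∫⁻ s in Set.Ioi (0 : ℝ), ‖Complex.exp (-Complex.I * lam * s) * waveField ψ x s‖ₑ :=
        enorm_integral_le_lintegral_enorm _
    _ ≤ ∫⁻ s in Set.Ioi 0, 2 * waveMajorant ψ x s := by
        refine setLIntegral_mono' measurableSet_Ioi fun s hs => ?_
        rw [enorm_mul, ← ofReal_norm, norm_exp_neg_I_mul, ENNReal.ofReal_one, one_mul]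
        exact enorm_waveField_le ψ x hs
    _ = 2 * ∫⁻ s in Set.Ioi 0, waveMajorant ψ x s := lintegral_const_mul' _ _ (by norm_num)
    _ ≤ 2 * N := by gcongr; exact hle x

/-! ### Hankel potentials of a neutral density as Fourier transforms in time -/

theorem NeutralDensity.integrable_waveKernel_prod (hψ : NeutralDensity ψ) (lam : ℝ) (x : Plane) :
    Integrable (fun q : ℝ × Plane => Complex.exp (-Complex.I * lam * q.1) *
      (((waveKernel q.1 ‖x - q.2‖ - waveKernel q.1 (1 + ‖x‖) : ℝ) : ℂ) * ψ q.2))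
      ((volume.restrict (Set.Ioi 0)).prod volume) := by
  obtain ⟨N, hN, hle⟩ := hψ.exists_lintegral_waveMajorant_le
  have hpsi := hψ.stronglyMeasurable.measurable
  have hm : Measurable (fun q : ℝ × Plane => Complex.exp (-Complex.I * lam * q.1) *
      (((waveKernel q.1 ‖x - q.2‖ - waveKernel q.1 (1 + ‖x‖) : ℝ) : ℂ) * ψ q.2)) := by fun_prop
  refine ⟨hm.aestronglyMeasurable, ?_⟩
  rw [HasFiniteIntegral, lintegral_prod _ (by fun_prop)]
  calc ∫⁻ s in Set.Ioi (0 : ℝ), ∫⁻ z, ‖Complex.exp (-Complex.I * lam * s) *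
        (((waveKernel s ‖x - z‖ - waveKernel s (1 + ‖x‖) : ℝ) : ℂ) * ψ z)‖ₑ
      ≤ ∫⁻ s in Set.Ioi 0, 2 * waveMajorant ψ x s := by
        refine setLIntegral_mono' measurableSet_Ioi fun s hs => ?_
        rw [waveMajorant, ← lintegral_const_mul' _ _ (by norm_num)]
        refine lintegral_mono fun z => ?_
        rw [enorm_mul, ← ofReal_norm, norm_exp_neg_I_mul, ENNReal.ofReal_one, one_mul]
        exact enorm_waveKernel_sub_mul_le ψ x z hs
    _ = 2 * ∫⁻ s in Set.Ioi 0, waveMajorant ψ x s := lintegral_const_mul' _ _ (by norm_num)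
    _ < ⊤ := ENNReal.mul_lt_top (by norm_num) ((hle x).trans_lt hN.lt_top)

theorem hankelMinus_sub_mul_ae (ψ : Plane → ℂ) {lam : ℝ} (hlam : 0 < lam) (x : Plane) : ∀ᵐ z : Plane,
      (hankelMinus (lam * ‖x - z‖) - hankelMinus (lam * (1 + ‖x‖))) * ψ z =
        2 * Complex.I / Real.pi * ∫ s in Set.Ioi (0 : ℝ), Complex.exp (-Complex.I * lam * s) *
          (((waveKernel s ‖x - z‖ - waveKernel s (1 + ‖x‖) : ℝ) : ℂ) * ψ z) := by
  have hne : ∀ᵐ z : Plane, z ≠ x := by simp [ae_iff]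
  filter_upwards [hne] with z hz
  have h1 : 0 < ‖x - z‖ := norm_pos_iff.2 (sub_ne_zero.2 hz.symm)
  have h2 : 0 < 1 + ‖x‖ := by positivity
  rw [hankelMinus_sub hlam h1 h2 (integrableOn_waveKernel_sub h1 h2), mul_assoc,
    ← integral_mul_const]
  simp_rw [mul_assoc]

/-- Fubini gives integrability once the Hankel function at the reference radius is subtracted; that
value is constant in z and ψ itself is integrable. -/
theorem NeutralDensity.integrable_hankelMinus_mul (hψ : NeutralDensity ψ) {lam : ℝ}
    (hlam : 0 < lam) (x : Plane) : Integrable fun z => hankelMinus (lam * ‖x - z‖) * ψ z := by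
  have h1 := ((hψ.integrable_waveKernel_prod lam x).integral_prod_right).const_mul
    (2 * Complex.I / Real.pi)
  have h2 := (h1.congr ((hankelMinus_sub_mul_ae ψ hlam x).mono fun z hz => hz.symm)).add
    (hψ.integrable.const_mul (hankelMinus (lam * (1 + ‖x‖))))
  refine h2.congr (Eventually.of_forall fun z => ?_)
  simp only [Pi.add_apply]
  ring

/-- Vanishing mean allows the reference value to be inserted at no cost; after that all integrals
converge absolutely and the order of s and z may be exchanged. -/
theorem NeutralDensity.integral_hankelMinus_mul (hψ : NeutralDensity ψ) {lam : ℝ}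
    (hlam : 0 < lam) (x : Plane) :
    ∫ z, hankelMinus (lam * ‖x - z‖) * ψ z = 2 * Complex.I / Real.pi * fieldTransform ψ lam x := by
  have h0 : ∫ z, hankelMinus (lam * ‖x - z‖) * ψ z =
      ∫ z, (hankelMinus (lam * ‖x - z‖) - hankelMinus (lam * (1 + ‖x‖))) * ψ z := by
    simp_rw [sub_mul]
    rw [integral_sub (hψ.integrable_hankelMinus_mul hlam x) (hψ.integrable.const_mul _),
      integral_const_mul, hψ.integral_eq_zero, mul_zero, sub_zero]
  rw [h0, integral_congr_ae (hankelMinus_sub_mul_ae ψ hlam x), integral_const_mul,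
    ← integral_integral_swap (hψ.integrable_waveKernel_prod lam x)]
  simp_rw [integral_const_mul]
  rfl

theorem besselJ0_eq (r : ℝ) :
    (besselJ0 r : ℂ) = 1 / 2 * (hankelMinus r + (starRingEnd ℂ) (hankelMinus r)) := by
  simp only [hankelMinus, map_sub, map_mul, Complex.conj_I, Complex.conj_ofReal]
  ring

/-- J₀ is the real part of H₀⁻. Conjugating the prefactor 2i/π changes its sign, so the two halves
enter as a difference. -/
theorem NeutralDensity.integral_conj_mul_besselJ0 (hψ : NeutralDensity ψ) {lam : ℝ}
    (hlam : 0 < lam) (y : Plane) :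
    ∫ w, (starRingEnd ℂ) (ψ w) * (besselJ0 (lam * ‖y - w‖) : ℂ) =
      Complex.I / Real.pi * (fieldTransform (fun z => (starRingEnd ℂ) (ψ z)) lam y -
        (starRingEnd ℂ) (fieldTransform ψ lam y)) := by
  have h1 := hψ.conj.integrable_hankelMinus_mul hlam y
  have h2 := hψ.integrable_hankelMinus_mul hlam y
  have h2' : Integrable fun w => (starRingEnd ℂ) (hankelMinus (lam * ‖y - w‖) * ψ w) :=
    Complex.conjCLE.toContinuousLinearMap.integrable_comp h2
  have e : ∀ w, (starRingEnd ℂ) (ψ w) * (besselJ0 (lam * ‖y - w‖) : ℂ) =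
      1 / 2 * (hankelMinus (lam * ‖y - w‖) * (starRingEnd ℂ) (ψ w) +
        (starRingEnd ℂ) (hankelMinus (lam * ‖y - w‖) * ψ w)) := by
    intro w
    rw [besselJ0_eq, map_mul]
    ring
  simp_rw [e]
  rw [integral_const_mul, integral_add h1 h2', integral_conj,
    hψ.integral_hankelMinus_mul hlam, hψ.conj.integral_hankelMinus_mul hlam]
  simp only [map_mul, map_div₀, Complex.conj_I, Complex.conj_ofReal, Complex.conj_ofNat]
  ring

/-! ### Decay of one-sided Fourier transforms -/

/-- The one-sided Fourier transform. -/
def halfFourier (m : ℝ → ℂ) (σ : ℝ) : ℂ :=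
  ∫ lam in Set.Ioi (0 : ℝ), m lam * Complex.exp (-Complex.I * lam * σ)

theorem hasDerivAt_exp_neg_I_mul (σ lam : ℝ) :
    HasDerivAt (fun t : ℝ => Complex.exp (-Complex.I * t * σ))
      (-(Complex.I * σ) * Complex.exp (-Complex.I * lam * σ)) lam := by
  have h : HasDerivAt (fun t : ℝ => -Complex.I * t * σ) (-Complex.I * 1 * σ) lam :=
    (((hasDerivAt_id lam).ofReal_comp).const_mul (-Complex.I)).mul_const (σ : ℂ)
  convert h.cexp using 1
  ring

theorem norm_one_sub_exp_le (σ lam : ℝ) :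
    ‖1 - Complex.exp (-Complex.I * lam * σ)‖ ≤ |σ| * |lam| := by
  have h := Real.norm_exp_I_mul_ofReal_sub_one_le (x := -(lam * σ))
  rw [norm_sub_rev]
  rw [show -Complex.I * lam * σ = Complex.I * ((-(lam * σ) : ℝ) : ℂ) by push_cast; ring]
  refine h.trans_eq ?_
  rw [norm_neg, Real.norm_eq_abs, abs_mul, mul_comm]

/-- Interpolation between the bounds |σ|λ and 2. The exponent 1/4 matches the weight on the second
derivative in `MildProfile`. -/
theorem norm_one_sub_exp_le_rpow (σ : ℝ) {lam : ℝ} (hlam : 0 < lam) :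
    ‖1 - Complex.exp (-Complex.I * lam * σ)‖ ≤
      2 * (|σ| ^ (1 / 4 : ℝ) * lam ^ (1 / 4 : ℝ)) := by
  rw [← Real.mul_rpow (abs_nonneg _) hlam.le]
  have h0 : 0 ≤ |σ| * lam := by positivity
  rcases le_total (|σ| * lam) 1 with h | h
  · have h1 := norm_one_sub_exp_le σ lam
    rw [abs_of_pos hlam] at h1
    have h2 : |σ| * lam ≤ (|σ| * lam) ^ (1 / 4 : ℝ) := by
      rcases h0.eq_or_lt with h3 | h3
      · rw [← h3]
        positivity
      · simpa using Real.rpow_le_rpow_of_exponent_ge h3 h (show (1 / 4 : ℝ) ≤ 1 by norm_num)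
    linarith [Real.rpow_nonneg h0 (1 / 4 : ℝ)]
  · have h1 : ‖1 - Complex.exp (-Complex.I * lam * σ)‖ ≤ 2 := by
      refine (norm_sub_le _ _).trans ?_
      have := norm_exp_neg_I_mul lam σ
      rw [this, norm_one]
      norm_num
    have h2 := Real.one_le_rpow h (show (0 : ℝ) ≤ 1 / 4 by norm_num)
    linarith

/-- A profile on the half-line with a mild singularity at `0`: it and its first derivative are
integrable, and its second derivative is integrable against `lam ^ (1/4)`. -/
structure MildProfile (m m₁ m₂ : ℝ → ℂ) : Prop where
  hasDerivAt : ∀ lam ∈ Set.Ioi (0 : ℝ), HasDerivAt m (m₁ lam) lam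
  hasDerivAt₁ : ∀ lam ∈ Set.Ioi (0 : ℝ), HasDerivAt m₁ (m₂ lam) lam
  integrableOn : IntegrableOn m (Set.Ioi 0)
  integrableOn₁ : IntegrableOn m₁ (Set.Ioi 0)
  integrableOn₂ : IntegrableOn (fun lam : ℝ => ((lam ^ (1 / 4 : ℝ) : ℝ) : ℂ) * m₂ lam) (Set.Ioi 0)
  tendsto_zero : Tendsto m (𝓝[>] 0) (𝓝 0)
  tendsto_zero₁ : Tendsto (fun lam : ℝ => (lam : ℂ) * m₁ lam) (𝓝[>] 0) (𝓝 0)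
  tendsto_atTop : Tendsto m atTop (𝓝 0)
  tendsto_atTop₁ : Tendsto m₁ atTop (𝓝 0)

variable {m m₁ m₂ : ℝ → ℂ}

theorem integrableOn_mul_exp (hm : IntegrableOn m (Set.Ioi 0)) (σ : ℝ) :
    IntegrableOn (fun lam : ℝ => m lam * Complex.exp (-Complex.I * lam * σ)) (Set.Ioi 0) := by
  refine hm.mul_bdd (c := 1) (Continuous.aestronglyMeasurable (by fun_prop)) ?_
  exact Eventually.of_forall fun lam => (norm_exp_neg_I_mul lam σ).le

theorem norm_halfFourier_le (m : ℝ → ℂ) (σ : ℝ) :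
    ‖halfFourier m σ‖ ≤ ∫ lam in Set.Ioi (0 : ℝ), ‖m lam‖ := by
  refine (norm_integral_le_integral_norm _).trans_eq ?_
  simp_rw [norm_mul, norm_exp_neg_I_mul, mul_one]

/-- The first integration by parts: the profile vanishes at both ends, so there is no boundary term.
-/
theorem MildProfile.mul_halfFourier (h : MildProfile m m₁ m₂) (σ : ℝ) :
    Complex.I * σ * halfFourier m σ = halfFourier m₁ σ := by
  have hz : Tendsto (m * fun lam : ℝ => Complex.exp (-Complex.I * lam * σ)) (𝓝[>] 0) (𝓝 0) := by
    rw [tendsto_zero_iff_norm_tendsto_zero]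
    simpa only [Pi.mul_apply, norm_mul, norm_exp_neg_I_mul, mul_one, norm_zero] using
      h.tendsto_zero.norm
  have hi : Tendsto (m * fun lam : ℝ => Complex.exp (-Complex.I * lam * σ)) atTop (𝓝 0) := by
    rw [tendsto_zero_iff_norm_tendsto_zero]
    simpa only [Pi.mul_apply, norm_mul, norm_exp_neg_I_mul, mul_one, norm_zero] using
      h.tendsto_atTop.norm
  have hp := integral_Ioi_mul_deriv_eq_deriv_mul h.hasDerivAt
    (fun lam _ => hasDerivAt_exp_neg_I_mul σ lam)
    (((integrableOn_mul_exp h.integrableOn σ).const_mul (-(Complex.I * σ))).congr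
      (Eventually.of_forall fun lam => by simp only [Pi.mul_apply]; ring))
    (integrableOn_mul_exp h.integrableOn₁ σ) hz hi
  have e : ∫ lam in Set.Ioi (0 : ℝ), m lam *
      (-(Complex.I * σ) * Complex.exp (-Complex.I * lam * σ)) =
      -(Complex.I * σ) * halfFourier m σ := by
    rw [halfFourier, ← integral_const_mul]
    congr 1
    ext lam
    ring
  rw [e] at hp
  have hp' : -(Complex.I * σ) * halfFourier m σ = 0 - 0 - halfFourier m₁ σ := hp
  linear_combination -hp'

/-- In the second integration by parts m₂ may fail to be integrable at 0. Therefore the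
antiderivative 1 - exp(-iλσ), which vanishes at λ = 0, is used: it tames the boundary term and,
through `norm_one_sub_exp_le_rpow`, supplies the weight λ^{1/4} at the price of |σ|^{1/4}. -/
theorem MildProfile.mul_norm_halfFourier_le (h : MildProfile m m₁ m₂) (σ : ℝ) :
    |σ| * ‖halfFourier m₁ σ‖ ≤ 2 * |σ| ^ (1 / 4 : ℝ) *
      ∫ lam in Set.Ioi (0 : ℝ), ‖((lam ^ (1 / 4 : ℝ) : ℝ) : ℂ) * m₂ lam‖ := by
  set v : ℝ → ℂ := fun lam => 1 - Complex.exp (-Complex.I * lam * σ) with hv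
  have hvd : ∀ lam ∈ Set.Ioi (0 : ℝ),
      HasDerivAt v (Complex.I * σ * Complex.exp (-Complex.I * lam * σ)) lam := by
    intro lam _
    exact ((hasDerivAt_exp_neg_I_mul σ lam).const_sub 1).congr_deriv (by ring)
  have hbound : ∀ lam ∈ Set.Ioi (0 : ℝ), ‖m₂ lam * v lam‖ ≤
      2 * |σ| ^ (1 / 4 : ℝ) * ‖((lam ^ (1 / 4 : ℝ) : ℝ) : ℂ) * m₂ lam‖ := by
    intro lam hlam
    have hl : 0 < lam := hlam
    rw [norm_mul, norm_mul, Complex.norm_real, Real.norm_of_nonneg (by positivity)]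
    calc ‖m₂ lam‖ * ‖v lam‖ ≤ ‖m₂ lam‖ * (2 * (|σ| ^ (1 / 4 : ℝ) * lam ^ (1 / 4 : ℝ))) := by
          gcongr
          exact norm_one_sub_exp_le_rpow σ hl
      _ = _ := by ring
  -- Only the weighted function is assumed integrable; dividing the weight out recovers
  -- measurability of m₂.
  have hmeas : AEStronglyMeasurable m₂ (volume.restrict (Set.Ioi 0)) := by
    have h1 : AEStronglyMeasurable (fun lam : ℝ => ((lam ^ (-(1 / 4) : ℝ) : ℝ) : ℂ) *
        (((lam ^ (1 / 4 : ℝ) : ℝ) : ℂ) * m₂ lam)) (volume.restrict (Set.Ioi 0)) :=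
      (Measurable.aestronglyMeasurable (by fun_prop)).mul h.integrableOn₂.aestronglyMeasurable
    refine h1.congr ((ae_restrict_mem measurableSet_Ioi).mono fun lam hlam => ?_)
    have hl : 0 < lam := hlam
    beta_reduce
    rw [← mul_assoc, ← Complex.ofReal_mul, ← Real.rpow_add hl]
    simp
  have hm2v : IntegrableOn (m₂ * v) (Set.Ioi 0) := by
    refine (h.integrableOn₂.norm.const_mul (2 * |σ| ^ (1 / 4 : ℝ))).mono'
      (hmeas.mul (Continuous.aestronglyMeasurable (by fun_prop))) ?_
    exact (ae_restrict_mem measurableSet_Ioi).mono hbound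
  have hz : Tendsto (m₁ * v) (𝓝[>] 0) (𝓝 0) := by
    refine squeeze_zero_norm' ?_ (by simpa using h.tendsto_zero₁.norm.const_mul |σ|)
    filter_upwards with lam
    rw [Pi.mul_apply, norm_mul]
    calc ‖m₁ lam‖ * ‖v lam‖ ≤ ‖m₁ lam‖ * (|σ| * |lam|) := by
          gcongr
          exact norm_one_sub_exp_le σ lam
      _ = _ := by ring
  have hi : Tendsto (m₁ * v) atTop (𝓝 0) := by
    refine squeeze_zero_norm' ?_ (by simpa using h.tendsto_atTop₁.norm.const_mul 2)
    filter_upwards with lam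
    rw [Pi.mul_apply, norm_mul, mul_comm]
    gcongr
    refine (norm_sub_le _ _).trans ?_
    rw [norm_exp_neg_I_mul lam σ, norm_one]
    norm_num
  have hp := integral_Ioi_mul_deriv_eq_deriv_mul h.hasDerivAt₁ hvd
    (((integrableOn_mul_exp h.integrableOn₁ σ).const_mul (Complex.I * σ)).congr
      (Eventually.of_forall fun lam => by simp only [Pi.mul_apply]; ring))
    hm2v hz hi
  have e : ∫ lam in Set.Ioi (0 : ℝ), m₁ lam *
      (Complex.I * σ * Complex.exp (-Complex.I * lam * σ)) =
      Complex.I * σ * halfFourier m₁ σ := by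
    rw [halfFourier, ← integral_const_mul]
    congr 1
    ext lam
    ring
  rw [e, sub_zero, zero_sub] at hp
  have hn : ‖Complex.I * σ * halfFourier m₁ σ‖ = |σ| * ‖halfFourier m₁ σ‖ := by
    simp
  rw [← hn, hp, norm_neg, ← integral_const_mul]
  refine (norm_integral_le_integral_norm _).trans ?_
  exact setIntegral_mono_on hm2v.norm (h.integrableOn₂.norm.const_mul _) measurableSet_Ioi hbound

/-- Two integrations by parts give |σ|²|m̂(σ)| = O(|σ|^{1/4}), hence the exponent 7/4; small |σ| are
covered by the L¹ bound. The factor 2^{7/4} comes from 1+|σ| ≤ 2 max(1,|σ|). -/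
theorem MildProfile.exists_norm_halfFourier_le (h : MildProfile m m₁ m₂) :
    ∃ C : ℝ, 0 ≤ C ∧ ∀ σ : ℝ, ‖halfFourier m σ‖ ≤ C * (1 + |σ|) ^ (-(7 / 4 : ℝ)) := by
  set A : ℝ := ∫ lam in Set.Ioi (0 : ℝ), ‖m lam‖ with hA
  set B : ℝ := ∫ lam in Set.Ioi (0 : ℝ), ‖((lam ^ (1 / 4 : ℝ) : ℝ) : ℂ) * m₂ lam‖ with hB
  have hA0 : 0 ≤ A := integral_nonneg fun _ => norm_nonneg _
  have hB0 : 0 ≤ B := integral_nonneg fun _ => norm_nonneg _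
  refine ⟨2 ^ (7 / 4 : ℝ) * (A + 2 * B), by positivity, fun σ => ?_⟩
  have hpos : 0 < 1 + |σ| := by positivity
  rw [Real.rpow_neg hpos.le, ← div_eq_mul_inv, le_div_iff₀ (by positivity)]
  have hn := norm_nonneg (halfFourier m σ)
  rcases le_total |σ| 1 with hσ | hσ
  · have h1 : (1 + |σ|) ^ (7 / 4 : ℝ) ≤ 2 ^ (7 / 4 : ℝ) :=
      Real.rpow_le_rpow hpos.le (by linarith) (by norm_num)
    calc ‖halfFourier m σ‖ * (1 + |σ|) ^ (7 / 4 : ℝ) ≤ A * 2 ^ (7 / 4 : ℝ) := by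
          gcongr
          exact norm_halfFourier_le m σ
      _ ≤ 2 ^ (7 / 4 : ℝ) * (A + 2 * B) := by
          rw [mul_comm]
          gcongr
          linarith
  · have hσ0 : 0 < |σ| := by linarith
    have h1 : (1 + |σ|) ^ (7 / 4 : ℝ) ≤ 2 ^ (7 / 4 : ℝ) * |σ| ^ (7 / 4 : ℝ) := by
      rw [← Real.mul_rpow (by norm_num) hσ0.le]
      exact Real.rpow_le_rpow hpos.le (by linarith) (by norm_num)
    have h2 : |σ| * ‖halfFourier m σ‖ = ‖halfFourier m₁ σ‖ := by
      rw [← h.mul_halfFourier σ]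
      simp
    have h3 := h.mul_norm_halfFourier_le σ
    rw [← h2, ← hB] at h3
    have h4 : |σ| * |σ| = |σ| ^ (1 / 4 : ℝ) * |σ| ^ (7 / 4 : ℝ) := by
      rw [← Real.rpow_add hσ0]
      norm_num
      ring
    have h5 : 0 < |σ| ^ (1 / 4 : ℝ) := by positivity
    have h6 : ‖halfFourier m σ‖ * |σ| ^ (7 / 4 : ℝ) ≤ 2 * B := by
      refine le_of_mul_le_mul_left ?_ h5
      calc |σ| ^ (1 / 4 : ℝ) * (‖halfFourier m σ‖ * |σ| ^ (7 / 4 : ℝ))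
          = |σ| * (|σ| * ‖halfFourier m σ‖) := by linear_combination -‖halfFourier m σ‖ * h4
        _ ≤ 2 * |σ| ^ (1 / 4 : ℝ) * B := h3
        _ = _ := by ring
    calc ‖halfFourier m σ‖ * (1 + |σ|) ^ (7 / 4 : ℝ)
        ≤ ‖halfFourier m σ‖ * (2 ^ (7 / 4 : ℝ) * |σ| ^ (7 / 4 : ℝ)) := by gcongr
      _ = 2 ^ (7 / 4 : ℝ) * (‖halfFourier m σ‖ * |σ| ^ (7 / 4 : ℝ)) := by ring
      _ ≤ 2 ^ (7 / 4 : ℝ) * (A + 2 * B) := by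
          gcongr
          linarith

/-! ### The low energy profile -/

/-- The common shape of the low energy profile, its first derivative and its weighted second
derivative: singularities integrable at 0 with continuous coefficients vanishing beyond R. -/
theorem integrableOn_rpow_log_add {f₁ f₂ f₃ : ℝ → ℂ} (h₁ : Continuous f₁) (h₂ : Continuous f₂)
    (h₃ : Continuous f₃) {R : ℝ} (hR : 0 ≤ R) (z₁ : ∀ t, R < t → f₁ t = 0)
    (z₂ : ∀ t, R < t → f₂ t = 0) (z₃ : ∀ t, R < t → f₃ t = 0) :
    IntegrableOn (fun t : ℝ => ((t ^ (-(3 / 4) : ℝ) : ℝ) : ℂ) * f₁ t + (Real.log t : ℂ) * f₂ t +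
      f₃ t) (Set.Ioi 0) := by
  have e1 : IntervalIntegrable (fun t : ℝ => ((t ^ (-(3 / 4) : ℝ) : ℝ) : ℂ)) volume 0 R := by
    have h := intervalIntegral.intervalIntegrable_rpow' (a := 0) (b := R)
      (show (-1 : ℝ) < -(3 / 4) by norm_num)
    exact ⟨h.1.ofReal, h.2.ofReal⟩
  have e2 : IntervalIntegrable (fun t : ℝ => (Real.log t : ℂ)) volume 0 R := by
    have h := intervalIntegral.intervalIntegrable_log' (a := 0) (b := R)
    exact ⟨h.1.ofReal, h.2.ofReal⟩
  have h := ((e1.mul_continuousOn h₁.continuousOn).add (e2.mul_continuousOn h₂.continuousOn)).add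
    (h₃.intervalIntegrable 0 R)
  have h' := (intervalIntegrable_iff_integrableOn_Ioc_of_le hR).1 h
  rw [← Set.Ioc_union_Ioi_eq_Ioi hR]
  refine h'.union ((integrableOn_zero (μ := volume)).congr_fun (fun t ht => ?_) measurableSet_Ioi)
  simp [z₁ t ht, z₂ t ht, z₃ t ht]

/-- The spectral profile `h⁻(lam) lam χ(lam)`. -/
def lowEnergyProfile (a b : ℝ) (z : ℂ) (χ : ℝ → ℝ) (lam : ℝ) : ℂ :=
  hMinus a b z lam * lam * χ lam

/-- Up to smooth factors the profile is λ log λ. Its first derivative is logarithmic, and in the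
second the only non-integrable term is a/λ, which the weight λ^{1/4} makes integrable. -/
theorem exists_mildProfile_lowEnergyProfile (a b : ℝ) (z : ℂ) {R : ℝ} (hR : 0 ≤ R) {χ : ℝ → ℝ}
    (hχ : ContDiff ℝ ∞ χ) (hχ_zero : ∀ lam : ℝ, R < lam → χ lam = 0) :
    ∃ m₁ m₂ : ℝ → ℂ, MildProfile (lowEnergyProfile a b z χ) m₁ m₂ := by
  set c : ℂ := z + b with hc
  set A : ℂ := (a : ℂ) with hA
  have hd0 : Differentiable ℝ χ := hχ.differentiable (by simp)
  have hχ1 : ContDiff ℝ ∞ (deriv χ) := by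
    have := (contDiff_infty_iff_deriv (𝕜 := ℝ) (f := χ)).1 hχ
    exact this.2
  have hd1 : Differentiable ℝ (deriv χ) := hχ1.differentiable (by simp)
  have hχ2 : ContDiff ℝ ∞ (deriv (deriv χ)) := by
    have := (contDiff_infty_iff_deriv (𝕜 := ℝ) (f := deriv χ)).1 hχ1
    exact this.2
  have k0 : Continuous χ := hd0.continuous
  have k1 : Continuous (deriv χ) := hd1.continuous
  have k2 : Continuous (deriv (deriv χ)) := hχ2.continuous
  have zero_deriv : ∀ f : ℝ → ℝ, (∀ t, R < t → f t = 0) → ∀ t, R < t → deriv f t = 0 := by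
    intro f hf t ht
    have : f =ᶠ[𝓝 t] fun _ => 0 := by
      filter_upwards [Ioi_mem_nhds ht] with u hu using hf u hu
    rw [this.deriv_eq]
    simp
  have z1 := zero_deriv χ hχ_zero
  have z2 := zero_deriv _ z1
  set m₁ : ℝ → ℂ := fun t => (A * Real.log t + c + A) * χ t + (A * Real.log t + c) * t * deriv χ t
    with hm₁
  set m₂ : ℝ → ℂ := fun t => A * (t : ℂ)⁻¹ * χ t + 2 * (A * Real.log t + c + A) * deriv χ t +
    (A * Real.log t + c) * t * deriv (deriv χ) t with hm₂
  have hm : ∀ t, lowEnergyProfile a b z χ t = (A * Real.log t + c) * t * χ t := by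
    intro t
    rw [lowEnergyProfile, hMinus, hc]
    ring
  have hlog : ∀ t ∈ Set.Ioi (0 : ℝ), HasDerivAt (fun t : ℝ => A * Real.log t + c)
      (A * (t : ℂ)⁻¹) t := by
    intro t ht
    have := (((Real.hasDerivAt_log (ne_of_gt ht)).ofReal_comp).const_mul A).add_const c
    simpa using this
  have hid : ∀ t : ℝ, HasDerivAt (fun t : ℝ => (t : ℂ)) 1 t := fun t => (hasDerivAt_id t).ofReal_comp
  have hne : ∀ t ∈ Set.Ioi (0 : ℝ), (t : ℂ) ≠ 0 := fun t ht => by exact_mod_cast (ne_of_gt ht)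
  have htlog : Continuous fun t : ℝ => ((t * Real.log t : ℝ) : ℂ) :=
    Complex.continuous_ofReal.comp Real.continuous_mul_log
  refine ⟨m₁, m₂, ?_, ?_, ?_, ?_, ?_, ?_, ?_, ?_, ?_⟩
  · intro t ht
    rw [show lowEnergyProfile a b z χ = fun t : ℝ => (A * Real.log t + c) * t * χ t from funext hm]
    refine (((hlog t ht).mul (hid t)).mul (hd0 t).hasDerivAt.ofReal_comp).congr_deriv ?_
    have := hne t ht
    simp only [hm₁, Pi.mul_apply]
    field_simp
    ring
  · intro t ht
    refine ((((hlog t ht).add_const A).mul (hd0 t).hasDerivAt.ofReal_comp).add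
      (((hlog t ht).mul (hid t)).mul (hd1 t).hasDerivAt.ofReal_comp)).congr_deriv ?_
    have := hne t ht
    simp only [hm₂, Pi.mul_apply]
    field_simp
    ring
  · refine (integrableOn_rpow_log_add (f₁ := fun _ => 0) (f₂ := fun t => A * t * χ t)
      (f₃ := fun t => c * t * χ t) (R := R) (by fun_prop) (by fun_prop) (by fun_prop) hR
      (fun _ _ => rfl) (fun t ht => by simp [hχ_zero t ht]) (fun t ht => by simp [hχ_zero t ht])).congr_fun
      (fun t _ => ?_) measurableSet_Ioi
    simp only [hm]
    ring
  · refine (integrableOn_rpow_log_add (f₁ := fun _ => 0)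
      (f₂ := fun t => A * χ t + A * t * deriv χ t)
      (f₃ := fun t => (c + A) * χ t + c * t * deriv χ t) (R := R) (by fun_prop) (by fun_prop)
      (by fun_prop) hR (fun _ _ => rfl) (fun t ht => by simp [hχ_zero t ht, z1 t ht])
      (fun t ht => by simp [hχ_zero t ht, z1 t ht])).congr_fun (fun t _ => ?_)
      measurableSet_Ioi
    simp only [hm₁]
    ring
  · have kr : Continuous fun t : ℝ => ((t ^ (1 / 4 : ℝ) : ℝ) : ℂ) :=
      Complex.continuous_ofReal.comp (Real.continuous_rpow_const (by norm_num))
    refine (integrableOn_rpow_log_add (f₁ := fun t => A * χ t)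
      (f₂ := fun t => ((t ^ (1 / 4 : ℝ) : ℝ) : ℂ) *
        (2 * A * deriv χ t + A * t * deriv (deriv χ) t))
      (f₃ := fun t => ((t ^ (1 / 4 : ℝ) : ℝ) : ℂ) *
        (2 * (c + A) * deriv χ t + c * t * deriv (deriv χ) t)) (R := R) (by fun_prop) (by fun_prop)
      (by fun_prop) hR (fun t ht => by simp [hχ_zero t ht])
      (fun t ht => by simp [z1 t ht, z2 t ht]) (fun t ht => by simp [z1 t ht, z2 t ht])).congr_fun
      (fun t ht => ?_) measurableSet_Ioi
    have ht0 : (0 : ℝ) < t := ht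
    -- The weighted a/t term is the only one that needs the slot `f₁` with its power -3/4.
    have e : ((t ^ (-(3 / 4) : ℝ) : ℝ) : ℂ) = ((t ^ (1 / 4 : ℝ) : ℝ) : ℂ) * (t : ℂ)⁻¹ := by
      rw [← Complex.ofReal_inv, ← Complex.ofReal_mul, ← Real.rpow_neg_one, ← Real.rpow_add ht0]
      norm_num
    simp only [hm₂, e]
    ring
  · have h : Continuous fun t : ℝ => A * ((t * Real.log t : ℝ) : ℂ) * χ t + c * t * χ t := by
      fun_prop
    have h0 := h.tendsto 0
    simp only [Complex.ofReal_zero, zero_mul, mul_zero, add_zero] at h0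
    refine (h0.mono_left nhdsWithin_le_nhds).congr fun t => ?_
    rw [hm]
    push_cast
    ring
  · have h : Continuous fun t : ℝ => ((t * Real.log t : ℝ) : ℂ) * (A * χ t + A * t * deriv χ t) +
        t * ((c + A) * χ t + c * t * deriv χ t) := by fun_prop
    have h0 := h.tendsto 0
    simp only [Complex.ofReal_zero, zero_mul, add_zero] at h0
    refine (h0.mono_left nhdsWithin_le_nhds).congr fun t => ?_
    simp only [hm₁]
    push_cast
    ring
  · refine tendsto_const_nhds.congr' ?_
    filter_upwards [eventually_gt_atTop R] with t ht
    simp [hm, hχ_zero t ht]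
  · refine tendsto_const_nhds.congr' ?_
    filter_upwards [eventually_gt_atTop R] with t ht
    simp [hm₁, hχ_zero t ht, z1 t ht]

/-! ### Schur's test on all `L^p` spaces -/

section Schur

variable {X : Type*} [MeasurableSpace X] {μ : Measure X}

/-- Hölder for the measure k dμ, from the factorisation kf = (k f^q)^{1/q} · k^{1-1/q}; this form
includes q = 1. -/
theorem rpow_lintegral_mul_le {k f : X → ℝ≥0∞} (hk : Measurable k) (hf : Measurable f) {q : ℝ}
    (hq : 1 ≤ q) :
    (∫⁻ x, k x * f x ∂μ) ^ q ≤ (∫⁻ x, k x ∂μ) ^ (q - 1) * ∫⁻ x, k x * f x ^ q ∂μ := by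
  have hq0 : 0 < q := by linarith
  have h := ENNReal.lintegral_mul_norm_pow_le (μ := μ) (f := fun x => k x * f x ^ q) (g := k)
    (p := q⁻¹) (q := 1 - q⁻¹) (by fun_prop) hk.aemeasurable (by positivity)
    (sub_nonneg.2 (inv_le_one_of_one_le₀ hq)) (by ring)
  have e : ∀ x, (k x * f x ^ q) ^ q⁻¹ * k x ^ (1 - q⁻¹) = k x * f x := by
    intro x
    rw [ENNReal.mul_rpow_of_nonneg _ _ (by positivity), ← ENNReal.rpow_mul,
      mul_inv_cancel₀ hq0.ne', ENNReal.rpow_one, mul_right_comm,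
      ← ENNReal.rpow_add_of_nonneg _ _ (by positivity) (sub_nonneg.2 (inv_le_one_of_one_le₀ hq))]
    simp
  simp_rw [e] at h
  calc (∫⁻ x, k x * f x ∂μ) ^ q
      ≤ ((∫⁻ x, k x * f x ^ q ∂μ) ^ q⁻¹ * (∫⁻ x, k x ∂μ) ^ (1 - q⁻¹)) ^ q := by gcongr
    _ = _ := by
        rw [ENNReal.mul_rpow_of_nonneg _ _ hq0.le, ← ENNReal.rpow_mul, ← ENNReal.rpow_mul,
          inv_mul_cancel₀ hq0.ne', ENNReal.rpow_one, sub_mul, one_mul, inv_mul_cancel₀ hq0.ne',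
          mul_comm]

/-- An integral kernel which is integrable in each variable, uniformly in the other one. -/
structure SchurKernel (μ : Measure X) (K : X → X → ℂ) (C : ℝ≥0∞) : Prop where
  stronglyMeasurable : StronglyMeasurable fun q : X × X => K q.1 q.2
  ne_top : C ≠ ⊤
  lintegral_right_le : ∀ x, ∫⁻ y, ‖K x y‖ₑ ∂μ ≤ C
  lintegral_left_le : ∀ y, ∫⁻ x, ‖K x y‖ₑ ∂μ ≤ C

variable {K : X → X → ℂ} {C : ℝ≥0∞}

theorem SchurKernel.measurable_enorm (hK : SchurKernel μ K C) :
    Measurable fun q : X × X => ‖K q.1 q.2‖ₑ :=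
  hK.stronglyMeasurable.enorm

theorem SchurKernel.measurable_enorm_right (hK : SchurKernel μ K C) (x : X) :
    Measurable fun y => ‖K x y‖ₑ :=
  hK.measurable_enorm.comp (measurable_prodMk_left (x := x))

theorem SchurKernel.measurable_enorm_left (hK : SchurKernel μ K C) (y : X) :
    Measurable fun x => ‖K x y‖ₑ :=
  hK.measurable_enorm.comp (measurable_prodMk_right (y := y))

/-- Hölder spends the power q - 1 of the constant on the integral over y; after Tonelli the integral
over x contributes the remaining one. -/
theorem SchurKernel.lintegral_rpow_le [SFinite μ] (hK : SchurKernel μ K C) {u : X → ℂ}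
    (hu : StronglyMeasurable u) {q : ℝ} (hq : 1 ≤ q) :
    ∫⁻ x, (∫⁻ y, ‖K x y‖ₑ * ‖u y‖ₑ ∂μ) ^ q ∂μ ≤ C ^ q * ∫⁻ y, ‖u y‖ₑ ^ q ∂μ := by
  have hKm := hK.measurable_enorm
  have hum := hu.enorm
  have hm : Measurable fun p : X × X => ‖K p.1 p.2‖ₑ * ‖u p.2‖ₑ ^ q := by fun_prop
  calc ∫⁻ x, (∫⁻ y, ‖K x y‖ₑ * ‖u y‖ₑ ∂μ) ^ q ∂μ
      ≤ ∫⁻ x, C ^ (q - 1) * ∫⁻ y, ‖K x y‖ₑ * ‖u y‖ₑ ^ q ∂μ ∂μ := by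
        refine lintegral_mono fun x => ?_
        refine (rpow_lintegral_mul_le (hK.measurable_enorm_right x) hum hq).trans ?_
        gcongr
        exact hK.lintegral_right_le x
    _ = C ^ (q - 1) * ∫⁻ y, ∫⁻ x, ‖K x y‖ₑ * ‖u y‖ₑ ^ q ∂μ ∂μ := by
        rw [lintegral_const_mul _ hm.lintegral_prod_right', lintegral_lintegral_swap hm.aemeasurable]
    _ ≤ C ^ (q - 1) * ∫⁻ y, C * ‖u y‖ₑ ^ q ∂μ := by
        gcongr with y
        rw [lintegral_mul_const _ (hK.measurable_enorm_left y)]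
        gcongr
        exact hK.lintegral_left_le y
    _ = _ := by
        rw [lintegral_const_mul _ (by fun_prop), ← mul_assoc]
        congr 1
        nth_rewrite 2 [← ENNReal.rpow_one C]
        rw [← ENNReal.rpow_add_of_nonneg _ _ (by linarith) zero_le_one]
        simp

theorem SchurKernel.lintegral_le_essSup (hK : SchurKernel μ K C) (u : X → ℂ) (x : X) :
    ∫⁻ y, ‖K x y‖ₑ * ‖u y‖ₑ ∂μ ≤ C * eLpNormEssSup u μ := by
  calc ∫⁻ y, ‖K x y‖ₑ * ‖u y‖ₑ ∂μ ≤ ∫⁻ y, ‖K x y‖ₑ * eLpNormEssSup u μ ∂μ := by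
        refine lintegral_mono_ae ?_
        filter_upwards [ae_le_eLpNormEssSup (f := u) (μ := μ)] with y hy
        gcongr
    _ = (∫⁻ y, ‖K x y‖ₑ ∂μ) * eLpNormEssSup u μ :=
        lintegral_mul_const _ (hK.measurable_enorm_right x)
    _ ≤ _ := by
        gcongr
        exact hK.lintegral_right_le x

/-- A finite L^p bound for the positive operator forces finiteness almost everywhere, which gives
the kernel integral a pointwise meaning on all of L^p. -/
theorem SchurKernel.ae_lintegral_lt_top [SFinite μ] (hK : SchurKernel μ K C) {p : ℝ≥0∞}
    (hp : 1 ≤ p) {u : X → ℂ} (hum : StronglyMeasurable u) (hu : MemLp u p μ) :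
    ∀ᵐ x ∂μ, ∫⁻ y, ‖K x y‖ₑ * ‖u y‖ₑ ∂μ < ⊤ := by
  have hKm := hK.measurable_enorm
  have hue := hum.enorm
  have hm : Measurable fun p : X × X => ‖K p.1 p.2‖ₑ * ‖u p.2‖ₑ := by fun_prop
  rcases eq_or_ne p ⊤ with rfl | hpt
  · refine Eventually.of_forall fun x => (hK.lintegral_le_essSup u x).trans_lt ?_
    have := hu.2
    rw [eLpNorm_exponent_top] at this
    exact ENNReal.mul_lt_top hK.ne_top.lt_top this
  · have hq : 1 ≤ p.toReal := by
      have := ENNReal.toReal_mono hpt hp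
      simpa using this
    have h := hK.lintegral_rpow_le hum hq
    have hfin : ∫⁻ y, ‖u y‖ₑ ^ p.toReal ∂μ < ⊤ :=
      lintegral_rpow_enorm_lt_top_of_eLpNorm_lt_top (zero_lt_one.trans_le hp).ne' hpt hu.2
    have h2 := ae_lt_top (hm.lintegral_prod_right'.pow_const p.toReal)
      (h.trans_lt (ENNReal.mul_lt_top
        (ENNReal.rpow_lt_top_of_nonneg (by linarith) hK.ne_top) hfin)).ne
    filter_upwards [h2] with x hx
    exact (ENNReal.rpow_lt_top_iff_of_pos (by linarith)).1 hx

theorem SchurKernel.ae_integrable [SFinite μ] (hK : SchurKernel μ K C) {p : ℝ≥0∞}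
    (hp : 1 ≤ p) {u : X → ℂ} (hum : StronglyMeasurable u) (hu : MemLp u p μ) :
    ∀ᵐ x ∂μ, Integrable (fun y => K x y * u y) μ := by
  filter_upwards [hK.ae_lintegral_lt_top hp hum hu] with x hx
  refine ⟨((hK.stronglyMeasurable.comp_measurable (measurable_prodMk_left (x := x))).mul
    hum).aestronglyMeasurable, ?_⟩
  simpa only [HasFiniteIntegral, enorm_mul] using hx

theorem SchurKernel.stronglyMeasurable_integral [SFinite μ] (hK : SchurKernel μ K C) {u : X → ℂ}
    (hum : StronglyMeasurable u) : StronglyMeasurable fun x => ∫ y, K x y * u y ∂μ :=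
  StronglyMeasurable.integral_prod_right' (f := fun q : X × X => K q.1 q.2 * u q.2)
    (hK.stronglyMeasurable.mul (hum.comp_measurable measurable_snd))

theorem SchurKernel.eLpNorm_integral_le [SFinite μ] (hK : SchurKernel μ K C) {p : ℝ≥0∞}
    (hp : 1 ≤ p) {u : X → ℂ} (hum : StronglyMeasurable u) :
    eLpNorm (fun x => ∫ y, K x y * u y ∂μ) p μ ≤ C * eLpNorm u p μ := by
  have hpt : ∀ x, ‖∫ y, K x y * u y ∂μ‖ₑ ≤ ∫⁻ y, ‖K x y‖ₑ * ‖u y‖ₑ ∂μ := fun x => by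
    refine (enorm_integral_le_lintegral_enorm _).trans_eq ?_
    simp_rw [enorm_mul]
  rcases eq_or_ne p ⊤ with rfl | hptop
  · rw [eLpNorm_exponent_top, eLpNorm_exponent_top]
    refine essSup_le_of_ae_le _ (Eventually.of_forall fun x => ?_)
    exact (hpt x).trans (hK.lintegral_le_essSup u x)
  · have hp0 : p ≠ 0 := (zero_lt_one.trans_le hp).ne'
    have hq : 1 ≤ p.toReal := by
      have := ENNReal.toReal_mono hptop hp
      simpa using this
    have hq0 : 0 < p.toReal := by linarith
    rw [eLpNorm_eq_lintegral_rpow_enorm_toReal hp0 hptop,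
      eLpNorm_eq_lintegral_rpow_enorm_toReal hp0 hptop]
    calc (∫⁻ x, ‖∫ y, K x y * u y ∂μ‖ₑ ^ p.toReal ∂μ) ^ (1 / p.toReal)
        ≤ (C ^ p.toReal * ∫⁻ y, ‖u y‖ₑ ^ p.toReal ∂μ) ^ (1 / p.toReal) := by
          gcongr
          refine le_trans ?_ (hK.lintegral_rpow_le hum hq)
          gcongr with x
          exact hpt x
      _ = _ := by
          rw [ENNReal.mul_rpow_of_nonneg _ _ (by positivity), ← ENNReal.rpow_mul,
            mul_one_div_cancel hq0.ne', ENNReal.rpow_one]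

theorem SchurKernel.memLp_integral [SFinite μ] (hK : SchurKernel μ K C) {p : ℝ≥0∞}
    [Fact (1 ≤ p)] (u : Lp ℂ p μ) : MemLp (fun x => ∫ y, K x y * u y ∂μ) p μ :=
  ⟨(hK.stronglyMeasurable_integral (Lp.stronglyMeasurable u)).aestronglyMeasurable,
    (hK.eLpNorm_integral_le Fact.out (Lp.stronglyMeasurable u)).trans_lt
      (ENNReal.mul_lt_top hK.ne_top.lt_top (Lp.eLpNorm_lt_top u))⟩

/-- Schur's test: the integral operator is bounded on `L^p` for every `1 ≤ p ≤ ∞`. -/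
theorem SchurKernel.exists_continuousLinearMap [SFinite μ] (hK : SchurKernel μ K C) (p : ℝ≥0∞)
    [Fact (1 ≤ p)] :
    ∃ B : Lp ℂ p μ →L[ℂ] Lp ℂ p μ, ∀ u : Lp ℂ p μ, ∀ᵐ x ∂μ, B u x = ∫ y, K x y * u y ∂μ := by
  -- Additivity of the Bochner integral requires both integrands to be integrable at the given x.
  have hint : ∀ u : Lp ℂ p μ, ∀ᵐ x ∂μ, Integrable (fun y => K x y * u y) μ := fun u =>
    hK.ae_integrable Fact.out (Lp.stronglyMeasurable u) (Lp.memLp u)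
  let B₀ : Lp ℂ p μ →ₗ[ℂ] Lp ℂ p μ :=
    { toFun := fun u => (hK.memLp_integral u).toLp _
      map_add' := fun u w => by
        apply Lp.ext
        filter_upwards [(hK.memLp_integral (u + w)).coeFn_toLp, (hK.memLp_integral u).coeFn_toLp,
          (hK.memLp_integral w).coeFn_toLp, hint u, hint w, Lp.coeFn_add
            ((hK.memLp_integral u).toLp _) ((hK.memLp_integral w).toLp _)] with x h1 h2 h3 h4 h5 h6
        rw [h1, h6, Pi.add_apply, h2, h3, ← integral_add h4 h5]
        refine integral_congr_ae ?_
        filter_upwards [Lp.coeFn_add u w] with y hy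
        rw [hy, Pi.add_apply, mul_add]
      map_smul' := fun c u => by
        apply Lp.ext
        filter_upwards [(hK.memLp_integral (c • u)).coeFn_toLp, (hK.memLp_integral u).coeFn_toLp,
          Lp.coeFn_smul c ((hK.memLp_integral u).toLp _)] with x h1 h2 h3
        rw [h1, RingHom.id_apply, h3, Pi.smul_apply, h2, smul_eq_mul, ← integral_const_mul]
        refine integral_congr_ae ?_
        filter_upwards [Lp.coeFn_smul c u] with y hy
        rw [hy, Pi.smul_apply, smul_eq_mul]
        ring }
  refine ⟨B₀.mkContinuous C.toReal fun u => ?_, fun u => (hK.memLp_integral u).coeFn_toLp⟩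
  change ‖(hK.memLp_integral u).toLp _‖ ≤ _
  rw [Lp.norm_toLp, Lp.norm_def, ← ENNReal.toReal_mul]
  exact ENNReal.toReal_mono (ENNReal.mul_ne_top hK.ne_top (Lp.eLpNorm_ne_top u))
    (hK.eLpNorm_integral_le Fact.out (Lp.stronglyMeasurable u))

end Schur

/-! ### Superpositions of products of one-sided Fourier transforms -/

/-- The two phases merge into exp(-iλ(s+εt)), and Fubini lets the λ-integral be done first,
producing m̂(s+εt). Below, ε = 1 and ε = -1 treat the two halves of the resolvent jump. -/
theorem enorm_integral_mul_halfFourier_le {m f g : ℝ → ℂ} (hm : IntegrableOn m (Set.Ioi 0))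
    (hf : IntegrableOn f (Set.Ioi 0)) (hg : IntegrableOn g (Set.Ioi 0)) (ε : ℝ) :
    ‖∫ lam in Set.Ioi (0 : ℝ), m lam * ((∫ s in Set.Ioi (0 : ℝ),
        Complex.exp (-Complex.I * lam * s) * f s) *
          ∫ t in Set.Ioi (0 : ℝ), Complex.exp (-Complex.I * lam * (ε * t : ℝ)) * g t)‖ₑ ≤
      ∫⁻ q : ℝ × ℝ, ‖f q.1‖ₑ * ‖g q.2‖ₑ * ‖halfFourier m (q.1 + ε * q.2)‖ₑ
        ∂((volume.restrict (Set.Ioi 0)).prod (volume.restrict (Set.Ioi 0))) := by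
  set ν : Measure ℝ := volume.restrict (Set.Ioi 0) with hν
  have hfg : Integrable (fun q : ℝ × ℝ => f q.1 * g q.2) (ν.prod ν) := Integrable.mul_prod hf hg
  have hmfg : Integrable (fun Q : ℝ × (ℝ × ℝ) => m Q.1 * (f Q.2.1 * g Q.2.2)) (ν.prod (ν.prod ν)) :=
    Integrable.mul_prod hm hfg
  have hphase : ∀ (lam : ℝ) (q : ℝ × ℝ),
      (Complex.exp (-Complex.I * lam * q.1) * f q.1) *
        (Complex.exp (-Complex.I * lam * (ε * q.2 : ℝ)) * g q.2) =
      f q.1 * g q.2 * Complex.exp (-Complex.I * lam * (q.1 + ε * q.2 : ℝ)) := by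
    intro lam q
    rw [show -Complex.I * lam * (q.1 + ε * q.2 : ℝ) =
      -Complex.I * lam * q.1 + -Complex.I * lam * (ε * q.2 : ℝ) by push_cast; ring, Complex.exp_add]
    ring
  have hI : Integrable (fun Q : ℝ × (ℝ × ℝ) => m Q.1 * (f Q.2.1 * g Q.2.2 *
      Complex.exp (-Complex.I * Q.1 * (Q.2.1 + ε * Q.2.2 : ℝ)))) (ν.prod (ν.prod ν)) := by
    have h : Integrable (fun Q : ℝ × (ℝ × ℝ) => m Q.1 * (f Q.2.1 * g Q.2.2) *
        Complex.exp (-Complex.I * Q.1 * (Q.2.1 + ε * Q.2.2 : ℝ))) (ν.prod (ν.prod ν)) :=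
      hmfg.mul_bdd (c := 1) (Continuous.aestronglyMeasurable (by fun_prop))
      (Eventually.of_forall fun Q => (norm_exp_neg_I_mul _ _).le)
    refine h.congr (Eventually.of_forall fun Q => ?_)
    simp only
    ring
  have e : ∫ lam in Set.Ioi (0 : ℝ), m lam * ((∫ s in Set.Ioi (0 : ℝ),
        Complex.exp (-Complex.I * lam * s) * f s) *
          ∫ t in Set.Ioi (0 : ℝ), Complex.exp (-Complex.I * lam * (ε * t : ℝ)) * g t) =
      ∫ q, f q.1 * g q.2 * halfFourier m (q.1 + ε * q.2) ∂(ν.prod ν) := by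
    calc _ = ∫ lam, ∫ q, m lam * (f q.1 * g q.2 *
          Complex.exp (-Complex.I * lam * (q.1 + ε * q.2 : ℝ))) ∂(ν.prod ν) ∂ν := by
          refine integral_congr_ae (Eventually.of_forall fun lam => ?_)
          simp only
          rw [← integral_prod_mul, integral_const_mul]
          simp_rw [hphase]
          rfl
      _ = ∫ q, ∫ lam, m lam * (f q.1 * g q.2 *
          Complex.exp (-Complex.I * lam * (q.1 + ε * q.2 : ℝ))) ∂ν ∂(ν.prod ν) :=
          integral_integral_swap hI
      _ = _ := by
          refine integral_congr_ae (Eventually.of_forall fun q => ?_)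
          simp only
          rw [halfFourier, ← integral_const_mul]
          refine integral_congr_ae (Eventually.of_forall fun lam => ?_)
          simp only
          ring
  rw [e]
  refine (enorm_integral_le_lintegral_enorm _).trans_eq ?_
  simp_rw [enorm_mul]

/-! ### The majorant of the kernel -/

/-- The interaction of two wave majorants through an even weight. -/
def pairMajorant (ψ : Plane → ℂ) (M : ℝ → ℝ≥0∞) (x y : Plane) : ℝ≥0∞ :=
  ∫⁻ s in Set.Ioi (0 : ℝ), ∫⁻ t in Set.Ioi (0 : ℝ),
    waveMajorant ψ x s * waveMajorant ψ y t * (M |s + t| + M |s - t|)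

variable {ψ : Plane → ℂ} {M : ℝ → ℝ≥0∞}

/-- The weight is even in s - t and symmetric in s + t. Because of this, one marginal bound serves
both halves of Schur's test. -/
theorem NeutralDensity.pairMajorant_comm (hψ : NeutralDensity ψ) (hM : Measurable M)
    (x y : Plane) : pairMajorant ψ M x y = pairMajorant ψ M y x := by
  have hx : Measurable (waveMajorant ψ x) :=
    hψ.measurable_waveMajorant (measurable_const (a := x)) measurable_id
  have hy : Measurable (waveMajorant ψ y) :=
    hψ.measurable_waveMajorant (measurable_const (a := y)) measurable_id
  rw [pairMajorant, lintegral_lintegral_swap (Measurable.aemeasurable (by fun_prop)), pairMajorant]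
  refine lintegral_congr fun s => lintegral_congr fun t => ?_
  rw [mul_comm (waveMajorant ψ x t), add_comm t s, abs_sub_comm t s]

/-- With τ = s ± t one has t ≤ |τ| + s, so √t ≤ √|τ| + √s; each sign is then a translated or
reflected integral over τ, which explains the factor 2. -/
theorem lintegral_weight_mul_sqrt_le (hM : Measurable M) {s : ℝ} (hs : 0 < s) :
    ∫⁻ t in Set.Ioi (0 : ℝ), (M |s + t| + M |s - t|) * ENNReal.ofReal (Real.sqrt t) ≤
      2 * ((∫⁻ t, M |t| * ENNReal.ofReal (Real.sqrt |t|)) +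
        (∫⁻ t, M |t|) * ENNReal.ofReal (Real.sqrt s)) := by
  set J : ℝ → ℝ≥0∞ := fun τ => M |τ| * ENNReal.ofReal (Real.sqrt |τ|) +
    M |τ| * ENNReal.ofReal (Real.sqrt s) with hJ
  have hJm : Measurable J := by fun_prop
  have hle : ∀ t ∈ Set.Ioi (0 : ℝ), ∀ τ : ℝ, t ≤ |τ| + s →
      M |τ| * ENNReal.ofReal (Real.sqrt t) ≤ J τ := by
    intro t _ τ h
    rw [hJ]
    simp only
    rw [← mul_add, ← ENNReal.ofReal_add (Real.sqrt_nonneg _) (Real.sqrt_nonneg _)]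
    gcongr
    refine (Real.sqrt_le_sqrt h).trans ?_
    rw [Real.sqrt_le_iff]
    refine ⟨by positivity, ?_⟩
    have e1 := Real.sq_sqrt (abs_nonneg τ)
    have e2 := Real.sq_sqrt hs.le
    nlinarith [mul_nonneg (Real.sqrt_nonneg |τ|) (Real.sqrt_nonneg s)]
  calc ∫⁻ t in Set.Ioi (0 : ℝ), (M |s + t| + M |s - t|) * ENNReal.ofReal (Real.sqrt t)
      ≤ ∫⁻ t in Set.Ioi (0 : ℝ), (J (s + t) + J (s - t)) := by
        refine setLIntegral_mono' measurableSet_Ioi fun t ht => ?_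
        have ht0 : (0 : ℝ) < t := ht
        rw [add_mul]
        refine add_le_add (hle t ht (s + t) ?_) (hle t ht (s - t) ?_)
        · rw [abs_of_pos (by linarith)]
          linarith
        · have := neg_le_abs (s - t)
          linarith
    _ ≤ ∫⁻ t, (J (s + t) + J (s - t)) := setLIntegral_le_lintegral _ _
    _ = 2 * ∫⁻ t, J t := by
        rw [lintegral_add_left (by fun_prop), lintegral_add_left_eq_self J s,
          lintegral_sub_left_eq_self J s, two_mul]
    _ = _ := by
        rw [hJ, lintegral_add_left (by fun_prop), lintegral_mul_const _ (by fun_prop)]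

/-- The y-integral comes first and yields √t; the t-integral against the weight then yields I₁ +
I₀√s. What remains are the zeroth and the √s moment in time of the majorant at x, both uniformly
bounded. -/
theorem NeutralDensity.exists_lintegral_pairMajorant_le (hψ : NeutralDensity ψ) (hM : Measurable M)
    (hM0 : ∫⁻ t, M |t| ≠ ⊤) (hM1 : ∫⁻ t, M |t| * ENNReal.ofReal (Real.sqrt |t|) ≠ ⊤) :
    ∃ C : ℝ≥0∞, C ≠ ⊤ ∧ ∀ x, ∫⁻ y, pairMajorant ψ M x y ≤ C := by
  obtain ⟨N₁, hN₁, h1⟩ := hψ.exists_lintegral_waveMajorant_le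
  obtain ⟨N₂, hN₂, h2⟩ := hψ.exists_lintegral_sqrt_mul_waveMajorant_le
  obtain ⟨N₃, hN₃, h3⟩ := hψ.exists_lintegral_waveMajorant_space_le
  set I₀ := ∫⁻ t, M |t| with hI₀
  set I₁ := ∫⁻ t, M |t| * ENNReal.ofReal (Real.sqrt |t|) with hI₁
  refine ⟨N₃ * 2 * (I₁ * N₁ + I₀ * N₂), ?_, fun x => ?_⟩
  · exact ENNReal.mul_ne_top (ENNReal.mul_ne_top hN₃ (by norm_num)) (ENNReal.add_ne_top.2
      ⟨ENNReal.mul_ne_top hM1 hN₁, ENNReal.mul_ne_top hM0 hN₂⟩)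
  have hx : Measurable (waveMajorant ψ x) :=
    hψ.measurable_waveMajorant (measurable_const (a := x)) measurable_id
  have hcomp : Measurable fun q : (Plane × ℝ) × ℝ => waveMajorant ψ q.1.1 q.2 :=
    hψ.measurable_waveMajorant (by fun_prop) (by fun_prop)
  have hcomp' : ∀ s : ℝ, Measurable fun q : Plane × ℝ =>
      waveMajorant ψ x s * waveMajorant ψ q.1 q.2 * (M |s + q.2| + M |s - q.2|) := fun s =>
    Measurable.mul (Measurable.mul measurable_const
      (hψ.measurable_waveMajorant measurable_fst measurable_snd)) (by fun_prop)
  have hF : Measurable fun q : (Plane × ℝ) × ℝ =>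
      waveMajorant ψ x q.1.2 * waveMajorant ψ q.1.1 q.2 * (M |q.1.2 + q.2| + M |q.1.2 - q.2|) :=
    Measurable.mul (Measurable.mul (by fun_prop) hcomp) (by fun_prop)
  calc ∫⁻ y, pairMajorant ψ M x y
      = ∫⁻ s in Set.Ioi (0 : ℝ), ∫⁻ y, ∫⁻ t in Set.Ioi (0 : ℝ),
          waveMajorant ψ x s * waveMajorant ψ y t * (M |s + t| + M |s - t|) :=
        lintegral_lintegral_swap (Measurable.lintegral_prod_right' hF).aemeasurable
    _ ≤ ∫⁻ s in Set.Ioi (0 : ℝ), waveMajorant ψ x s * (N₃ * (2 * (I₁ +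
          I₀ * ENNReal.ofReal (Real.sqrt s)))) := by
        refine setLIntegral_mono' measurableSet_Ioi fun s hs => ?_
        rw [lintegral_lintegral_swap (hcomp' s).aemeasurable]
        calc ∫⁻ t in Set.Ioi (0 : ℝ), ∫⁻ y,
              waveMajorant ψ x s * waveMajorant ψ y t * (M |s + t| + M |s - t|)
            ≤ ∫⁻ t in Set.Ioi (0 : ℝ), waveMajorant ψ x s * (N₃ *
                ((M |s + t| + M |s - t|) * ENNReal.ofReal (Real.sqrt t))) := by
              refine setLIntegral_mono' measurableSet_Ioi fun t ht => ?_
              have hy : Measurable fun y => waveMajorant ψ y t :=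
                hψ.measurable_waveMajorant measurable_id measurable_const
              rw [lintegral_mul_const _ (by fun_prop), lintegral_const_mul _ hy]
              calc waveMajorant ψ x s * (∫⁻ y, waveMajorant ψ y t) * (M |s + t| + M |s - t|)
                  ≤ waveMajorant ψ x s * (N₃ * ENNReal.ofReal (Real.sqrt t)) *
                      (M |s + t| + M |s - t|) := by
                    gcongr
                    exact h3 t ht
                _ = _ := by ring
          _ = waveMajorant ψ x s * (N₃ * ∫⁻ t in Set.Ioi (0 : ℝ),
                (M |s + t| + M |s - t|) * ENNReal.ofReal (Real.sqrt t)) := by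
              rw [lintegral_const_mul _ (by fun_prop), lintegral_const_mul _ (by fun_prop)]
          _ ≤ _ := by
              gcongr
              exact lintegral_weight_mul_sqrt_le hM hs
    _ = N₃ * 2 * (I₁ * (∫⁻ s in Set.Ioi (0 : ℝ), waveMajorant ψ x s) +
          I₀ * ∫⁻ s in Set.Ioi (0 : ℝ), ENNReal.ofReal (Real.sqrt s) * waveMajorant ψ x s) := by
        rw [← lintegral_const_mul _ hx, ← lintegral_const_mul _ (by fun_prop),
          ← lintegral_add_left (by fun_prop), ← lintegral_const_mul _ (by fun_prop)]
        refine lintegral_congr fun s => ?_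
        ring
    _ ≤ _ := by
        gcongr
        · exact h1 x
        · exact h2 x

/-! ### The structure of `S₁ D₁ S₁` -/

theorem finrank_spanV_le_one (V : Plane → ℝ) : Module.finrank ℂ (spanV V) ≤ 1 := by
  have h : {f : L2 | ∀ᵐ x : Plane, f x = (sqrtAbs V x : ℂ)}.Subsingleton := by
    intro f hf g hg
    apply Lp.ext
    filter_upwards [hf, hg] with x h1 h2
    rw [h1, h2]
  rcases h.eq_empty_or_singleton with h0 | ⟨w, hw⟩
  · rw [spanV, h0, Submodule.span_empty, finrank_bot]
    exact zero_le_one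
  · rw [spanV, hw]
    exact (finrank_span_le_card {w}).trans (by simp)

/-- The map f ↦ PTf is injective on S₁L², because T₁f = S₁T(PTf) vanishes with it and T₁ is
invertible; its target, the span of v, has dimension at most one. -/
theorem exists_generator_spaceS1 {V : Plane → ℝ} (h : IsUnit (opT1 V)) :
    ∃ e : spaceS1 V, ∀ w : spaceS1 V, ∃ c : ℂ, c • e = w := by
  obtain ⟨D, hD⟩ := h.exists_left_inv
  set L : spaceS1 V →ₗ[ℂ] spanV V :=
    ((spanV V).orthogonalProjectionOnto ∘L thresholdOp V ∘L (spaceS1 V).subtypeL).toLinearMap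
    with hL
  have hinj : Function.Injective L := by
    rw [← LinearMap.ker_eq_bot, LinearMap.ker_eq_bot']
    intro f hf
    have h1 : projP V (thresholdOp V f) = 0 := by
      have h2 : ((L f : spanV V) : L2) = 0 := by rw [hf]; rfl
      exact h2
    have h3 : opT1 V f = 0 := by
      simp only [opT1, compress, ContinuousLinearMap.comp_apply, Submodule.subtypeL_apply, h1,
        map_zero]
    have h4 : (D * opT1 V) f = f := by rw [hD]; rfl
    rw [← h4]
    change D (opT1 V f) = 0
    rw [h3, map_zero]
  have : FiniteDimensional ℂ (spaceS1 V) := FiniteDimensional.of_injective L hinj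
  exact finrank_le_one_iff.1
    ((LinearMap.finrank_le_finrank_of_injective hinj).trans (finrank_spanV_le_one V))

/-- If `T₁` is invertible then `S₁ D₁ S₁` has rank at most one. -/
theorem exists_opS1D1S1_eq {V : Plane → ℝ} (h : IsUnit (opT1 V)) :
    ∃ φ ∈ spaceS1 V, ∃ c : ℂ, ∀ f : L2, opS1D1S1 V f = (c * inner ℂ φ f) • φ := by
  obtain ⟨e, he⟩ := exists_generator_spaceS1 h
  obtain ⟨β, hβ⟩ := he (Ring.inverse (opT1 V) e)
  -- On the generator D₁e = βe, and the coefficient of the projection of f is ⟨e,f⟩/⟨e,e⟩. If e = 0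
  -- the quotient is the default value 0, and both sides vanish.
  refine ⟨e, e.2, β / (inner ℂ (e : L2) (e : L2)), fun f => ?_⟩
  obtain ⟨α, hα⟩ := he ((spaceS1 V).orthogonalProjectionOnto f)
  have h1 : opS1D1S1 V f = (α * β) • (e : L2) := by
    simp only [opS1D1S1, ContinuousLinearMap.comp_apply, Submodule.subtypeL_apply]
    rw [← hα, map_smul, ← hβ, smul_smul, Submodule.coe_smul]
  rw [h1]
  rcases eq_or_ne (e : L2) 0 with h0 | h0
  · rw [h0, smul_zero, smul_zero]
  · have h2 : inner ℂ (e : L2) f = α * inner ℂ (e : L2) (e : L2) := by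
      rw [← Submodule.inner_orthogonalProjectionOnto_eq_of_mem_left e f, ← hα,
        Submodule.coe_inner, Submodule.coe_smul, inner_smul_right]
    have h3 : inner ℂ (e : L2) (e : L2) ≠ 0 := inner_self_ne_zero.2 h0
    rw [h2]
    congr 1
    field_simp

/-! ### Decay of the potential -/

section Potential

variable {V : Plane → ℝ}

/-- One power of decay is spent on the weight and two are left, enough for both boundedness and
square integrability in the plane. -/
theorem sqrtAbs_mul_bracket_le
    (hdecay : ∃ C δ : ℝ, 0 < δ ∧ ∀ x : Plane, sqrtAbs V x ≤ C * bracket x ^ (-3 - δ)) :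
    ∃ C : ℝ, 0 ≤ C ∧ ∀ x : Plane, sqrtAbs V x * (1 + ‖x‖) ≤ C * (1 + ‖x‖ ^ 2) ^ (-1 : ℝ) := by
  obtain ⟨C, δ, hδ, hC⟩ := hdecay
  have hb : ∀ x : Plane, 1 ≤ bracket x := fun x => by
    rw [bracket, Real.one_le_sqrt]
    nlinarith [sq_nonneg ‖x‖]
  have hb2 : ∀ x : Plane, bracket x ^ 2 = 1 + ‖x‖ ^ 2 := fun x => Real.sq_sqrt (by positivity)
  have hC0 : 0 ≤ C := by
    have h := (Real.sqrt_nonneg _).trans (hC 0)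
    have hp : 0 < bracket (0 : Plane) ^ (-3 - δ) := Real.rpow_pos_of_pos (by linarith [hb 0]) _
    exact nonneg_of_mul_nonneg_left h hp
  refine ⟨2 * C, by positivity, fun x => ?_⟩
  have hx := hb x
  have hx0 : 0 < bracket x := by linarith
  have h1 : bracket x ^ (-3 - δ) ≤ bracket x ^ (-3 : ℝ) :=
    Real.rpow_le_rpow_of_exponent_le hx (by linarith)
  have h2 : 1 + ‖x‖ ≤ 2 * bracket x := by
    have : ‖x‖ ≤ bracket x := Real.le_sqrt_of_sq_le (by linarith)
    linarith
  have h3 : bracket x ^ (-3 : ℝ) * bracket x = (1 + ‖x‖ ^ 2) ^ (-1 : ℝ) := by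
    rw [← hb2, ← Real.rpow_natCast, ← Real.rpow_mul hx0.le]
    nth_rewrite 2 [← Real.rpow_one (bracket x)]
    rw [← Real.rpow_add hx0]
    norm_num
  calc sqrtAbs V x * (1 + ‖x‖) ≤ C * bracket x ^ (-3 : ℝ) * (2 * bracket x) := by
        have := hC x
        gcongr
        exact this.trans (by gcongr)
    _ = 2 * C * (bracket x ^ (-3 : ℝ) * bracket x) := by ring
    _ = _ := by rw [h3]

theorem memLp_sqrtAbs_mul (hV : Measurable V) (hdecay : ∃ C δ : ℝ, 0 < δ ∧
    ∀ x : Plane, sqrtAbs V x ≤ C * bracket x ^ (-3 - δ)) :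
    MemLp (fun x : Plane => sqrtAbs V x * (1 + ‖x‖)) 2 (volume : Measure Plane) := by
  obtain ⟨C, hC0, hC⟩ := sqrtAbs_mul_bracket_le hdecay
  have hv := measurable_sqrtAbs hV
  have hfin : Module.finrank ℝ Plane = 2 := by simp
  have hj : MemLp (fun x : Plane => (1 + ‖x‖ ^ 2) ^ (-1 : ℝ)) 2 (volume : Measure Plane) := by
    refine (memLp_two_iff_integrable_sq (Measurable.aestronglyMeasurable (by fun_prop))).2 ?_
    have := integrable_rpow_neg_one_add_norm_sq (μ := (volume : Measure Plane)) (r := 4)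
      (by rw [hfin]; norm_num)
    refine this.congr (Eventually.of_forall fun x => ?_)
    simp only
    rw [← Real.rpow_mul_natCast (by positivity)]
    norm_num
  refine (hj.const_mul C).mono (Measurable.aestronglyMeasurable (by fun_prop))
    (Eventually.of_forall fun x => ?_)
  have h0 : 0 ≤ sqrtAbs V x := Real.sqrt_nonneg _
  rw [Real.norm_of_nonneg (by positivity), Real.norm_of_nonneg (by positivity)]
  exact hC x

theorem memLp_sqrtAbs (hV : Measurable V) (hdecay : ∃ C δ : ℝ, 0 < δ ∧
    ∀ x : Plane, sqrtAbs V x ≤ C * bracket x ^ (-3 - δ)) :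
    MemLp (fun x : Plane => (sqrtAbs V x : ℂ)) 2 (volume : Measure Plane) := by
  have hv := measurable_sqrtAbs hV
  refine (memLp_sqrtAbs_mul hV hdecay).mono (Measurable.aestronglyMeasurable (by fun_prop))
    (Eventually.of_forall fun x => ?_)
  have h0 : 0 ≤ sqrtAbs V x := Real.sqrt_nonneg _
  rw [Complex.norm_real, Real.norm_of_nonneg h0, Real.norm_of_nonneg (by positivity)]
  exact le_mul_of_one_le_right h0 (by linarith [norm_nonneg x])

/-- S₁L² is contained in QL², the orthogonal complement of v, and v is real. This cancellation
drives the whole argument. -/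
theorem integral_sqrtAbs_mul_eq_zero (hV : Measurable V)
    (hdecay : ∃ C δ : ℝ, 0 < δ ∧ ∀ x : Plane, sqrtAbs V x ≤ C * bracket x ^ (-3 - δ))
    {φ : L2} (hφ : φ ∈ spaceS1 V) : ∫ x, (sqrtAbs V x : ℂ) * φ x = 0 := by
  have hv := memLp_sqrtAbs hV hdecay
  obtain ⟨f, -, rfl⟩ := hφ
  have h1 : hv.toLp _ ∈ spanV V := Submodule.subset_span hv.coeFn_toLp
  have h2 : inner ℂ (hv.toLp _) (f : L2) = 0 := (Submodule.mem_orthogonal _ _).1 f.2 _ h1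
  rw [L2.inner_def] at h2
  rw [← h2]
  refine integral_congr_ae ?_
  filter_upwards [hv.coeFn_toLp] with x hx
  simp [hx, mul_comm]

/-- The weighted v is both square integrable, so that Cauchy–Schwarz with φ gives the first moment,
and bounded, so that the squared moment is controlled by |φ|². -/
theorem neutralDensity_sqrtAbs_mul (hV : Measurable V)
    (hdecay : ∃ C δ : ℝ, 0 < δ ∧ ∀ x : Plane, sqrtAbs V x ≤ C * bracket x ^ (-3 - δ))
    {φ : L2} (hφ : φ ∈ spaceS1 V) : NeutralDensity fun x => (sqrtAbs V x : ℂ) * φ x where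
  stronglyMeasurable := by
    have hv := measurable_sqrtAbs hV
    exact (Measurable.stronglyMeasurable (by fun_prop)).mul (Lp.stronglyMeasurable φ)
  integrable_weight := by
    have h := (memLp_sqrtAbs_mul hV hdecay).integrable_mul (Lp.memLp φ).norm
    refine h.congr (Eventually.of_forall fun x => ?_)
    have h0 : 0 ≤ sqrtAbs V x := Real.sqrt_nonneg _
    simp only [Pi.mul_apply, norm_mul, Complex.norm_real, Real.norm_of_nonneg h0]
    ring
  integrable_weight_sq := by
    obtain ⟨C, hC0, hC⟩ := sqrtAbs_mul_bracket_le hdecay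
    have hv := measurable_sqrtAbs hV
    have h := (memLp_two_iff_integrable_sq_norm (Lp.aestronglyMeasurable φ)).1 (Lp.memLp φ)
    have hφm := (Lp.stronglyMeasurable φ).measurable
    refine (h.const_mul (C ^ 2)).mono' (Measurable.aestronglyMeasurable (by fun_prop))
      (Eventually.of_forall fun x => ?_)
    have h0 : 0 ≤ sqrtAbs V x := Real.sqrt_nonneg _
    rw [Real.norm_of_nonneg (sq_nonneg _), norm_mul, Complex.norm_real, Real.norm_of_nonneg h0,
      ← mul_pow]
    have h1 : sqrtAbs V x * (1 + ‖x‖) ≤ C := by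
      refine (hC x).trans (mul_le_of_le_one_right hC0 ?_)
      exact Real.rpow_le_one_of_one_le_of_nonpos (by nlinarith [sq_nonneg ‖x‖]) (by norm_num)
    refine pow_le_pow_left₀ (by positivity) ?_ 2
    calc sqrtAbs V x * ‖φ x‖ * (1 + ‖x‖) = sqrtAbs V x * (1 + ‖x‖) * ‖φ x‖ := by ring
      _ ≤ C * ‖φ x‖ := by gcongr
  integral_eq_zero := integral_sqrtAbs_mul_eq_zero hV hdecay hφ

end Potential

/-! ### The jump of the resolvent -/

theorem continuous_besselJ0 : Continuous besselJ0 := by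
  unfold besselJ0
  refine continuous_const.mul ?_
  exact intervalIntegral.continuous_parametric_intervalIntegral_of_continuous' (by fun_prop) _ _

@[fun_prop]
theorem measurable_besselJ0_comp {α : Type*} [MeasurableSpace α] {f : α → ℝ} (hf : Measurable f) :
    Measurable fun a => besselJ0 (f a) :=
  continuous_besselJ0.measurable.comp hf

theorem abs_besselJ0_le (r : ℝ) : |besselJ0 r| ≤ 1 := by
  have h := intervalIntegral.norm_integral_le_of_norm_le_const (a := 0) (b := Real.pi) (C := 1)
    (f := fun θ => Real.cos (r * Real.sin θ)) (fun θ _ => Real.abs_cos_le_one _)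
  rw [besselJ0, abs_mul, abs_of_pos (by positivity : 0 < 1 / Real.pi)]
  rw [sub_zero, abs_of_pos Real.pi_pos, one_mul, Real.norm_eq_abs] at h
  calc 1 / Real.pi * |∫ θ in (0 : ℝ)..Real.pi, Real.cos (r * Real.sin θ)|
      ≤ 1 / Real.pi * Real.pi := by gcongr
    _ = 1 := one_div_mul_cancel Real.pi_ne_zero

/-- The Y₀ parts cancel, and with them the logarithmic singularity. The jump is a bounded kernel, so
it acts on every integrable u. -/
theorem freeResolventPlus_sub (lam : ℝ) (w y : Plane) :
    freeResolventPlus lam w y - freeResolventMinus lam w y =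
      Complex.I / 2 * (besselJ0 (lam * ‖w - y‖) : ℂ) := by
  rw [freeResolventPlus, freeResolventMinus, hankelPlus, hankelMinus]
  ring

theorem norm_besselJ0_le (r : ℝ) : ‖(besselJ0 r : ℂ)‖ ≤ 1 := by
  rw [Complex.norm_real]
  exact abs_besselJ0_le r

theorem integrable_besselJ0_mul {u : Plane → ℂ} (hu : Integrable u) (lam : ℝ) (w : Plane) :
    Integrable fun y => (besselJ0 (lam * ‖w - y‖) : ℂ) * u y :=
  hu.bdd_mul (c := 1) (Measurable.aestronglyMeasurable (by fun_prop))
    (Eventually.of_forall fun _ => norm_besselJ0_le _)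

theorem integrable_resolventJump_mul {u : Plane → ℂ} (hu : Integrable u) (lam : ℝ) (w : Plane) :
    Integrable fun y => (freeResolventPlus lam w y - freeResolventMinus lam w y) * u y := by
  simp_rw [freeResolventPlus_sub, mul_assoc]
  exact (integrable_besselJ0_mul hu lam w).const_mul _

theorem rightFactor_eq (V : Plane → ℝ) (lam : ℝ) (u : Plane → ℂ) (w : Plane) :
    rightFactor V lam u w =
      (sqrtAbs V w : ℂ) * (Complex.I / 2 * ∫ y, (besselJ0 (lam * ‖w - y‖) : ℂ) * u y) := by
  simp_rw [rightFactor, freeResolventPlus_sub, mul_assoc]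
  rw [integral_const_mul]

/-- Since |J₀| ≤ 1, the function is dominated by half the L¹ norm of u times v, and v is square
integrable. -/
theorem memLp_rightFactor {V : Plane → ℝ} (hV : Measurable V)
    (hv : MemLp (fun x : Plane => (sqrtAbs V x : ℂ)) 2 (volume : Measure Plane))
    {u : Plane → ℂ} (hu : Integrable u) (lam : ℝ) :
    MemLp (rightFactor V lam u) 2 (volume : Measure Plane) := by
  have hvm := measurable_sqrtAbs hV
  have hm : AEStronglyMeasurable (fun w : Plane => ∫ y, (besselJ0 (lam * ‖w - y‖) : ℂ) * u y)
      (volume : Measure Plane) := by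
    refine AEStronglyMeasurable.integral_prod_right'
      (f := fun q : Plane × Plane => (besselJ0 (lam * ‖q.1 - q.2‖) : ℂ) * u q.2) ?_
    exact AEStronglyMeasurable.mul (Measurable.aestronglyMeasurable (by fun_prop)) hu.1.comp_snd
  refine (hv.const_mul ((1 / 2 * ∫ y, ‖u y‖ : ℝ) : ℂ)).mono ?_ (Eventually.of_forall fun w => ?_)
  · refine AEStronglyMeasurable.congr (f := fun w => (sqrtAbs V w : ℂ) *
      (Complex.I / 2 * ∫ y, (besselJ0 (lam * ‖w - y‖) : ℂ) * u y)) ?_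
      (Eventually.of_forall fun w => (rightFactor_eq V lam u w).symm)
    exact AEStronglyMeasurable.mul (Measurable.aestronglyMeasurable (by fun_prop)) (hm.const_mul _)
  · have h0 : 0 ≤ ∫ y, ‖u y‖ := integral_nonneg fun _ => norm_nonneg _
    rw [rightFactor_eq, norm_mul, norm_mul, norm_mul, mul_comm, Complex.norm_real (1 / 2 * _),
      Real.norm_of_nonneg (by positivity)]
    gcongr
    · simp
    · refine (norm_integral_le_integral_norm _).trans ?_
      refine integral_mono (integrable_besselJ0_mul hu lam w).norm hu.norm fun y => ?_
      simp only [norm_mul]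
      exact mul_le_of_le_one_left (norm_nonneg _) (norm_besselJ0_le _)

/-- The transform of the density against the jump of the resolvent. -/
def jumpTransform (ψ : Plane → ℂ) (lam : ℝ) (y : Plane) : ℂ :=
  fieldTransform (fun z => (starRingEnd ℂ) (ψ z)) lam y - (starRingEnd ℂ) (fieldTransform ψ lam y)

theorem NeutralDensity.stronglyMeasurable_jumpTransform {ψ : Plane → ℂ} (hψ : NeutralDensity ψ)
    {α : Type*} [MeasurableSpace α] {f : α → ℝ} {g : α → Plane} (hf : Measurable f)
    (hg : Measurable g) : StronglyMeasurable fun a => jumpTransform ψ (f a) (g a) :=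
  (hψ.conj.stronglyMeasurable_fieldTransform hf hg).sub
    (Complex.continuous_conj.comp_stronglyMeasurable (hψ.stronglyMeasurable_fieldTransform hf hg))

theorem NeutralDensity.exists_norm_jumpTransform_le {ψ : Plane → ℂ} (hψ : NeutralDensity ψ) :
    ∃ N : ℝ, ∀ (lam : ℝ) (x : Plane), ‖jumpTransform ψ lam x‖ ≤ N := by
  obtain ⟨N₁, h1⟩ := hψ.conj.exists_norm_fieldTransform_le
  obtain ⟨N₂, h2⟩ := hψ.exists_norm_fieldTransform_le
  refine ⟨N₁ + N₂, fun lam x => (norm_sub_le _ _).trans (add_le_add (h1 lam x) ?_)⟩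
  rw [RCLike.norm_conj]
  exact h2 lam x

/-- Fubini moves the Bessel kernel from u onto the conjugate of ψ, where it can be expressed through
the wave field. -/
theorem inner_rightFactor {V : Plane → ℝ} {φ : L2}
    (hψ : NeutralDensity fun x => (sqrtAbs V x : ℂ) * φ x) {u : Plane → ℂ} (hu : Integrable u)
    {lam : ℝ} (hlam : 0 < lam) (hg : MemLp (rightFactor V lam u) 2 (volume : Measure Plane)) :
    inner ℂ φ (hg.toLp _) = Complex.I / 2 * (Complex.I / Real.pi) *
      ∫ y, jumpTransform (fun x => (sqrtAbs V x : ℂ) * φ x) lam y * u y := by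
  set ψ : Plane → ℂ := fun x => (sqrtAbs V x : ℂ) * φ x with hψdef
  have hI : Integrable (fun q : Plane × Plane =>
      (starRingEnd ℂ) (ψ q.1) * ((besselJ0 (lam * ‖q.1 - q.2‖) : ℂ) * u q.2)) := by
    have h := (Integrable.mul_prod hψ.conj.integrable hu).bdd_mul (c := 1)
      (f := fun q : Plane × Plane => (besselJ0 (lam * ‖q.1 - q.2‖) : ℂ))
      (Measurable.aestronglyMeasurable (by fun_prop))
      (Eventually.of_forall fun _ => norm_besselJ0_le _)
    refine h.congr (Eventually.of_forall fun q => ?_)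
    simp only
    ring
  calc inner ℂ φ (hg.toLp _)
      = ∫ w, Complex.I / 2 * ∫ y, (starRingEnd ℂ) (ψ w) *
          ((besselJ0 (lam * ‖w - y‖) : ℂ) * u y) := by
        rw [L2.inner_def]
        refine integral_congr_ae ?_
        filter_upwards [hg.coeFn_toLp] with w hw
        rw [hw, rightFactor_eq, integral_const_mul]
        simp only [hψdef, RCLike.inner_apply, map_mul, Complex.conj_ofReal]
        ring
    _ = Complex.I / 2 * ∫ y, ∫ w, (starRingEnd ℂ) (ψ w) *
          ((besselJ0 (lam * ‖w - y‖) : ℂ) * u y) := by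
        rw [integral_const_mul, integral_integral_swap hI]
    _ = Complex.I / 2 * ∫ y, Complex.I / Real.pi * (jumpTransform ψ lam y * u y) := by
        congr 1
        refine integral_congr_ae (Eventually.of_forall fun y => ?_)
        simp only
        have h := hψ.integral_conj_mul_besselJ0 hlam y
        simp_rw [← mul_assoc]
        rw [integral_mul_const, jumpTransform, ← h]
        simp_rw [norm_sub_rev y]
    _ = _ := by
        rw [integral_const_mul]
        ring

/-! ### The kernel of the low energy operator -/

section Kernel

variable {ψ : Plane → ℂ} {m : ℝ → ℂ}

/-- The kernel of the low energy operator, up to a constant. -/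
def lowEnergyKernel (ψ : Plane → ℂ) (m : ℝ → ℂ) (x y : Plane) : ℂ :=
  ∫ lam in Set.Ioi (0 : ℝ), m lam * (fieldTransform ψ lam x * jumpTransform ψ lam y)

theorem NeutralDensity.stronglyMeasurable_lowEnergyKernel (hψ : NeutralDensity ψ)
    (hm : StronglyMeasurable m) :
    StronglyMeasurable fun q : Plane × Plane => lowEnergyKernel ψ m q.1 q.2 := by
  refine StronglyMeasurable.integral_prod_right' (f := fun q : (Plane × Plane) × ℝ =>
    m q.2 * (fieldTransform ψ q.2 q.1.1 * jumpTransform ψ q.2 q.1.2)) ?_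
  exact (hm.comp_measurable measurable_snd).mul
    ((hψ.stronglyMeasurable_fieldTransform measurable_snd (measurable_fst.comp measurable_fst)).mul
      (hψ.stronglyMeasurable_jumpTransform measurable_snd (measurable_snd.comp measurable_fst)))

theorem NeutralDensity.integrable_lowEnergyKernel_prod (hψ : NeutralDensity ψ)
    (hm : IntegrableOn m (Set.Ioi 0)) {u : Plane → ℂ} (hu : Integrable u) (x : Plane) :
    Integrable (fun q : ℝ × Plane => m q.1 * fieldTransform ψ q.1 x *
      (jumpTransform ψ q.1 q.2 * u q.2)) ((volume.restrict (Set.Ioi 0)).prod volume) := by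
  obtain ⟨N₁, h1⟩ := hψ.exists_norm_fieldTransform_le
  obtain ⟨N₂, h2⟩ := hψ.exists_norm_jumpTransform_le
  have hN₁ : 0 ≤ N₁ := (norm_nonneg _).trans (h1 0 0)
  have h := (Integrable.mul_prod hm hu).bdd_mul (c := N₁ * N₂)
    ((hψ.stronglyMeasurable_fieldTransform measurable_fst (measurable_const (a := x))).mul
      (hψ.stronglyMeasurable_jumpTransform measurable_fst measurable_snd)).aestronglyMeasurable
    (Eventually.of_forall fun q => by
      rw [Pi.mul_apply, norm_mul]
      exact mul_le_mul (h1 _ _) (h2 _ _) (norm_nonneg _) hN₁)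
  refine h.congr (Eventually.of_forall fun q => ?_)
  simp only [Pi.mul_apply]
  ring

theorem integrableOn_mul_of_bounded
    (hm : IntegrableOn m (Set.Ioi 0)) {F G : ℝ → ℂ} {N₁ N₂ : ℝ} (hF : StronglyMeasurable F)
    (hG : StronglyMeasurable G) (h1 : ∀ lam, ‖F lam‖ ≤ N₁) (h2 : ∀ lam, ‖G lam‖ ≤ N₂) :
    IntegrableOn (fun lam => m lam * (F lam * G lam)) (Set.Ioi 0) := by
  refine hm.mul_bdd (c := N₁ * N₂) (hF.mul hG).aestronglyMeasurable ?_
  refine Eventually.of_forall fun lam => ?_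
  rw [norm_mul]
  exact mul_le_mul (h1 _) (h2 _) (norm_nonneg _) ((norm_nonneg _).trans (h1 lam))

theorem NeutralDensity.integral_lowEnergyKernel_mul (hψ : NeutralDensity ψ)
    (hm : IntegrableOn m (Set.Ioi 0)) {u : Plane → ℂ} (hu : Integrable u) (x : Plane) :
    ∫ lam in Set.Ioi (0 : ℝ), m lam * fieldTransform ψ lam x * ∫ y, jumpTransform ψ lam y * u y =
      ∫ y, lowEnergyKernel ψ m x y * u y := by
  simp_rw [← integral_const_mul]
  rw [integral_integral_swap (hψ.integrable_lowEnergyKernel_prod hm hu x)]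
  refine integral_congr_ae (Eventually.of_forall fun y => ?_)
  simp only
  rw [lowEnergyKernel, ← integral_mul_const]
  refine integral_congr_ae (Eventually.of_forall fun lam => ?_)
  simp only
  ring

/-- Conjugation reverses the phase, which brings the second half of `jumpTransform` into the form of
`enorm_integral_mul_halfFourier_le` with ε = -1. -/
theorem conj_fieldTransform (ψ : Plane → ℂ) (lam : ℝ) (y : Plane) :
    (starRingEnd ℂ) (fieldTransform ψ lam y) = ∫ t in Set.Ioi (0 : ℝ),
      Complex.exp (-Complex.I * lam * ((-1) * t : ℝ)) *
        waveField (fun z => (starRingEnd ℂ) (ψ z)) y t := by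
  rw [fieldTransform, ← integral_conj]
  refine integral_congr_ae (Eventually.of_forall fun t => ?_)
  simp only
  rw [waveField_conj, map_mul, ← Complex.exp_conj]
  simp

theorem NeutralDensity.lintegral_enorm_waveField_le (hψ : NeutralDensity ψ) {M : ℝ → ℝ≥0∞}
    (hM : Measurable M) (hmM : ∀ σ, ‖halfFourier m σ‖ₑ ≤ M |σ|) (ε : ℝ) (x y : Plane) :
    ∫⁻ q : ℝ × ℝ, ‖waveField ψ x q.1‖ₑ * ‖waveField (fun z => (starRingEnd ℂ) (ψ z)) y q.2‖ₑ *
        ‖halfFourier m (q.1 + ε * q.2)‖ₑ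
        ∂((volume.restrict (Set.Ioi 0)).prod (volume.restrict (Set.Ioi 0))) ≤
      4 * ∫⁻ s in Set.Ioi (0 : ℝ), ∫⁻ t in Set.Ioi (0 : ℝ),
        waveMajorant ψ x s * waveMajorant ψ y t * M |s + ε * t| := by
  have hx : Measurable (waveMajorant ψ x) := hψ.measurable_waveMajorant measurable_const measurable_id
  have hy : Measurable (waveMajorant ψ y) := hψ.measurable_waveMajorant measurable_const measurable_id
  have hmeas : Measurable fun q : ℝ × ℝ =>
      waveMajorant ψ x q.1 * waveMajorant ψ y q.2 * M |q.1 + ε * q.2| := by fun_prop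
  rw [← lintegral_prod (fun q : ℝ × ℝ =>
      waveMajorant ψ x q.1 * waveMajorant ψ y q.2 * M |q.1 + ε * q.2|) hmeas.aemeasurable,
    ← lintegral_const_mul _ hmeas, Measure.prod_restrict]
  refine setLIntegral_mono' (measurableSet_Ioi.prod measurableSet_Ioi) fun q hq => ?_
  have h1 := enorm_waveField_le ψ x hq.1
  have h2 := enorm_waveField_le (fun z => (starRingEnd ℂ) (ψ z)) y hq.2
  rw [waveMajorant_conj] at h2
  calc _ ≤ (2 * waveMajorant ψ x q.1) * (2 * waveMajorant ψ y q.2) * M |q.1 + ε * q.2| := by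
        gcongr
        exact hmM _
    _ = _ := by ring

/-- The two halves of `jumpTransform` produce m̂(s+t) and m̂(s-t), matching the two weights in
`pairMajorant`. No cancellation between them is used; the 4 is 2·2 from the two field bounds. -/
theorem NeutralDensity.enorm_lowEnergyKernel_le (hψ : NeutralDensity ψ)
    (hm : IntegrableOn m (Set.Ioi 0)) {M : ℝ → ℝ≥0∞} (hM : Measurable M)
    (hmM : ∀ σ, ‖halfFourier m σ‖ₑ ≤ M |σ|) (x y : Plane) :
    ‖lowEnergyKernel ψ m x y‖ₑ ≤ 4 * pairMajorant ψ M x y := by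
  obtain ⟨N₁, h1⟩ := hψ.exists_norm_fieldTransform_le
  obtain ⟨N₂, h2⟩ := hψ.conj.exists_norm_fieldTransform_le
  have hslice : ∀ (θ : Plane → ℂ) (p : Plane), NeutralDensity θ →
      StronglyMeasurable fun lam => fieldTransform θ lam p := fun θ p hθ =>
    hθ.stronglyMeasurable_fieldTransform measurable_id measurable_const
  have hi1 := integrableOn_mul_of_bounded hm (hslice ψ x hψ) (hslice _ y hψ.conj)
    (fun lam => h1 lam x) (fun lam => h2 lam y)
  have hi2 := integrableOn_mul_of_bounded hm (hslice ψ x hψ)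
    (Complex.continuous_conj.comp_stronglyMeasurable (hslice ψ y hψ))
    (fun lam => h1 lam x) (fun lam => (RCLike.norm_conj _).trans_le (h1 lam y))
  have hx : Measurable (waveMajorant ψ x) := hψ.measurable_waveMajorant measurable_const measurable_id
  have hy : Measurable (waveMajorant ψ y) := hψ.measurable_waveMajorant measurable_const measurable_id
  have key : ∀ ε : ℝ, ‖∫ lam in Set.Ioi (0 : ℝ), m lam * (fieldTransform ψ lam x *
      ∫ t in Set.Ioi (0 : ℝ), Complex.exp (-Complex.I * lam * (ε * t : ℝ)) *
        waveField (fun z => (starRingEnd ℂ) (ψ z)) y t)‖ₑ ≤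
      4 * ∫⁻ s in Set.Ioi (0 : ℝ), ∫⁻ t in Set.Ioi (0 : ℝ),
        waveMajorant ψ x s * waveMajorant ψ y t * M |s + ε * t| := fun ε =>
    (enorm_integral_mul_halfFourier_le hm (hψ.integrableOn_waveField x)
      (hψ.conj.integrableOn_waveField y) ε).trans (hψ.lintegral_enorm_waveField_le hM hmM ε x y)
  have hsplit : lowEnergyKernel ψ m x y =
      (∫ lam in Set.Ioi (0 : ℝ), m lam * (fieldTransform ψ lam x *
        fieldTransform (fun z => (starRingEnd ℂ) (ψ z)) lam y)) -
      ∫ lam in Set.Ioi (0 : ℝ), m lam * (fieldTransform ψ lam x *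
        (starRingEnd ℂ) (fieldTransform ψ lam y)) := by
    rw [← integral_sub hi1 hi2, lowEnergyKernel]
    refine integral_congr_ae (Eventually.of_forall fun lam => ?_)
    simp only [jumpTransform]
    ring
  have hplus := key 1
  have hminus := key (-1)
  simp_rw [← conj_fieldTransform] at hminus
  simp only [one_mul] at hplus
  rw [hsplit]
  refine (enorm_sub_le).trans ((add_le_add hplus hminus).trans_eq ?_)
  rw [← mul_add, pairMajorant, ← lintegral_add_left (Measurable.lintegral_prod_right'
    (f := fun q : ℝ × ℝ => waveMajorant ψ x q.1 * waveMajorant ψ y q.2 * M |q.1 + q.2|)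
    (by fun_prop))]
  congr 1
  refine lintegral_congr fun s => ?_
  rw [← lintegral_add_left (by fun_prop)]
  refine lintegral_congr fun t => ?_
  rw [neg_one_mul, ← sub_eq_add_neg]
  ring

theorem NeutralDensity.exists_schurKernel (hψ : NeutralDensity ψ) (hmm : StronglyMeasurable m)
    {m₁ m₂ : ℝ → ℂ} (hm : MildProfile m m₁ m₂) (c : ℂ) :
    ∃ C : ℝ≥0∞, SchurKernel volume (fun x y => c * lowEnergyKernel ψ m x y) C := by
  obtain ⟨A, hA0, hA⟩ := hm.exists_norm_halfFourier_le
  set M : ℝ → ℝ≥0∞ := fun τ => ENNReal.ofReal (A * (1 + τ) ^ (-(7 / 4 : ℝ))) with hM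
  have hMm : Measurable M := by fun_prop
  have hfin : ∀ r : ℝ, 1 < r → Integrable fun t : ℝ => A * (1 + |t|) ^ (-r) := fun r hr => by
    have := (integrable_one_add_norm (E := ℝ) (μ := volume) (r := r) (by simpa using hr)).const_mul A
    simpa using this
  have hM0 : ∫⁻ t, M |t| ≠ ⊤ := (hfin (7 / 4) (by norm_num)).lintegral_lt_top.ne
  -- The √|t| lowers the decay from 7/4 to 5/4, still above the threshold 1.
  have hM1 : ∫⁻ t, M |t| * ENNReal.ofReal (Real.sqrt |t|) ≠ ⊤ := by
    refine ne_top_of_le_ne_top (hfin (5 / 4) (by norm_num)).lintegral_lt_top.ne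
      (lintegral_mono fun t => ?_)
    simp only [hM]
    rw [← ENNReal.ofReal_mul (by positivity)]
    apply ENNReal.ofReal_le_ofReal
    have h1 : Real.sqrt |t| ≤ (1 + |t|) ^ (1 / 2 : ℝ) := by
      rw [← Real.sqrt_eq_rpow]
      exact Real.sqrt_le_sqrt (by linarith)
    calc A * (1 + |t|) ^ (-(7 / 4 : ℝ)) * Real.sqrt |t|
        ≤ A * (1 + |t|) ^ (-(7 / 4 : ℝ)) * (1 + |t|) ^ (1 / 2 : ℝ) := by gcongr
      _ = A * (1 + |t|) ^ (-(5 / 4 : ℝ)) := by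
          rw [mul_assoc, ← Real.rpow_add (by positivity)]
          norm_num
  obtain ⟨C, hC, hle⟩ := hψ.exists_lintegral_pairMajorant_le hMm hM0 hM1
  have hbound : ∀ x y, ‖c * lowEnergyKernel ψ m x y‖ₑ ≤ ‖c‖ₑ * 4 * pairMajorant ψ M x y := by
    intro x y
    rw [enorm_mul, mul_assoc]
    gcongr
    refine hψ.enorm_lowEnergyKernel_le hm.integrableOn hMm (fun σ => ?_) x y
    rw [← ofReal_norm]
    exact ENNReal.ofReal_le_ofReal (hA σ)
  have hc : ‖c‖ₑ * 4 ≠ ⊤ := ENNReal.mul_ne_top enorm_ne_top (by norm_num)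
  refine ⟨‖c‖ₑ * 4 * C, ?_, ENNReal.mul_ne_top hc hC, fun x => ?_, fun y => ?_⟩
  · exact (hψ.stronglyMeasurable_lowEnergyKernel hmm).const_mul c
  · refine (lintegral_mono (hbound x)).trans ?_
    rw [lintegral_const_mul' _ _ hc]
    gcongr
    exact hle x
  · refine (lintegral_mono fun x => hbound x y).trans ?_
    rw [lintegral_const_mul' _ _ hc]
    gcongr
    simp_rw [hψ.pairMajorant_comm hMm _ y]
    exact hle y

end Kernel

/-! ### The low energy operator as an integral operator -/

section Operator

variable {V : Plane → ℝ} {φ : L2} {c : ℂ} {u : Plane → ℂ} {lam : ℝ}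

theorem middleFactor_ae_eq (hB : ∀ f : L2, opS1D1S1 V f = (c * inner ℂ φ f) • φ)
    (hψ : NeutralDensity fun x => (sqrtAbs V x : ℂ) * φ x) (hu : Integrable u) (hlam : 0 < lam)
    (hg : MemLp (rightFactor V lam u) 2 (volume : Measure Plane)) :
    ∀ᵐ z : Plane, middleFactor V lam u z =
      c * (Complex.I / 2 * (Complex.I / Real.pi) *
        ∫ y, jumpTransform (fun x => (sqrtAbs V x : ℂ) * φ x) lam y * u y) *
        ((sqrtAbs V z : ℂ) * φ z) := by
  filter_upwards [Lp.coeFn_smul (c * inner ℂ φ (hg.toLp _)) φ] with z hz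
  -- The hypothesis `hg` selects the genuine branch of `applyFun` rather than its default 0.
  rw [middleFactor, applyFun, dif_pos hg, hB, hz, Pi.smul_apply, smul_eq_mul,
    inner_rightFactor hψ hu hlam hg]
  ring

theorem freeResolventMinus_mul_ae_eq (hB : ∀ f : L2, opS1D1S1 V f = (c * inner ℂ φ f) • φ)
    (hψ : NeutralDensity fun x => (sqrtAbs V x : ℂ) * φ x) (hu : Integrable u) (hlam : 0 < lam)
    (hg : MemLp (rightFactor V lam u) 2 (volume : Measure Plane)) (x : Plane) :
    ∀ᵐ z : Plane, freeResolventMinus lam x z * middleFactor V lam u z =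
      (-(Complex.I / 4) * (c * (Complex.I / 2 * (Complex.I / Real.pi) *
        ∫ y, jumpTransform (fun x => (sqrtAbs V x : ℂ) * φ x) lam y * u y))) *
        (hankelMinus (lam * ‖x - z‖) * ((sqrtAbs V z : ℂ) * φ z)) := by
  filter_upwards [middleFactor_ae_eq hB hψ hu hlam hg] with z hz
  rw [hz, freeResolventMinus]
  ring

/-- The constant in front of the kernel of the low energy operator. -/
def kernelConstant (c : ℂ) : ℂ :=
  -(Complex.I / 4) * (c * (Complex.I / 2 * (Complex.I / Real.pi))) * (2 * Complex.I / Real.pi)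

/-- The rank-one form separates the variables: the resolvent on the left acts on ψ alone, while u
enters only through the scalar coming from the jump. -/
theorem lowEnergyIntegrand_eq (hB : ∀ f : L2, opS1D1S1 V f = (c * inner ℂ φ f) • φ)
    (hψ : NeutralDensity fun x => (sqrtAbs V x : ℂ) * φ x) (hu : Integrable u) (hlam : 0 < lam)
    (hg : MemLp (rightFactor V lam u) 2 (volume : Measure Plane)) (a b : ℝ) (z : ℂ) (χ : ℝ → ℝ)
    (x : Plane) :
    lowEnergyIntegrand V (hMinus a b z) χ u x lam = kernelConstant c *
      (lowEnergyProfile a b z χ lam * fieldTransform (fun x => (sqrtAbs V x : ℂ) * φ x) lam x *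
        ∫ y, jumpTransform (fun x => (sqrtAbs V x : ℂ) * φ x) lam y * u y) := by
  rw [lowEnergyIntegrand, integral_congr_ae (freeResolventMinus_mul_ae_eq hB hψ hu hlam hg x),
    integral_const_mul, hψ.integral_hankelMinus_mul hlam, kernelConstant, lowEnergyProfile]
  ring

theorem lowEnergyOpConverges (hV : Measurable V)
    (hv : MemLp (fun x : Plane => (sqrtAbs V x : ℂ)) 2 (volume : Measure Plane))
    (hB : ∀ f : L2, opS1D1S1 V f = (c * inner ℂ φ f) • φ)
    (hψ : NeutralDensity fun x => (sqrtAbs V x : ℂ) * φ x) (hu : Integrable u) {a b : ℝ} {z : ℂ}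
    {χ : ℝ → ℝ} (hm : IntegrableOn (lowEnergyProfile a b z χ) (Set.Ioi 0)) :
    LowEnergyOpConverges V (hMinus a b z) χ u where
  right_integrable lam _ w := integrable_resolventJump_mul hu lam w
  right_memLp lam _ := memLp_rightFactor hV hv hu lam
  left_integrable lam hlam x := by
    exact (integrable_congr (freeResolventMinus_mul_ae_eq hB hψ hu hlam
      (memLp_rightFactor hV hv hu lam) x)).2 ((hψ.integrable_hankelMinus_mul hlam x).const_mul _)
  energy_integrable x := by
    have h := ((hψ.integrable_lowEnergyKernel_prod hm hu x).integral_prod_left).const_mul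
      (kernelConstant c)
    refine IntegrableOn.congr_fun h (fun lam hlam => ?_) measurableSet_Ioi
    simp only
    rw [integral_const_mul, lowEnergyIntegrand_eq hB hψ hu hlam (memLp_rightFactor hV hv hu lam)]

theorem lowEnergyOp_eq (hV : Measurable V)
    (hv : MemLp (fun x : Plane => (sqrtAbs V x : ℂ)) 2 (volume : Measure Plane))
    (hB : ∀ f : L2, opS1D1S1 V f = (c * inner ℂ φ f) • φ)
    (hψ : NeutralDensity fun x => (sqrtAbs V x : ℂ) * φ x) (hu : Integrable u) {a b : ℝ} {z : ℂ}
    {χ : ℝ → ℝ} (hm : IntegrableOn (lowEnergyProfile a b z χ) (Set.Ioi 0)) (x : Plane) :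
    lowEnergyOp V (hMinus a b z) χ u x =
      ∫ y, 1 / ((Real.pi : ℂ) * Complex.I) * kernelConstant c *
        lowEnergyKernel (fun x => (sqrtAbs V x : ℂ) * φ x) (lowEnergyProfile a b z χ) x y * u y := by
  rw [lowEnergyOp, setIntegral_congr_fun measurableSet_Ioi fun lam hlam =>
    lowEnergyIntegrand_eq hB hψ hu hlam (memLp_rightFactor hV hv hu lam) a b z χ x,
    integral_const_mul, hψ.integral_lowEnergyKernel_mul hm hu x, ← mul_assoc, ← integral_const_mul]
  simp_rw [mul_assoc]

end Operator

/-! ### Truncation to balls -/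

theorem integrable_indicator_ball {p : ℝ≥0∞} [Fact (1 ≤ p)] (u : Lp ℂ p (volume : Measure Plane))
    (R : ℝ) : Integrable ((Metric.ball (0 : Plane) R).indicator u) := by
  rw [integrable_indicator_iff measurableSet_ball]
  have : IsFiniteMeasure ((volume : Measure Plane).restrict (Metric.ball 0 R)) :=
    ⟨by rw [Measure.restrict_apply_univ]; exact measure_ball_lt_top⟩
  exact ((Lp.memLp u).restrict _).integrable Fact.out

/-- Every y eventually lies in the ball, and |fu| dominates all truncations. -/
theorem tendsto_integral_mul_indicator_ball {f u : Plane → ℂ}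
    (h : Integrable fun y => f y * u y) :
    Tendsto (fun R : ℝ => ∫ y, f y * (Metric.ball (0 : Plane) R).indicator u y) atTop
      (𝓝 (∫ y, f y * u y)) := by
  have e : ∀ R y, f y * (Metric.ball (0 : Plane) R).indicator u y =
      (Metric.ball (0 : Plane) R).indicator (fun y => f y * u y) y := fun R y =>
    (Set.indicator_mul_right _ _ _).symm
  simp_rw [e]
  refine tendsto_integral_filter_of_dominated_convergence (fun y => ‖f y * u y‖) ?_ ?_ h.norm ?_
  · exact Eventually.of_forall fun R => h.1.indicator measurableSet_ball
  · exact Eventually.of_forall fun R => Eventually.of_forall fun y => norm_indicator_le_norm_self _ _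
  · refine Eventually.of_forall fun y => tendsto_const_nhds.congr' ?_
    filter_upwards [eventually_gt_atTop ‖y‖] with R hR
    rw [Set.indicator_of_mem (by simpa using hR)]

theorem stronglyMeasurable_lowEnergyProfile (a b : ℝ) (z : ℂ) {χ : ℝ → ℝ} (hχ : Continuous χ) :
    StronglyMeasurable (lowEnergyProfile a b z χ) := by
  have := hχ.measurable
  unfold lowEnergyProfile hMinus
  exact Measurable.stronglyMeasurable (by fun_prop)

end PlanarSchrodinger

end

open PlanarSchrodinger
theorem proposition3p1
    (V : Plane → ℝ) (hV : Measurable V)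
    (hdecay : ∃ C δ : ℝ, 0 < δ ∧ ∀ x : Plane, sqrtAbs V x ≤ C * bracket x ^ (-3 - δ))
    (hres : FirstKindResonance V)
    (a b : ℝ) (z : ℂ)
    (lam₁ : ℝ) (hlam₁ : 0 < lam₁)
    (χ : ℝ → ℝ) (hχ : ContDiff ℝ ∞ χ)
    (hχ_one : ∀ lam : ℝ, 0 < lam → lam < lam₁ → χ lam = 1)
    (hχ_zero : ∀ lam : ℝ, 2 * lam₁ < lam → χ lam = 0) :
    (∀ u : Plane → ℂ, Integrable u → LowEnergyOpConverges V (hMinus a b z) χ u) ∧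
    ∀ (p : ℝ≥0∞) [Fact (1 ≤ p)],
      ∃ B : Lp ℂ p (volume : Measure Plane) →L[ℂ] Lp ℂ p (volume : Measure Plane),
        (∀ u : Lp ℂ p (volume : Measure Plane), Integrable u →
          ∀ᵐ x : Plane, B u x = lowEnergyOp V (hMinus a b z) χ u x) ∧
        (∀ u : Lp ℂ p (volume : Measure Plane), ∀ᵐ x : Plane,
          Tendsto
            (fun R : ℝ =>
              lowEnergyOp V (hMinus a b z) χ ((Metric.ball (0 : Plane) R).indicator u) x)
            atTop (𝓝 (B u x))) := by
  obtain ⟨φ, hφ, c, hB⟩ := exists_opS1D1S1_eq hres.2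
  have hv := memLp_sqrtAbs hV hdecay
  have hψ := neutralDensity_sqrtAbs_mul hV hdecay hφ
  obtain ⟨m₁, m₂, hm⟩ := exists_mildProfile_lowEnergyProfile a b z (R := 2 * lam₁) (by linarith)
    hχ hχ_zero
  refine ⟨fun u hu => lowEnergyOpConverges hV hv hB hψ hu hm.integrableOn, fun p _ => ?_⟩
  -- The kernel does not depend on p, so the extensions to the different L^p are all given by the
  -- same integral.
  obtain ⟨C, hK⟩ := hψ.exists_schurKernel (stronglyMeasurable_lowEnergyProfile a b z hχ.continuous)
    hm (1 / ((Real.pi : ℂ) * Complex.I) * kernelConstant c)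
  obtain ⟨B, hBu⟩ := hK.exists_continuousLinearMap p
  refine ⟨B, fun u hu => ?_, fun u => ?_⟩
  · filter_upwards [hBu u] with x hx
    rw [hx, lowEnergyOp_eq hV hv hB hψ hu hm.integrableOn]
  -- For u in L^p the kernel integral converges absolutely at almost every x. Each truncation is
  -- integrable, so there A coincides with the kernel operator and dominated convergence applies.
  · filter_upwards [hBu u, hK.ae_integrable Fact.out (Lp.stronglyMeasurable u) (Lp.memLp u)]
      with x hx hi
    rw [hx]
    simp_rw [lowEnergyOp_eq hV hv hB hψ (integrable_indicator_ball u _) hm.integrableOn]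
    exact tendsto_integral_mul_indicator_ball hi
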